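/- All manifolds, bundles and maps are smooth; manifolds are finite-dimensional, Hausdorff and second countable. For a Lie algebroid $A \to M$ with anchor $\rho$ and bracket $[\cdot,\cdot]$, let $d_A$ denote its differential, $$(d_A f)(a) = \rho(a) f, \qquad (d_A\alpha)(a,b) = \rho(a)(\alpha(b)) - \rho(b)(\alpha(a)) - \alpha([a,b]),$$ for $f \in C^\infty(M)$, $\alpha \in \Gamma(A^*)$, $a, b \in \Gamma(A)$, and let $$H^1(A) = \{\alpha \in \Gamma(A^*) : d_A \alpha = 0\} / d_A C^\infty(M).$$ Let $A \to M$ be a Lie algebroid and let $\phi : P \to M$ be a surjective submersion. The pull-back Lie algebroid $\phi^! A \to P$ has the fibre $$(\phi^! A)_p = \{(a,u) \in A_{\phi(p)} \oplus T_pP : \rho(a) = T\phi(u)\}$$ at $p \in P$, its anchor is $(a,u) \mapsto u$, and its bracket is given by $$\Big[\Big(\sum_i f_i \otimes b_i, u\Big), \Big(\sum_j g_j \otimes c_j, v\Big)\Big] = \Big(\sum_{i,j} f_i g_j \otimes [b_i, c_j] + \sum_j u(g_j) \otimes c_j - \sum_i v(f_i) \otimes b_i,\ [u,v]\Big)$$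 where $f_i, g_j \in C^\infty(P)$, $b_i, c_j \in \Gamma(A)$, and $u, v$ are vector fields on $P$. The canonical morphism $\phi^! A \to A$, $(a,u) \mapsto a$, induces a linear map $$\Phi : H^1(A) \to H^1(\phi^! A), \qquad \Phi[\alpha] = [\widehat{\alpha}], \quad \widehat{\alpha}_p(a,u) = \alpha_{\phi(p)}(a).$$ 1. If the fibres $\phi^{-1}(m)$, $m \in M$, are connected, then $\Phi$ is injective. 2. If the fibres $\phi^{-1}(m)$, $m \in M$, are connected and simply connected, then $\Phi$ is an isomorphism $H^1(A) \cong H^1(\phi^! A)$. -/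

import Mathlib

open Bundle
open scoped Manifold ContDiff

noncomputable section

open Set Filter Topology VectorField

set_option linter.unusedSectionVars false

section Calculus
variable {E X : Type*} [NormedAddCommGroup E] [NormedSpace ℝ E]
  [TopologicalSpace X] [ChartedSpace E X]

theorem contMDiff_mvfderiv_apply [IsManifold 𝓘(ℝ, E) ∞ X] {f : X → ℝ} {W : ∀ x, TangentSpace 𝓘(ℝ, E) x}
    (hf : ContMDiff 𝓘(ℝ, E) 𝓘(ℝ, ℝ) ∞ f)
    (hW : ContMDiff 𝓘(ℝ, E) 𝓘(ℝ, E).tangent ∞ (fun x => (⟨x, W x⟩ : TangentBundle 𝓘(ℝ, E) X))) :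
    ContMDiff 𝓘(ℝ, E) 𝓘(ℝ, ℝ) ∞ (fun x => mvfderiv 𝓘(ℝ, E) f x (W x)) := by
  have h1 := (hf.contMDiff_tangentMap (m := ∞) (by norm_num)).comp hW
  intro x
  have h2 := (contMDiffAt_totalSpace.1 (h1 x)).2
  simpa using! h2

variable [FiniteDimensional ℝ E] [T2Space X]

theorem exists_bump (x : X) (U : Set X) (hU : U ∈ 𝓝 x) [IsManifold 𝓘(ℝ, E) ∞ X] :
    ∃ ψ : X → ℝ, ContMDiff 𝓘(ℝ, E) 𝓘(ℝ, ℝ) ∞ ψ ∧ ψ =ᶠ[𝓝 x] 1 ∧ tsupport ψ ⊆ U := by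
  obtain ⟨ψ, -, hψ⟩ := ((SmoothBumpFunction.nhds_basis_tsupport (I := 𝓘(ℝ, E)) x).mem_iff).1 hU
  exact ⟨ψ, ψ.contMDiff, ψ.eventuallyEq_one, hψ⟩

theorem exists_global_section {F : Type*} [NormedAddCommGroup F] [NormedSpace ℝ F]
    {A : X → Type*} [TopologicalSpace (TotalSpace F A)] [∀ x, AddCommGroup (A x)]
    [∀ x, Module ℝ (A x)] [∀ x, TopologicalSpace (A x)] [FiberBundle F A] [VectorBundle ℝ F A]
    [IsManifold 𝓘(ℝ, E) ∞ X] {x : X} {U : Set X}  (hU : U ∈ 𝓝 x) {σ : ∀ y, A y}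
    (hσ : ContMDiffOn 𝓘(ℝ, E) (𝓘(ℝ, E).prod 𝓘(ℝ, F)) ∞ (fun y => TotalSpace.mk' F y (σ y)) U) :
    ∃ s : ContMDiffSection 𝓘(ℝ, E) F ∞ A, ∀ᶠ y in 𝓝 x, s y = σ y := by
  obtain ⟨ψ, h1, h2, h3⟩ := exists_bump (E := E) x (interior U) (interior_mem_nhds.2 hU)
  refine ⟨⟨ψ • σ, ContMDiffOn.smul_section_of_tsupport h1.contMDiffOn isOpen_interior h3 (hσ.mono interior_subset)⟩, ?_⟩
  filter_upwards [h2] with y hy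
  simp [hy]

theorem contMDiff_mlieBracket [IsManifold 𝓘(ℝ, E) ∞ X] {S T : ∀ x : X, TangentSpace 𝓘(ℝ, E) x}
    (hS : ContMDiff 𝓘(ℝ, E) 𝓘(ℝ, E).tangent ∞ (fun x => (⟨x, S x⟩ : TangentBundle 𝓘(ℝ, E) X)))
    (hT : ContMDiff 𝓘(ℝ, E) 𝓘(ℝ, E).tangent ∞ (fun x => (⟨x, T x⟩ : TangentBundle 𝓘(ℝ, E) X))) :
    ContMDiff 𝓘(ℝ, E) 𝓘(ℝ, E).tangent ∞
      (fun x => (⟨x, mlieBracket 𝓘(ℝ, E) S T x⟩ : TangentBundle 𝓘(ℝ, E) X)) := by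
  intro y
  have : IsManifold 𝓘(ℝ, E) (((⊤ : ℕ∞) : WithTop ℕ∞) + 1) X := by
    simpa using ‹IsManifold 𝓘(ℝ, E) ∞ X›
  have : IsManifold 𝓘(ℝ, E) (minSmoothness ℝ 3) X := by
    rw [minSmoothness_of_isRCLikeNormedField]; infer_instance
  exact ContMDiffAt.mlieBracket_vectorField (m := ⊤) (n := ⊤) (hS y) (hT y) (by simp)

theorem mvfderiv_mlieBracket [IsManifold 𝓘(ℝ, E) ∞ X] {f : X → ℝ} {V W : ∀ x, TangentSpace 𝓘(ℝ, E) x}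
    (hf : ContMDiff 𝓘(ℝ, E) 𝓘(ℝ, ℝ) ∞ f)
    (hV : ContMDiff 𝓘(ℝ, E) 𝓘(ℝ, E).tangent ∞ (fun x => (⟨x, V x⟩ : TangentBundle 𝓘(ℝ, E) X)))
    (hW : ContMDiff 𝓘(ℝ, E) 𝓘(ℝ, E).tangent ∞ (fun x => (⟨x, W x⟩ : TangentBundle 𝓘(ℝ, E) X)))
    (x : X) :
    mvfderiv 𝓘(ℝ, E) f x (mlieBracket 𝓘(ℝ, E) V W x) =
      mvfderiv 𝓘(ℝ, E) (fun y => mvfderiv 𝓘(ℝ, E) f y (W y)) x (V x) -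
      mvfderiv 𝓘(ℝ, E) (fun y => mvfderiv 𝓘(ℝ, E) f y (V y)) x (W x) := by
  by_cases hz : ∀ z : TangentSpace 𝓘(ℝ, E) x, z = 0
  · rw [hz (mlieBracket 𝓘(ℝ, E) V W x), hz (V x), hz (W x)]; simp
  push Not at hz
  obtain ⟨z, hz⟩ := hz
  obtain ⟨U, hU, hE⟩ := FiberBundle.exists_contMDiffOn_extend (k := ∞) 𝓘(ℝ, E) E (V := TangentSpace 𝓘(ℝ, E)) z
  obtain ⟨Z, hZ⟩ := exists_global_section (E := E) (F := E) hU hE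
  have hZx : Z x ≠ 0 := by rw [hZ.self_of_nhds, FiberBundle.extend_apply_self]; exact hz
  have hle : (minSmoothness ℝ 2) ≤ ∞ := by simp; exact WithTop.coe_le_coe.2 le_top
  have : IsManifold 𝓘(ℝ, E) (minSmoothness ℝ 3) X := by
    rw [minSmoothness_of_isRCLikeNormedField]; infer_instance
  have hZc := Z.contMDiff
  generalize (Z : ∀ y, TangentSpace 𝓘(ℝ, E) y) = Z at hZc hZx hZ
  have hWf := contMDiff_mvfderiv_apply hf hW
  have hVf := contMDiff_mvfderiv_apply hf hV
  have hfZ : ContMDiff 𝓘(ℝ, E) 𝓘(ℝ, E).tangent ∞ (T% (f • Z)) := hf.smul_section hZc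
  have J := leibniz_identity_mlieBracket_apply (I := 𝓘(ℝ, E)) ((hV x).of_le hle)
    ((hW x).of_le hle) ((hfZ x).of_le hle)
  have J0 := leibniz_identity_mlieBracket_apply (I := 𝓘(ℝ, E)) ((hV x).of_le hle)
    ((hW x).of_le hle) ((hZc x).of_le hle)
  have e1 (S : ∀ x, TangentSpace 𝓘(ℝ, E) x) (g : X → ℝ) (T : ∀ x, TangentSpace 𝓘(ℝ, E) x)
     (hg : ContMDiff 𝓘(ℝ, E) 𝓘(ℝ, ℝ) ∞ g)
     (hT : ContMDiff 𝓘(ℝ, E) 𝓘(ℝ, E).tangent ∞ (fun x => (⟨x, T x⟩ : TangentBundle 𝓘(ℝ, E) X))) :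
      mlieBracket 𝓘(ℝ, E) S (g • T) = (fun y => mvfderiv 𝓘(ℝ, E) g y (S y)) • T
        + g • mlieBracket 𝓘(ℝ, E) S T := by
    ext y
    exact mlieBracket_smul_right (hg.mdifferentiable (by simp) y) (hT.mdifferentiable (by simp) y)
  have e2 (S : ∀ x, TangentSpace 𝓘(ℝ, E) x) (T T' : ∀ x, TangentSpace 𝓘(ℝ, E) x)
     (hT : ContMDiff 𝓘(ℝ, E) 𝓘(ℝ, E).tangent ∞ (fun x => (⟨x, T x⟩ : TangentBundle 𝓘(ℝ, E) X)))
     (hT' : ContMDiff 𝓘(ℝ, E) 𝓘(ℝ, E).tangent ∞ (fun x => (⟨x, T' x⟩ : TangentBundle 𝓘(ℝ, E) X))) :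
      mlieBracket 𝓘(ℝ, E) S (T + T') = mlieBracket 𝓘(ℝ, E) S T + mlieBracket 𝓘(ℝ, E) S T' := by
    ext y
    exact mlieBracket_add_right (hT.mdifferentiable (by simp) y) (hT'.mdifferentiable (by simp) y)
  rw [e1 _ _ _ hf hZc, e1 _ _ _ hf hZc, e1 _ _ _ hf hZc, e2 _ _ _ (hWf.smul_section hZc) (hf.smul_section (contMDiff_mlieBracket hW hZc)),
   e2 _ _ _ (hVf.smul_section hZc) (hf.smul_section (contMDiff_mlieBracket hV hZc)), e1 _ _ _ hWf hZc, e1 _ _ _ hf (contMDiff_mlieBracket hW hZc),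
   e1 _ _ _ hVf hZc, e1 _ _ _ hf (contMDiff_mlieBracket hV hZc)] at J
  simp only [Pi.add_apply, Pi.smul_apply', J0] at J
  have : (mvfderiv 𝓘(ℝ, E) f x (mlieBracket 𝓘(ℝ, E) V W x) - (
      mvfderiv 𝓘(ℝ, E) (fun y => mvfderiv 𝓘(ℝ, E) f y (W y)) x (V x) -
      mvfderiv 𝓘(ℝ, E) (fun y => mvfderiv 𝓘(ℝ, E) f y (V y)) x (W x))) • Z x = 0 := by
    simp only [sub_smul]
    simp only [smul_add] at J
    rw [← sub_eq_zero] at J; rw [← neg_eq_zero, ← J]; module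
  rcases smul_eq_zero.1 this with h | h
  · exact sub_eq_zero.1 h
  · exact absurd h hZx

theorem exists_mvfderiv_ne_zero [IsManifold 𝓘(ℝ, E) ∞ X] {x : X} {w : TangentSpace 𝓘(ℝ, E) x}
    (hw : w ≠ 0) :
    ∃ f : X → ℝ, ContMDiff 𝓘(ℝ, E) 𝓘(ℝ, ℝ) ∞ f ∧ mvfderiv 𝓘(ℝ, E) f x w ≠ 0 := by
  have hinv := isInvertible_mfderiv_extChartAt (I := 𝓘(ℝ, E)) (mem_extChartAt_source (I := 𝓘(ℝ, E)) x)
  have hne : mfderiv 𝓘(ℝ, E) 𝓘(ℝ, E) (extChartAt 𝓘(ℝ, E) x) x w ≠ 0 := by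
    intro h
    exact hw (hinv.injective (h.trans (map_zero _).symm))
  have key : ∀ v : E, v ≠ 0 → ∃ l : E →L[ℝ] ℝ, l v ≠ 0 :=
    fun v hv => SeparatingDual.exists_ne_zero hv
  obtain ⟨l, hl⟩ := key (mfderiv 𝓘(ℝ, E) 𝓘(ℝ, E) (extChartAt 𝓘(ℝ, E) x) x w) hne
  obtain ⟨ψ, h1, h2, h3⟩ := exists_bump (E := E) x (chartAt E x).source (chart_source_mem_nhds E x)
  set g : X → ℝ := l ∘ extChartAt 𝓘(ℝ, E) x with hg
  have hgs : ContMDiffOn 𝓘(ℝ, E) 𝓘(ℝ, ℝ) ∞ g (chartAt E x).source :=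
    l.contMDiff.comp_contMDiffOn contMDiffOn_extChartAt
  refine ⟨fun y => ψ y * g y, ?_, ?_⟩
  · apply contMDiff_of_tsupport
    intro y hy
    have hy' : y ∈ (chartAt E x).source := h3 (tsupport_mul_subset_left hy)
    exact h1.contMDiffAt.mul (hgs.contMDiffAt ((chartAt E x).open_source.mem_nhds hy'))
  · have he : (fun y => ψ y * g y) =ᶠ[𝓝 x] g := by
      filter_upwards [h2] with y hy
      simp [hy]
    have : mvfderiv 𝓘(ℝ, E) (fun y => ψ y * g y) x = mvfderiv 𝓘(ℝ, E) g x := by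
      unfold mvfderiv
      rw [he.mfderiv_eq]
      rw [he.self_of_nhds]
    have hl' : HasMFDerivAt 𝓘(ℝ, E) 𝓘(ℝ, ℝ) l (extChartAt 𝓘(ℝ, E) x x) l :=
      l.hasFDerivAt.hasMFDerivAt
    have hc := hl'.comp x
      (mdifferentiableAt_extChartAt (I := 𝓘(ℝ, E)) (mem_chart_source E x)).hasMFDerivAt
    have h4 : mvfderiv 𝓘(ℝ, E) g x w =
        l (mfderiv 𝓘(ℝ, E) 𝓘(ℝ, E) (extChartAt 𝓘(ℝ, E) x) x w) := by
      unfold mvfderiv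
      rw [hg, hc.mfderiv]
      rfl
    rw [this, h4]
    exact hl

end Calculus

section Along

variable {EM EP F M P : Type*}
  [NormedAddCommGroup EM] [NormedSpace ℝ EM] [FiniteDimensional ℝ EM]
  [TopologicalSpace M] [ChartedSpace EM M] [IsManifold 𝓘(ℝ, EM) ∞ M]
  [NormedAddCommGroup EP] [NormedSpace ℝ EP] [FiniteDimensional ℝ EP]
  [TopologicalSpace P] [ChartedSpace EP P] [IsManifold 𝓘(ℝ, EP) ∞ P]
  [NormedAddCommGroup F] [NormedSpace ℝ F] [FiniteDimensional ℝ F]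
  {A : M → Type*} [TopologicalSpace (TotalSpace F A)] [∀ x, AddCommGroup (A x)]
  [∀ x, Module ℝ (A x)] [∀ x, TopologicalSpace (A x)] [FiberBundle F A] [VectorBundle ℝ F A]
  [ContMDiffVectorBundle ∞ F A 𝓘(ℝ, EM)]

variable (EM EP F) in
/-- Smooth sections of the pull-back vector bundle of `A` along a map `φ`,
seen as smooth maps to the total space of `A` which lift `φ`. -/
def IsSmoothAlong (φ : P → M) (s : ∀ p, A (φ p)) : Prop :=
  ContMDiff 𝓘(ℝ, EP) (𝓘(ℝ, EM).prod 𝓘(ℝ, F)) ∞ (fun p => TotalSpace.mk' F (φ p) (s p))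

variable {φ : P → M}

theorem isSmoothAlong_iff (hφ : ContMDiff 𝓘(ℝ, EP) 𝓘(ℝ, EM) ∞ φ) {s : ∀ p, A (φ p)} :
    IsSmoothAlong EM EP F φ s ↔ ∀ p₀, ContMDiffAt 𝓘(ℝ, EP) 𝓘(ℝ, F) ∞
      (fun p => (trivializationAt F A (φ p₀) ⟨φ p, s p⟩).2) p₀ := by
  refine forall_congr' fun p₀ => ?_
  rw [contMDiffAt_totalSpace]
  exact and_iff_right (hφ p₀)

theorem eventually_mem_baseSet (hφ : ContMDiff 𝓘(ℝ, EP) 𝓘(ℝ, EM) ∞ φ) (p₀ : P) :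
    ∀ᶠ p in 𝓝 p₀, φ p ∈ (trivializationAt F A (φ p₀)).baseSet :=
  hφ.continuous.continuousAt.eventually_mem ((trivializationAt F A (φ p₀)).open_baseSet.mem_nhds
    (FiberBundle.mem_baseSet_trivializationAt' _))

theorem IsSmoothAlong.add (hφ : ContMDiff 𝓘(ℝ, EP) 𝓘(ℝ, EM) ∞ φ) {s t : ∀ p, A (φ p)}
    (hs : IsSmoothAlong EM EP F φ s) (ht : IsSmoothAlong EM EP F φ t) :
    IsSmoothAlong EM EP F φ (fun p => s p + t p) := by
  rw [isSmoothAlong_iff hφ] at hs ht ⊢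
  intro p₀
  refine ((hs p₀).add (ht p₀)).congr_of_eventuallyEq ?_
  filter_upwards [eventually_mem_baseSet (F := F) (A := A) hφ p₀] with p hp
  exact ((trivializationAt F A (φ p₀)).linear ℝ hp).map_add _ _

theorem IsSmoothAlong.smul (hφ : ContMDiff 𝓘(ℝ, EP) 𝓘(ℝ, EM) ∞ φ) {f : P → ℝ} {s : ∀ p, A (φ p)}
    (hf : ContMDiff 𝓘(ℝ, EP) 𝓘(ℝ, ℝ) ∞ f) (hs : IsSmoothAlong EM EP F φ s) :
    IsSmoothAlong EM EP F φ (fun p => f p • s p) := by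
  rw [isSmoothAlong_iff hφ] at hs ⊢
  intro p₀
  refine ((hf p₀).smul (hs p₀)).congr_of_eventuallyEq ?_
  filter_upwards [eventually_mem_baseSet (F := F) (A := A) hφ p₀] with p hp
  exact ((trivializationAt F A (φ p₀)).linear ℝ hp).map_smul _ _

theorem IsSmoothAlong.zero (hφ : ContMDiff 𝓘(ℝ, EP) 𝓘(ℝ, EM) ∞ φ) :
    IsSmoothAlong EM EP F φ (fun p => (0 : A (φ p))) :=
  (contMDiff_zeroSection ℝ A).comp hφ

theorem IsSmoothAlong.comp (hφ : ContMDiff 𝓘(ℝ, EP) 𝓘(ℝ, EM) ∞ φ)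
    (b : ContMDiffSection 𝓘(ℝ, EM) F ∞ A) :
    IsSmoothAlong EM EP F φ (fun p => b (φ p)) :=
  b.contMDiff.comp hφ

theorem IsSmoothAlong.sum (hφ : ContMDiff 𝓘(ℝ, EP) 𝓘(ℝ, EM) ∞ φ) {ι : Type*} (I : Finset ι)
    {s : ι → ∀ p, A (φ p)} (hs : ∀ i ∈ I, IsSmoothAlong EM EP F φ (s i)) :
    IsSmoothAlong EM EP F φ (fun p => ∑ i ∈ I, s i p) := by
  classical
  induction I using Finset.induction_on with
  | empty => simpa using IsSmoothAlong.zero hφ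
  | insert i I hi ih =>
    simp only [Finset.sum_insert hi]
    exact (hs _ (I.mem_insert_self i)).add hφ (ih fun j hj => hs _ (I.mem_insert_of_mem hj))

theorem exists_coeff [T2Space P] (hφ : ContMDiff 𝓘(ℝ, EP) 𝓘(ℝ, EM) ∞ φ) (p₀ : P)
    {ι : Type*} [Fintype ι] (b : Module.Basis ι ℝ F) {e : ι → Cₛ^∞⟮𝓘(ℝ, EM); F, A⟯}
    (he : ∀ᶠ x in 𝓝 (φ p₀), ∀ i, e i x = (trivializationAt F A (φ p₀)).localFrame b i x)
    {s : ∀ p, A (φ p)} (hs : IsSmoothAlong EM EP F φ s) :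
    ∃ f : ι → P → ℝ, (∀ i, ContMDiff 𝓘(ℝ, EP) 𝓘(ℝ, ℝ) ∞ (f i)) ∧
      ∀ᶠ p in 𝓝 p₀, s p = ∑ i, f i p • e i (φ p) := by
  set T := trivializationAt F A (φ p₀)
  have hB' := eventually_mem_baseSet (F := F) (A := A) hφ p₀
  obtain ⟨ψ, h1, h2, h3⟩ := exists_bump (E := EP) p₀ _ hB'
  refine ⟨fun i p => ψ p * b.repr (T ⟨φ p, s p⟩).2 i, fun i => ?_, ?_⟩
  · apply contMDiff_of_tsupport
    intro p hp
    have hp' : φ p ∈ T.baseSet := h3 (tsupport_mul_subset_left hp)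
    refine h1.contMDiffAt.mul ?_
    have : ContMDiffAt 𝓘(ℝ, EP) 𝓘(ℝ, F) ∞ (fun p => (T ⟨φ p, s p⟩).2) p :=
      ((T.contMDiffAt_iff (IB := 𝓘(ℝ, EM)) (n := ∞)
        (by simpa [T.mem_source] using hp')).1 (hs p)).2
    exact ((LinearMap.toContinuousLinearMap (b.coord i)).contMDiff.contMDiffAt).comp p this
  · filter_upwards [h2, hφ.continuous.continuousAt.eventually he, hB'] with p hp1 hp2 hpB
    refine ((T.basisAt b hpB).sum_repr (s p)).symm.trans (Finset.sum_congr rfl fun i _ => ?_)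
    rw [hp2 i, hp1, T.localFrame_apply_of_mem_baseSet b hpB]
    simp [Trivialization.basisAt]

theorem exists_frame [T2Space M] [T2Space P] (hφ : ContMDiff 𝓘(ℝ, EP) 𝓘(ℝ, EM) ∞ φ) (p₀ : P) :
    ∃ (n : ℕ) (e : Fin n → Cₛ^∞⟮𝓘(ℝ, EM); F, A⟯),
      (∀ᶠ x in 𝓝 (φ p₀), LinearIndependent ℝ (fun i => e i x)) ∧
      (∀ s : ∀ x, A x, IsSmoothAlong EM EM F id s → ∃ f : Fin n → M → ℝ,
        (∀ i, ContMDiff 𝓘(ℝ, EM) 𝓘(ℝ, ℝ) ∞ (f i)) ∧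
        ∀ᶠ x in 𝓝 (φ p₀), s x = ∑ i, f i x • e i x) ∧
      ∀ s : ∀ p, A (φ p), IsSmoothAlong EM EP F φ s → ∃ f : Fin n → P → ℝ,
        (∀ i, ContMDiff 𝓘(ℝ, EP) 𝓘(ℝ, ℝ) ∞ (f i)) ∧
        ∀ᶠ p in 𝓝 p₀, s p = ∑ i, f i p • e i (φ p) := by
  set T := trivializationAt F A (φ p₀) with hT
  have hB : T.baseSet ∈ 𝓝 (φ p₀) :=
    T.open_baseSet.mem_nhds (FiberBundle.mem_baseSet_trivializationAt' _)
  let b := Module.finBasis ℝ F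
  have h := fun i => exists_global_section hB
    (T.contMDiffOn_localFrame_baseSet (I := 𝓘(ℝ, EM)) ∞ b i)
  choose e he using h
  have he' := eventually_all.2 he
  refine ⟨_, e, ?_, fun s hs => exists_coeff (φ := id) contMDiff_id (φ p₀) b he' hs,
    fun s hs => exists_coeff hφ p₀ b he' hs⟩
  filter_upwards [he', hB] with x hx hxB
  have : (fun i => e i x) = T.basisAt b hxB := by
    ext i; rw [hx i]; simp [hxB]
  rw [this]
  exact (T.basisAt b hxB).linearIndependent

end Along

section Structures

/-- A Lie algebroid structure on the smooth real vector bundle `A → M` with typical fibre `F`, over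
a smooth manifold `M` modelled on `EM`: an anchor `ρ : A → TM`, which is a smooth morphism of vector
bundles over `M`, and a Lie bracket on the space `Γ(A)` of smooth sections of `A` such that
`[a, f b] = f [a, b] + (ρ(a) f) b` and `ρ([a, b]) = [ρ(a), ρ(b)]`. -/
structure LieAlgebroid (EM F : Type*) {M : Type*}
    [NormedAddCommGroup EM] [NormedSpace ℝ EM] [TopologicalSpace M] [ChartedSpace EM M]
    [NormedAddCommGroup F] [NormedSpace ℝ F]
    (A : M → Type*) [TopologicalSpace (TotalSpace F A)] [∀ x, AddCommGroup (A x)]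
    [∀ x, Module ℝ (A x)] [∀ x, TopologicalSpace (A x)] [FiberBundle F A] [VectorBundle ℝ F A]
    [IsManifold 𝓘(ℝ, EM) ∞ M] where
  /-- The anchor, on each fibre. -/
  anchor : ∀ x, A x →ₗ[ℝ] TangentSpace 𝓘(ℝ, EM) x
  contMDiff_anchor : ContMDiff (𝓘(ℝ, EM).prod 𝓘(ℝ, F)) 𝓘(ℝ, EM).tangent ∞
    (fun a : TotalSpace F A => (⟨a.proj, anchor a.proj a.2⟩ : TangentBundle 𝓘(ℝ, EM) M))
  /-- The bracket of smooth sections. -/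
  bracket : Cₛ^∞⟮𝓘(ℝ, EM); F, A⟯ →ₗ[ℝ] Cₛ^∞⟮𝓘(ℝ, EM); F, A⟯ →ₗ[ℝ] Cₛ^∞⟮𝓘(ℝ, EM); F, A⟯
  bracket_self : ∀ a, bracket a a = 0
  jacobi : ∀ a b c, bracket a (bracket b c) = bracket (bracket a b) c + bracket b (bracket a c)
  leibniz : ∀ (a b c : Cₛ^∞⟮𝓘(ℝ, EM); F, A⟯) (f : M → ℝ),
    ContMDiff 𝓘(ℝ, EM) 𝓘(ℝ, ℝ) ∞ f → (∀ x, c x = f x • b x) → ∀ x,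
      bracket a c x = f x • bracket a b x + mvfderiv 𝓘(ℝ, EM) f x (anchor x (a x)) • b x
  anchor_bracket : ∀ (a b : Cₛ^∞⟮𝓘(ℝ, EM); F, A⟯) (x : M),
    anchor x (bracket a b x) =
      mlieBracket 𝓘(ℝ, EM) (fun y => anchor y (a y)) (fun y => anchor y (b y)) x

end Structures

namespace LieAlgebroid

variable {EM EP F M P : Type*}
  [NormedAddCommGroup EM] [NormedSpace ℝ EM] [FiniteDimensional ℝ EM]
  [TopologicalSpace M] [ChartedSpace EM M] [IsManifold 𝓘(ℝ, EM) ∞ M]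
  [NormedAddCommGroup EP] [NormedSpace ℝ EP] [FiniteDimensional ℝ EP]
  [TopologicalSpace P] [ChartedSpace EP P] [IsManifold 𝓘(ℝ, EP) ∞ P]
  [NormedAddCommGroup F] [NormedSpace ℝ F] [FiniteDimensional ℝ F]
  {A : M → Type*} [TopologicalSpace (TotalSpace F A)] [∀ x, AddCommGroup (A x)]
  [∀ x, Module ℝ (A x)] [∀ x, TopologicalSpace (A x)] [FiberBundle F A] [VectorBundle ℝ F A]
  [ContMDiffVectorBundle ∞ F A 𝓘(ℝ, EM)]
  (L : LieAlgebroid EM F A) {φ : P → M}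

theorem bracket_swap (a b : Cₛ^∞⟮𝓘(ℝ, EM); F, A⟯) : L.bracket a b = - L.bracket b a := by
  have h := L.bracket_self (a + b)
  simp only [map_add, LinearMap.add_apply, L.bracket_self, zero_add, add_zero] at h
  exact eq_neg_of_add_eq_zero_right h

theorem leibniz_left (a b c : Cₛ^∞⟮𝓘(ℝ, EM); F, A⟯) (f : M → ℝ) (hf : ContMDiff 𝓘(ℝ, EM) 𝓘(ℝ, ℝ) ∞ f)
    (h : ∀ x, c x = f x • b x) (x : M) :
    L.bracket c a x = f x • L.bracket b a x - mvfderiv 𝓘(ℝ, EM) f x (L.anchor x (a x)) • b x := by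
  rw [L.bracket_swap c a, L.bracket_swap b a]
  simp only [ContMDiffSection.coe_neg, Pi.neg_apply, L.leibniz a b c f hf h x]
  module

/-- The bracket of a Lie algebroid is local. -/
theorem bracket_congr_left [T2Space M] {a a' : Cₛ^∞⟮𝓘(ℝ, EM); F, A⟯} (c : Cₛ^∞⟮𝓘(ℝ, EM); F, A⟯) {x : M} (h : ∀ᶠ y in 𝓝 x, a y = a' y) :
    L.bracket a c x = L.bracket a' c x := by
  obtain ⟨ψ, h1, h2, h3⟩ := exists_bump (E := EM) x _ h
  have h0 : ∀ y, (0 : Cₛ^∞⟮𝓘(ℝ, EM); F, A⟯) y = ψ y • (a - a') y := by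
    intro y
    by_cases hy : y ∈ tsupport ψ
    · have := h3 hy
      simp only [mem_ofPred_eq] at this
      simp [this]
    · simp [image_eq_zero_of_notMem_tsupport hy]
  have := L.leibniz_left c (a - a') 0 ψ h1 h0 x
  have hx : (a - a') x = 0 := by simp [h.self_of_nhds]
  rw [hx] at this
  simp [h2.self_of_nhds] at this
  exact (sub_eq_zero.1 this.symm)

theorem contMDiff_anchor_along (_hφ : ContMDiff 𝓘(ℝ, EP) 𝓘(ℝ, EM) ∞ φ) {s : ∀ p, A (φ p)}
    (hs : IsSmoothAlong EM EP F φ s) :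
    ContMDiff 𝓘(ℝ, EP) 𝓘(ℝ, EM).tangent ∞
      (fun p => (⟨φ p, L.anchor _ (s p)⟩ : TangentBundle 𝓘(ℝ, EM) M)) :=
  L.contMDiff_anchor.comp hs

theorem contMDiff_anchor_section (a : Cₛ^∞⟮𝓘(ℝ, EM); F, A⟯) :
    ContMDiff 𝓘(ℝ, EM) 𝓘(ℝ, EM).tangent ∞
      (fun x => (⟨x, L.anchor x (a x)⟩ : TangentBundle 𝓘(ℝ, EM) M)) :=
  L.contMDiff_anchor.comp a.contMDiff

variable (EM EP F) in
/-- Near `p`, the section `s` of the pull-back bundle is `∑ i, f i • (b i ∘ φ)` with smooth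
functions `f i` on `P` and smooth sections `b i` of `A`. -/
def IsDecomp (φ : P → M) (s : ∀ p, A (φ p)) (p : P) {ι : Type} [Fintype ι]
    (f : ι → P → ℝ) (b : ι → Cₛ^∞⟮𝓘(ℝ, EM); F, A⟯) : Prop :=
  (∀ i, ContMDiff 𝓘(ℝ, EP) 𝓘(ℝ, ℝ) ∞ (f i)) ∧ ∀ᶠ q in 𝓝 p, s q = ∑ i, f i q • b i (φ q)

theorem exists_isDecomp [T2Space M] [T2Space P] (hφ : ContMDiff 𝓘(ℝ, EP) 𝓘(ℝ, EM) ∞ φ)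
    {s : ∀ p, A (φ p)} (hs : IsSmoothAlong EM EP F φ s) (p : P) :
    ∃ (n : ℕ) (f : Fin n → P → ℝ) (b : Fin n → Cₛ^∞⟮𝓘(ℝ, EM); F, A⟯),
      IsDecomp EM EP F φ s p f b := by
  obtain ⟨n, e, -, -, h⟩ := exists_frame (F := F) (A := A) hφ p
  obtain ⟨f, hf⟩ := h s hs
  exact ⟨n, f, e, hf⟩

theorem coe_sum {ι : Type*} (I : Finset ι) (b : ι → Cₛ^∞⟮𝓘(ℝ, EM); F, A⟯) (x : M) :
    (∑ i ∈ I, b i) x = ∑ i ∈ I, b i x := by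
  have := map_sum (ContMDiffSection.coeAddHom 𝓘(ℝ, EM) F ∞ A) b I
  have := congrFun this x
  rw [Finset.sum_apply] at this
  exact this

/-- The product of a smooth section with a smooth function. -/
def fsmul (h : M → ℝ) (hh : ContMDiff 𝓘(ℝ, EM) 𝓘(ℝ, ℝ) ∞ h) (b : Cₛ^∞⟮𝓘(ℝ, EM); F, A⟯) :
    Cₛ^∞⟮𝓘(ℝ, EM); F, A⟯ :=
  ⟨fun x => h x • b x, hh.smul_section b.contMDiff⟩

theorem mvfderiv_sum {E X : Type*} [NormedAddCommGroup E] [NormedSpace ℝ E]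
    [TopologicalSpace X] [ChartedSpace E X] {ι : Type*} (I : Finset ι) (f : ι → X → ℝ) (x : X)
    (hf : ∀ i ∈ I, MDifferentiableAt 𝓘(ℝ, E) 𝓘(ℝ, ℝ) (f i) x) :
    mvfderiv 𝓘(ℝ, E) (fun y => ∑ i ∈ I, f i y) x = ∑ i ∈ I, mvfderiv 𝓘(ℝ, E) (f i) x ∧
    MDifferentiableAt 𝓘(ℝ, E) 𝓘(ℝ, ℝ) (fun y => ∑ i ∈ I, f i y) x := by
  classical
  induction I using Finset.induction_on with
  | empty =>
    simp only [Finset.sum_empty]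
    exact ⟨mvfderiv_const _, mdifferentiableAt_const⟩
  | insert i I hi ih =>
    simp only [Finset.sum_insert hi]
    obtain ⟨h1, h2⟩ := ih fun j hj => hf _ (I.mem_insert_of_mem hj)
    have h3 := hf _ (I.mem_insert_self i)
    refine ⟨?_, h3.add h2⟩
    rw [← h1]
    exact mvfderiv_add h3 h2

theorem mvfderiv_congr {E X : Type*} [NormedAddCommGroup E] [NormedSpace ℝ E]
    [TopologicalSpace X] [ChartedSpace E X] {f g : X → ℝ} {x : X} (h : f =ᶠ[𝓝 x] g) :
    mvfderiv 𝓘(ℝ, E) f x = mvfderiv 𝓘(ℝ, E) g x := by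
  unfold mvfderiv
  rw [h.mfderiv_eq, h.self_of_nhds]

theorem mvfderiv_sum_mul_comp {E X : Type*} [NormedAddCommGroup E] [NormedSpace ℝ E]
    [TopologicalSpace X] [ChartedSpace E X] {E' Y : Type*} [NormedAddCommGroup E']
    [NormedSpace ℝ E'] [TopologicalSpace Y] [ChartedSpace E' Y]
    {φ : Y → X} (hφ : ContMDiff 𝓘(ℝ, E') 𝓘(ℝ, E) ∞ φ) {ι : Type*} [Fintype ι]
    {f : ι → Y → ℝ} (hf : ∀ i, ContMDiff 𝓘(ℝ, E') 𝓘(ℝ, ℝ) ∞ (f i))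
    {h : ι → X → ℝ} (hh : ∀ i, ContMDiff 𝓘(ℝ, E) 𝓘(ℝ, ℝ) ∞ (h i))
    {G : Y → ℝ} {p : Y} (hG : ∀ᶠ q in 𝓝 p, G q = ∑ i, f i q * h i (φ q))
    (v : TangentSpace 𝓘(ℝ, E') p) :
    mvfderiv 𝓘(ℝ, E') G p v = ∑ i, (f i p * mvfderiv 𝓘(ℝ, E) (h i) (φ p)
      (mfderiv 𝓘(ℝ, E') 𝓘(ℝ, E) φ p v) + h i (φ p) * mvfderiv 𝓘(ℝ, E') (f i) p v) := by
  have hpd : MDifferentiableAt 𝓘(ℝ, E') 𝓘(ℝ, E) φ p := hφ.mdifferentiable (by simp) p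
  have hd1 : ∀ i, MDifferentiableAt 𝓘(ℝ, E') 𝓘(ℝ, ℝ) (f i) p :=
    fun i => (hf i).mdifferentiable (by simp) p
  have hd2 : ∀ i, MDifferentiableAt 𝓘(ℝ, E) 𝓘(ℝ, ℝ) (h i) (φ p) :=
    fun i => (hh i).mdifferentiable (by simp) (φ p)
  have h0 := (mvfderiv_sum Finset.univ (fun i q => f i q * h i (φ q)) p
    fun i _ => (hd1 i).mul ((hd2 i).comp p hpd)).1
  rw [mvfderiv_congr hG, h0, sum_apply]
  refine Finset.sum_congr rfl fun i _ => ?_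
  have h1 := mvfderiv_mul (hd1 i) ((hd2 i).comp p hpd)
  have h2 := mvfderiv_comp_apply (I := 𝓘(ℝ, E)) (I' := 𝓘(ℝ, E')) p (hd2 i) hpd v
  rw [← h2]
  exact congrArg (fun l => l v) h1

/-- A first-order expression in a decomposition does not depend on the decomposition. -/
theorem decomp_indep_frame [T2Space M] (hφ : ContMDiff 𝓘(ℝ, EP) 𝓘(ℝ, EM) ∞ φ) {p : P}
    (v : TangentSpace 𝓘(ℝ, EP) p)
    (B : Cₛ^∞⟮𝓘(ℝ, EM); F, A⟯ →ₗ[ℝ] A (φ p))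
    (hloc : ∀ b b' : Cₛ^∞⟮𝓘(ℝ, EM); F, A⟯, (∀ᶠ y in 𝓝 (φ p), b y = b' y) → B b = B b')
    (hB : ∀ (b c : Cₛ^∞⟮𝓘(ℝ, EM); F, A⟯) (h : M → ℝ), ContMDiff 𝓘(ℝ, EM) 𝓘(ℝ, ℝ) ∞ h →
      (∀ x, c x = h x • b x) → B c = h (φ p) • B b -
        mvfderiv 𝓘(ℝ, EM) h (φ p) (mfderiv 𝓘(ℝ, EP) 𝓘(ℝ, EM) φ p v) • b (φ p))
    {n : ℕ} {e : Fin n → Cₛ^∞⟮𝓘(ℝ, EM); F, A⟯}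
    (he : ∀ᶠ x in 𝓝 (φ p), LinearIndependent ℝ (fun i => e i x))
    (hf : ∀ s : ∀ x, A x, IsSmoothAlong EM EM F id s → ∃ f : Fin n → M → ℝ,
        (∀ i, ContMDiff 𝓘(ℝ, EM) 𝓘(ℝ, ℝ) ∞ (f i)) ∧
        ∀ᶠ y in 𝓝 (φ p), s y = ∑ i, f i y • e i y)
    {s : ∀ p, A (φ p)} {σ : Fin n → P → ℝ} (hσ : IsDecomp EM EP F φ s p σ e)
    {ι : Type} [Fintype ι] {f : ι → P → ℝ} {b : ι → Cₛ^∞⟮𝓘(ℝ, EM); F, A⟯}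
    (hfb : IsDecomp EM EP F φ s p f b) :
    ∑ i, (f i p • B (b i) - mvfderiv 𝓘(ℝ, EP) (f i) p v • b i (φ p)) =
    ∑ k, (σ k p • B (e k) - mvfderiv 𝓘(ℝ, EP) (σ k) p v • e k (φ p)) := by
  choose h hh hbe using fun i => hf (b i) (b i).contMDiff
  have hbe' := eventually_all.2 hbe
  have h1 : ∀ i, B (b i) = ∑ k, (h i k (φ p) • B (e k) -
      mvfderiv 𝓘(ℝ, EM) (h i k) (φ p) (mfderiv 𝓘(ℝ, EP) 𝓘(ℝ, EM) φ p v) • e k (φ p)) := by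
    intro i
    rw [hloc (b i) (∑ k, fsmul (h i k) (hh i k) (e k)), map_sum]
    · exact Finset.sum_congr rfl fun k _ => hB _ _ _ (hh i k) fun x => rfl
    · filter_upwards [hbe i] with y hy
      rw [coe_sum]; exact hy
  have h2 : ∀ i, b i (φ p) = ∑ k, h i k (φ p) • e k (φ p) := fun i => (hbe i).self_of_nhds
  have h3 : ∀ k, σ k =ᶠ[𝓝 p] fun q => ∑ i, f i q * h i k (φ q) := by
    have hc := hφ.continuous.continuousAt (x := p)
    have : ∀ᶠ q in 𝓝 p, ∀ k, σ k q = ∑ i, f i q * h i k (φ q) := by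
      filter_upwards [hc.eventually he, hc.eventually hbe', hσ.2, hfb.2] with q q1 q2 q3 q4
      have : ∑ k, (σ k q - ∑ i, f i q * h i k (φ q)) • e k (φ q) = 0 := by
        simp only [sub_smul, Finset.sum_sub_distrib, ← q3]
        rw [q4, sub_eq_zero]
        simp only [q2, Finset.smul_sum, Finset.sum_smul, mul_smul]
        exact Finset.sum_comm
      intro k
      exact sub_eq_zero.1 (Fintype.linearIndependent_iff.1 q1 _ this k)
    exact fun k => this.mono fun q hq => hq k
  have h4 : ∀ k, mvfderiv 𝓘(ℝ, EP) (σ k) p v = ∑ i, (f i p * mvfderiv 𝓘(ℝ, EM) (h i k) (φ p)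
      (mfderiv 𝓘(ℝ, EP) 𝓘(ℝ, EM) φ p v) + h i k (φ p) * mvfderiv 𝓘(ℝ, EP) (f i) p v) :=
    fun k => mvfderiv_sum_mul_comp hφ hfb.1 (fun i => hh i k) (h3 k) v
  have h5 : ∀ k, σ k p = ∑ i, f i p * h i k (φ p) := fun k => (h3 k).self_of_nhds
  simp only [h1, h2, h4, h5, Finset.smul_sum, Finset.sum_smul, ← Finset.sum_sub_distrib]
  rw [Finset.sum_comm]
  refine Finset.sum_congr rfl fun k _ => Finset.sum_congr rfl fun i _ => ?_
  module

/-- The `A`-component of the bracket of `(∑ i, f i ⊗ b i, u)` and `(∑ j, g j ⊗ c j, v)` at `p`: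
`∑ i j, f i g j [b i, c j] + ∑ j, u(g j) c j - ∑ i, v(f i) b i`. -/
def decompBracket (φ : P → M) (p : P) (u v : TangentSpace 𝓘(ℝ, EP) p)
    {ι κ : Type} [Fintype ι] [Fintype κ]
    (f : ι → P → ℝ) (b : ι → Cₛ^∞⟮𝓘(ℝ, EM); F, A⟯)
    (g : κ → P → ℝ) (c : κ → Cₛ^∞⟮𝓘(ℝ, EM); F, A⟯) : A (φ p) :=
  ∑ i, ∑ j, (f i p * g j p) • L.bracket (b i) (c j) (φ p)
    + ∑ j, mvfderiv 𝓘(ℝ, EP) (g j) p u • c j (φ p)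
    - ∑ i, mvfderiv 𝓘(ℝ, EP) (f i) p v • b i (φ p)

theorem decompBracket_swap (p : P) (u v : TangentSpace 𝓘(ℝ, EP) p)
    {ι κ : Type} [Fintype ι] [Fintype κ]
    (f : ι → P → ℝ) (b : ι → Cₛ^∞⟮𝓘(ℝ, EM); F, A⟯)
    (g : κ → P → ℝ) (c : κ → Cₛ^∞⟮𝓘(ℝ, EM); F, A⟯) :
    L.decompBracket φ p u v f b g c = - L.decompBracket φ p v u g c f b := by
  unfold decompBracket
  rw [Finset.sum_comm]
  have : ∀ i j, (f i p * g j p) • L.bracket (b i) (c j) (φ p) =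
      - ((g j p * f i p) • L.bracket (c j) (b i) (φ p)) := by
    intro i j
    rw [L.bracket_swap (b i) (c j)]
    simp [mul_comm]
  simp only [this, Finset.sum_neg_distrib]
  module

/-- The map `b ↦ [b, c](x)`. -/
def bracketAt (x : M) (c : Cₛ^∞⟮𝓘(ℝ, EM); F, A⟯) : Cₛ^∞⟮𝓘(ℝ, EM); F, A⟯ →ₗ[ℝ] A x where
  toFun b := L.bracket b c x
  map_add' b b' := by simp
  map_smul' r b := by simp

theorem decompBracket_congr_left [T2Space M] [T2Space P]
    (hφ : ContMDiff 𝓘(ℝ, EP) 𝓘(ℝ, EM) ∞ φ) {p : P} {u v : TangentSpace 𝓘(ℝ, EP) p}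
    {s t : ∀ p, A (φ p)} (hs : IsSmoothAlong EM EP F φ s)
    (hv : L.anchor (φ p) (t p) = mfderiv 𝓘(ℝ, EP) 𝓘(ℝ, EM) φ p v)
    {ι ι' κ : Type} [Fintype ι] [Fintype ι'] [Fintype κ]
    {f : ι → P → ℝ} {b : ι → Cₛ^∞⟮𝓘(ℝ, EM); F, A⟯} (hf : IsDecomp EM EP F φ s p f b)
    {f' : ι' → P → ℝ} {b' : ι' → Cₛ^∞⟮𝓘(ℝ, EM); F, A⟯} (hf' : IsDecomp EM EP F φ s p f' b')
    {g : κ → P → ℝ} {c : κ → Cₛ^∞⟮𝓘(ℝ, EM); F, A⟯} (hg : IsDecomp EM EP F φ t p g c) :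
    L.decompBracket φ p u v f b g c = L.decompBracket φ p u v f' b' g c := by
  obtain ⟨n, e, he, he1, he2⟩ := exists_frame (F := F) (A := A) (EM := EM) (φ := φ) hφ p
  obtain ⟨σ, hσ⟩ := he2 s hs
  have hv' : mfderiv 𝓘(ℝ, EP) 𝓘(ℝ, EM) φ p v = ∑ j, g j p • L.anchor (φ p) (c j (φ p)) := by
    rw [← hv, hg.2.self_of_nhds]; simp
  set B : Cₛ^∞⟮𝓘(ℝ, EM); F, A⟯ →ₗ[ℝ] A (φ p) := ∑ j, g j p • L.bracketAt (φ p) (c j) with hBdef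
  have hBa : ∀ b, B b = ∑ j, g j p • L.bracket b (c j) (φ p) := by
    intro b; simp [hBdef, bracketAt]
  have key : ∀ {ι : Type} [Fintype ι] {f : ι → P → ℝ} {b : ι → Cₛ^∞⟮𝓘(ℝ, EM); F, A⟯}
      (_ : IsDecomp EM EP F φ s p f b), L.decompBracket φ p u v f b g c =
      ∑ k, (σ k p • B (e k) - mvfderiv 𝓘(ℝ, EP) (σ k) p v • e k (φ p)) +
        ∑ j, mvfderiv 𝓘(ℝ, EP) (g j) p u • c j (φ p) := by
    intro ι _ f b hf
    rw [← decomp_indep_frame hφ v B ?_ ?_ he he1 hσ hf]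
    · simp only [decompBracket, hBa, Finset.sum_sub_distrib, Finset.smul_sum, mul_smul]
      module
    · intro b b' hb
      simp only [hBa]
      exact Finset.sum_congr rfl fun j _ => by rw [L.bracket_congr_left (c j) hb]
    · intro b b' h hh hb
      simp only [hBa, L.leibniz_left _ _ _ h hh hb, hv', map_sum, map_smul, Finset.sum_smul,
        Finset.smul_sum, ← Finset.sum_sub_distrib]
      refine Finset.sum_congr rfl fun j _ => ?_
      rw [smul_eq_mul]
      module
  rw [key hf, key hf']

theorem decompBracket_congr [T2Space M] [T2Space P]
    (hφ : ContMDiff 𝓘(ℝ, EP) 𝓘(ℝ, EM) ∞ φ) {p : P} {u v : TangentSpace 𝓘(ℝ, EP) p}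
    {s t : ∀ p, A (φ p)} (hs : IsSmoothAlong EM EP F φ s) (ht : IsSmoothAlong EM EP F φ t)
    (hu : L.anchor (φ p) (s p) = mfderiv 𝓘(ℝ, EP) 𝓘(ℝ, EM) φ p u)
    (hv : L.anchor (φ p) (t p) = mfderiv 𝓘(ℝ, EP) 𝓘(ℝ, EM) φ p v)
    {ι ι' κ κ' : Type} [Fintype ι] [Fintype ι'] [Fintype κ] [Fintype κ']
    {f : ι → P → ℝ} {b : ι → Cₛ^∞⟮𝓘(ℝ, EM); F, A⟯} (hf : IsDecomp EM EP F φ s p f b)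
    {f' : ι' → P → ℝ} {b' : ι' → Cₛ^∞⟮𝓘(ℝ, EM); F, A⟯} (hf' : IsDecomp EM EP F φ s p f' b')
    {g : κ → P → ℝ} {c : κ → Cₛ^∞⟮𝓘(ℝ, EM); F, A⟯} (hg : IsDecomp EM EP F φ t p g c)
    {g' : κ' → P → ℝ} {c' : κ' → Cₛ^∞⟮𝓘(ℝ, EM); F, A⟯} (hg' : IsDecomp EM EP F φ t p g' c') :
    L.decompBracket φ p u v f b g c = L.decompBracket φ p u v f' b' g' c' := by
  rw [L.decompBracket_congr_left hφ hs hv hf hf' hg, L.decompBracket_swap,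
    L.decompBracket_congr_left hφ ht hu hg hg' hf', ← L.decompBracket_swap]

theorem contMDiff_anchor_apply (c : Cₛ^∞⟮𝓘(ℝ, EM); F, A⟯) {h : M → ℝ}
    (hh : ContMDiff 𝓘(ℝ, EM) 𝓘(ℝ, ℝ) ∞ h) :
    ContMDiff 𝓘(ℝ, EM) 𝓘(ℝ, ℝ) ∞ (fun x => mvfderiv 𝓘(ℝ, EM) h x (L.anchor x (c x))) :=
  contMDiff_mvfderiv_apply hh (L.contMDiff_anchor_section c)

/-- Tangent vectors are determined by the derivatives of smooth functions along them. -/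
theorem tangent_ext {E X : Type*} [NormedAddCommGroup E] [NormedSpace ℝ E] [FiniteDimensional ℝ E]
    [TopologicalSpace X] [ChartedSpace E X] [T2Space X] [IsManifold 𝓘(ℝ, E) ∞ X] {x : X}
    {w w' : TangentSpace 𝓘(ℝ, E) x}
    (h : ∀ f : X → ℝ, ContMDiff 𝓘(ℝ, E) 𝓘(ℝ, ℝ) ∞ f →
      mvfderiv 𝓘(ℝ, E) f x w = mvfderiv 𝓘(ℝ, E) f x w') : w = w' := by
  by_contra hne
  obtain ⟨f, hf, hf'⟩ := exists_mvfderiv_ne_zero (E := E) (sub_ne_zero.2 hne)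
  exact hf' (by rw [map_sub, h f hf, sub_self])

/-- `(s, u)` is a smooth section of `A ×_{TM} TP`. -/
structure IsPullbackSection (φ : P → M) (s : ∀ p, A (φ p)) (u : ∀ p : P, TangentSpace 𝓘(ℝ, EP) p) :
    Prop where
  smooth_fst : IsSmoothAlong EM EP F φ s
  smooth_snd : ContMDiff 𝓘(ℝ, EP) 𝓘(ℝ, EP).tangent ∞
    (fun p => (⟨p, u p⟩ : TangentBundle 𝓘(ℝ, EP) P))
  anchor_eq : ∀ p, L.anchor (φ p) (s p) = mfderiv 𝓘(ℝ, EP) 𝓘(ℝ, EM) φ p (u p)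

variable {L}

theorem decomp_anchor {φ : P → M} {s : ∀ p, A (φ p)} {u : ∀ p : P, TangentSpace 𝓘(ℝ, EP) p}
    (hs : L.IsPullbackSection φ s u) {p : P} {ι : Type} [Fintype ι]
    {f : ι → P → ℝ} {b : ι → Cₛ^∞⟮𝓘(ℝ, EM); F, A⟯} (hf : IsDecomp EM EP F φ s p f b) :
    mfderiv 𝓘(ℝ, EP) 𝓘(ℝ, EM) φ p (u p) = ∑ i, f i p • L.anchor (φ p) (b i (φ p)) := by
  rw [← hs.anchor_eq, hf.2.self_of_nhds]; simp

theorem anchor_decompBracket [T2Space M] [T2Space P] (hφ : ContMDiff 𝓘(ℝ, EP) 𝓘(ℝ, EM) ∞ φ)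
    {s t : ∀ p, A (φ p)} {u v : ∀ p : P, TangentSpace 𝓘(ℝ, EP) p}
    (hs : L.IsPullbackSection φ s u) (ht : L.IsPullbackSection φ t v) {p : P}
    {ι κ : Type} [Fintype ι] [Fintype κ]
    {f : ι → P → ℝ} {b : ι → Cₛ^∞⟮𝓘(ℝ, EM); F, A⟯} (hf : IsDecomp EM EP F φ s p f b)
    {g : κ → P → ℝ} {c : κ → Cₛ^∞⟮𝓘(ℝ, EM); F, A⟯} (hg : IsDecomp EM EP F φ t p g c) :
    L.anchor (φ p) (L.decompBracket φ p (u p) (v p) f b g c) =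
      mfderiv 𝓘(ℝ, EP) 𝓘(ℝ, EM) φ p (mlieBracket 𝓘(ℝ, EP) u v p) := by
  apply tangent_ext
  intro h hh
  have hpd : MDifferentiable 𝓘(ℝ, EP) 𝓘(ℝ, EM) φ := hφ.mdifferentiable (by simp)
  have hhd : MDifferentiable 𝓘(ℝ, EM) 𝓘(ℝ, ℝ) h := hh.mdifferentiable (by simp)
  have chain : ∀ (q : P) (w : TangentSpace 𝓘(ℝ, EP) q), mvfderiv 𝓘(ℝ, EP) (h ∘ φ) q w =
      mvfderiv 𝓘(ℝ, EM) h (φ q) (mfderiv 𝓘(ℝ, EP) 𝓘(ℝ, EM) φ q w) := fun q w =>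
    mvfderiv_comp_apply (I := 𝓘(ℝ, EM)) (I' := 𝓘(ℝ, EP)) q (hhd _) (hpd q) w
  have aux : ∀ {s : ∀ p, A (φ p)} {u : ∀ p : P, TangentSpace 𝓘(ℝ, EP) p}
      (_ : L.IsPullbackSection φ s u) {ι : Type} [Fintype ι] {f : ι → P → ℝ}
      {b : ι → Cₛ^∞⟮𝓘(ℝ, EM); F, A⟯} (_ : IsDecomp EM EP F φ s p f b),
      ∀ᶠ q in 𝓝 p, mvfderiv 𝓘(ℝ, EP) (h ∘ φ) q (u q) = ∑ i, f i q *
        (fun x => mvfderiv 𝓘(ℝ, EM) h x (L.anchor x (b i x))) (φ q) := by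
    intro s u hs ι _ f b hf
    filter_upwards [hf.2] with q hq
    rw [chain, ← hs.anchor_eq, hq]
    simp
  rw [← chain, mvfderiv_mlieBracket (hh.comp hφ) hs.smooth_snd ht.smooth_snd,
    mvfderiv_sum_mul_comp hφ hg.1 (fun j => L.contMDiff_anchor_apply (c j) hh) (aux ht hg) (u p),
    mvfderiv_sum_mul_comp hφ hf.1 (fun i => L.contMDiff_anchor_apply (b i) hh) (aux hs hf) (v p),
    decomp_anchor hs hf, decomp_anchor ht hg]
  simp only [decompBracket, map_add, map_sub, map_sum, map_smul, L.anchor_bracket,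
    mvfderiv_mlieBracket hh (L.contMDiff_anchor_section _) (L.contMDiff_anchor_section _),
    smul_eq_mul, Finset.sum_add_distrib, Finset.mul_sum, mul_sub, Finset.sum_sub_distrib]
  have e1 : ∀ X : ι → κ → ℝ, ∑ j, ∑ i, g j p * (f i p * X i j) = ∑ i, ∑ j, f i p * g j p * X i j := by
    intro X
    rw [Finset.sum_comm]
    exact Finset.sum_congr rfl fun i _ => Finset.sum_congr rfl fun j _ => by ring
  have e2 : ∀ X : ι → κ → ℝ, ∑ i, ∑ j, f i p * (g j p * X i j) = ∑ i, ∑ j, f i p * g j p * X i j := by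
    intro X
    exact Finset.sum_congr rfl fun i _ => Finset.sum_congr rfl fun j _ => by ring
  have e3 : ∀ X Y : ι → ℝ, ∑ i, X i * Y i = ∑ i, Y i * X i := fun X Y =>
    Finset.sum_congr rfl fun i _ => mul_comm _ _
  have e4 : ∀ X Y : κ → ℝ, ∑ i, X i * Y i = ∑ i, Y i * X i := fun X Y =>
    Finset.sum_congr rfl fun i _ => mul_comm _ _
  rw [e1, e2, e3 (fun i => mvfderiv 𝓘(ℝ, EP) (f i) p (v p)), e4 (fun i => mvfderiv 𝓘(ℝ, EP) (g i) p (u p))]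
  ring

theorem contMDiff_decompBracket [T2Space M] [T2Space P] (hφ : ContMDiff 𝓘(ℝ, EP) 𝓘(ℝ, EM) ∞ φ)
    {s t : ∀ p, A (φ p)} {u v : ∀ p : P, TangentSpace 𝓘(ℝ, EP) p}
    (hs : L.IsPullbackSection φ s u) (ht : L.IsPullbackSection φ t v)
    {ι κ : Type} [Fintype ι] [Fintype κ]
    {f : ι → P → ℝ} (b : ι → Cₛ^∞⟮𝓘(ℝ, EM); F, A⟯)
    (hf : ∀ i, ContMDiff 𝓘(ℝ, EP) 𝓘(ℝ, ℝ) ∞ (f i))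
    {g : κ → P → ℝ} (c : κ → Cₛ^∞⟮𝓘(ℝ, EM); F, A⟯)
    (hg : ∀ i, ContMDiff 𝓘(ℝ, EP) 𝓘(ℝ, ℝ) ∞ (g i)) :
    IsSmoothAlong EM EP F φ (fun p => L.decompBracket φ p (u p) (v p) f b g c) := by
  have h1 : IsSmoothAlong EM EP F φ
      (fun p => ∑ i, ∑ j, (f i p * g j p) • L.bracket (b i) (c j) (φ p)) :=
    .sum hφ _ fun i _ => .sum hφ _ fun j _ => .smul hφ ((hf i).mul (hg j)) (.comp hφ _)
  have h2 : IsSmoothAlong EM EP F φ (fun p => ∑ j, mvfderiv 𝓘(ℝ, EP) (g j) p (u p) • c j (φ p)) :=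
    .sum hφ _ fun j _ => .smul hφ (contMDiff_mvfderiv_apply (hg j) hs.smooth_snd) (.comp hφ _)
  have h3 : IsSmoothAlong EM EP F φ
      (fun p => ∑ i, (-mvfderiv 𝓘(ℝ, EP) (f i) p (v p)) • b i (φ p)) :=
    .sum hφ _ fun j _ => .smul hφ (contMDiff_mvfderiv_apply (hf j) ht.smooth_snd).neg (.comp hφ _)
  have := (h1.add hφ h2).add hφ h3
  simpa only [neg_smul, Finset.sum_neg_distrib, ← sub_eq_add_neg, decompBracket] using this


section Decomp

theorem IsDecomp.eventually {s : ∀ p : P, A (φ p)} {p : P} {ι : Type} [Fintype ι]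
    {f : ι → P → ℝ} {b : ι → Cₛ^∞⟮𝓘(ℝ, EM); F, A⟯} (h : IsDecomp EM EP F φ s p f b) :
    ∀ᶠ q in 𝓝 p, IsDecomp EM EP F φ s q f b :=
  (eventually_eventually_nhds.2 h.2).mono fun _ hq => ⟨h.1, hq⟩

theorem IsDecomp.add {s t : ∀ p : P, A (φ p)} {p : P} {ι κ : Type} [Fintype ι] [Fintype κ]
    {f : ι → P → ℝ} {b : ι → Cₛ^∞⟮𝓘(ℝ, EM); F, A⟯} (h : IsDecomp EM EP F φ s p f b)
    {g : κ → P → ℝ} {c : κ → Cₛ^∞⟮𝓘(ℝ, EM); F, A⟯} (h' : IsDecomp EM EP F φ t p g c) :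
    IsDecomp EM EP F φ (fun p => s p + t p) p (Sum.elim f g) (Sum.elim b c) := by
  refine ⟨?_, ?_⟩
  · rintro (i | j)
    exacts [h.1 i, h'.1 j]
  · filter_upwards [h.2, h'.2] with q h1 h2
    simp [h1, h2, Fintype.sum_sum_type]

theorem IsDecomp.smul {s : ∀ p : P, A (φ p)} {p : P} {ι : Type} [Fintype ι]
    {f : ι → P → ℝ} {b : ι → Cₛ^∞⟮𝓘(ℝ, EM); F, A⟯} (h : IsDecomp EM EP F φ s p f b)
    {k : P → ℝ} (hk : ContMDiff 𝓘(ℝ, EP) 𝓘(ℝ, ℝ) ∞ k) :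
    IsDecomp EM EP F φ (fun p => k p • s p) p (fun i p => k p * f i p) b := by
  refine ⟨fun i => hk.mul (h.1 i), ?_⟩
  filter_upwards [h.2] with q h1
  simp [h1, Finset.smul_sum, mul_smul]

end Decomp

section Pullback

variable (EP φ) (L) in
/-- The fibre of the pull-back Lie algebroid at `p`: the pairs `(a, u)` with `a` in the fibre of `A`
at `φ p` and `u` tangent to `P` at `p` such that `ρ(a) = Tφ(u)`. -/
def PullbackFiber (p : P) : Submodule ℝ (A (φ p) × TangentSpace 𝓘(ℝ, EP) p) :=
  LinearMap.eqLocus ((L.anchor (φ p)).comp (LinearMap.fst ℝ _ _))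
    ((mfderiv 𝓘(ℝ, EP) 𝓘(ℝ, EM) φ p).toLinearMap.comp (LinearMap.snd ℝ _ _))

variable (L) in
/-- The smooth sections of the pull-back Lie algebroid: both components, in the pull-back of the
vector bundle `A` and in `TP`, are smooth. -/
def pullbackSections (hφ : ContMDiff 𝓘(ℝ, EP) 𝓘(ℝ, EM) ∞ φ) :
    Submodule ℝ (∀ p : P, L.PullbackFiber EP φ p) where
  carrier := {s | IsSmoothAlong EM EP F φ (fun p => (s p).1.1) ∧
    ContMDiff 𝓘(ℝ, EP) 𝓘(ℝ, EP).tangent ∞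
      (fun p => (⟨p, (s p).1.2⟩ : TangentBundle 𝓘(ℝ, EP) P))}
  add_mem' := fun hs ht => ⟨hs.1.add hφ ht.1, hs.2.add_section ht.2⟩
  zero_mem' := ⟨.zero hφ, contMDiff_zeroSection ℝ (TangentSpace 𝓘(ℝ, EP))⟩
  smul_mem' := fun _ _ hs => ⟨hs.1.smul hφ contMDiff_const, hs.2.const_smul_section⟩

theorem isPullbackSection {hφ : ContMDiff 𝓘(ℝ, EP) 𝓘(ℝ, EM) ∞ φ} (s : L.pullbackSections hφ) :
    L.IsPullbackSection φ (fun p => (s.1 p).1.1) (fun p => (s.1 p).1.2) :=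
  ⟨s.2.1, s.2.2, fun p => (s.1 p).2⟩

variable [T2Space M] [T2Space P] {hφ : ContMDiff 𝓘(ℝ, EP) 𝓘(ℝ, EM) ∞ φ}

theorem exists_isDecomp' (s : L.pullbackSections hφ) (p : P) :
    ∃ (n : ℕ) (f : Fin n → P → ℝ) (b : Fin n → Cₛ^∞⟮𝓘(ℝ, EM); F, A⟯),
      IsDecomp EM EP F φ (fun q => (s.1 q).1.1) p f b :=
  exists_isDecomp hφ s.2.1 p

/-- The `A`-component of the bracket of two sections `(s, u)`, `(t, v)` of the pull-back Lie
algebroid, computed with arbitrary decompositions `s = ∑ i, f i ⊗ b i`, `t = ∑ j, g j ⊗ c j` near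
`p`; by `pullbackBracketFst_eq` it does not depend on their choice. -/
def pullbackBracketFst (s t : L.pullbackSections hφ) (p : P) : A (φ p) :=
  L.decompBracket φ p (s.1 p).1.2 (t.1 p).1.2
    (exists_isDecomp' s p).choose_spec.choose (exists_isDecomp' s p).choose_spec.choose_spec.choose
    (exists_isDecomp' t p).choose_spec.choose (exists_isDecomp' t p).choose_spec.choose_spec.choose

theorem pullbackBracketFst_eq (s t : L.pullbackSections hφ) {p : P}
    {ι κ : Type} [Fintype ι] [Fintype κ]
    {f : ι → P → ℝ} {b : ι → Cₛ^∞⟮𝓘(ℝ, EM); F, A⟯}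
    (hf : IsDecomp EM EP F φ (fun q => (s.1 q).1.1) p f b)
    {g : κ → P → ℝ} {c : κ → Cₛ^∞⟮𝓘(ℝ, EM); F, A⟯}
    (hg : IsDecomp EM EP F φ (fun q => (t.1 q).1.1) p g c) :
    pullbackBracketFst s t p = L.decompBracket φ p (s.1 p).1.2 (t.1 p).1.2 f b g c :=
  L.decompBracket_congr hφ s.2.1 t.2.1 (s.1 p).2 (t.1 p).2
    (exists_isDecomp' s p).choose_spec.choose_spec.choose_spec hf
    (exists_isDecomp' t p).choose_spec.choose_spec.choose_spec hg

/-- The bracket of sections of the pull-back Lie algebroid: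
`[(∑ i, f i ⊗ b i, u), (∑ j, g j ⊗ c j, v)] =
(∑ i j, f i g j ⊗ [b i, c j] + ∑ j, u(g j) ⊗ c j - ∑ i, v(f i) ⊗ b i, [u, v])`. -/
def pullbackBracketFun (s t : L.pullbackSections hφ) : L.pullbackSections hφ :=
  ⟨fun p => ⟨(pullbackBracketFst s t p,
      mlieBracket 𝓘(ℝ, EP) (fun q => (s.1 q).1.2) (fun q => (t.1 q).1.2) p),
    anchor_decompBracket hφ (isPullbackSection s) (isPullbackSection t)
      (exists_isDecomp' s p).choose_spec.choose_spec.choose_spec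
      (exists_isDecomp' t p).choose_spec.choose_spec.choose_spec⟩, by
    refine ⟨?_, contMDiff_mlieBracket s.2.2 t.2.2⟩
    intro p
    obtain ⟨n, f, b, hf⟩ := exists_isDecomp' s p
    obtain ⟨m, g, c, hg⟩ := exists_isDecomp' t p
    refine (contMDiff_decompBracket hφ (isPullbackSection s) (isPullbackSection t) b hf.1 c hg.1
      p).congr_of_eventuallyEq ?_
    filter_upwards [hf.eventually, hg.eventually] with q h1 h2
    simp only [pullbackBracketFst_eq s t h1 h2]⟩

theorem pullbackBracketFun_fst (s t : L.pullbackSections hφ) {p : P}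
    {ι κ : Type} [Fintype ι] [Fintype κ]
    {f : ι → P → ℝ} {b : ι → Cₛ^∞⟮𝓘(ℝ, EM); F, A⟯}
    (hf : IsDecomp EM EP F φ (fun q => (s.1 q).1.1) p f b)
    {g : κ → P → ℝ} {c : κ → Cₛ^∞⟮𝓘(ℝ, EM); F, A⟯}
    (hg : IsDecomp EM EP F φ (fun q => (t.1 q).1.1) p g c) :
    ((pullbackBracketFun s t).1 p).1.1 =
      L.decompBracket φ p (s.1 p).1.2 (t.1 p).1.2 f b g c :=
  pullbackBracketFst_eq s t hf hg

theorem pullbackSections_ext {s t : L.pullbackSections hφ} (h1 : ∀ p, (s.1 p).1.1 = (t.1 p).1.1)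
    (h2 : ∀ p, (s.1 p).1.2 = (t.1 p).1.2) : s = t :=
  Subtype.ext (funext fun p => Subtype.ext (Prod.ext (h1 p) (h2 p)))

theorem pullbackBracketFun_swap (s t : L.pullbackSections hφ) :
    pullbackBracketFun s t = - pullbackBracketFun t s := by
  apply pullbackSections_ext
  · intro p
    obtain ⟨n, f, b, hf⟩ := exists_isDecomp' s p
    obtain ⟨m, g, c, hg⟩ := exists_isDecomp' t p
    change _ = - ((pullbackBracketFun t s).1 p).1.1
    rw [pullbackBracketFun_fst s t hf hg, pullbackBracketFun_fst t s hg hf, decompBracket_swap]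
  · intro p
    exact mlieBracket_swap_apply

theorem pullbackBracketFun_add (s t t' : L.pullbackSections hφ) :
    pullbackBracketFun s (t + t') = pullbackBracketFun s t + pullbackBracketFun s t' := by
  apply pullbackSections_ext
  · intro p
    obtain ⟨n, f, b, hf⟩ := exists_isDecomp' s p
    obtain ⟨m, g, c, hg⟩ := exists_isDecomp' t p
    obtain ⟨m', g', c', hg'⟩ := exists_isDecomp' t' p
    change _ = ((pullbackBracketFun s t).1 p).1.1 + ((pullbackBracketFun s t').1 p).1.1
    rw [pullbackBracketFun_fst s t hf hg, pullbackBracketFun_fst s t' hf hg',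
      pullbackBracketFun_fst s (t + t') hf (hg.add hg')]
    change L.decompBracket φ p _ ((t.1 p).1.2 + (t'.1 p).1.2) _ _ _ _ = _
    simp only [decompBracket, Fintype.sum_sum_type, Sum.elim_inl, Sum.elim_inr, map_add, add_smul,
      Finset.sum_add_distrib]
    module
  · intro p
    exact mlieBracket_add_right (t.2.2.mdifferentiable (by simp) p)
      (t'.2.2.mdifferentiable (by simp) p)

variable (L hφ) in
/-- The product of a section of the pull-back Lie algebroid with a smooth function. -/
def pullbackSMul (k : P → ℝ) (hk : ContMDiff 𝓘(ℝ, EP) 𝓘(ℝ, ℝ) ∞ k) (s : L.pullbackSections hφ) :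
    L.pullbackSections hφ :=
  ⟨fun p => k p • s.1 p, s.2.1.smul hφ hk, hk.smul_section s.2.2⟩

theorem pullbackBracketFun_smul (k : P → ℝ) (hk : ContMDiff 𝓘(ℝ, EP) 𝓘(ℝ, ℝ) ∞ k)
    (s t : L.pullbackSections hφ) (p : P) :
    (pullbackBracketFun s (L.pullbackSMul hφ k hk t)).1 p = k p • (pullbackBracketFun s t).1 p +
      mvfderiv 𝓘(ℝ, EP) k p (s.1 p).1.2 • t.1 p := by
  apply Subtype.ext
  apply Prod.ext
  · obtain ⟨n, f, b, hf⟩ := exists_isDecomp' s p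
    obtain ⟨m, g, c, hg⟩ := exists_isDecomp' t p
    have ht : (t.1 p).1.1 = ∑ j, g j p • c j (φ p) := hg.2.self_of_nhds
    change _ = k p • ((pullbackBracketFun s t).1 p).1.1 +
      mvfderiv 𝓘(ℝ, EP) k p (s.1 p).1.2 • (t.1 p).1.1
    rw [pullbackBracketFun_fst s t hf hg,
      pullbackBracketFun_fst s (L.pullbackSMul hφ k hk t) hf (hg.smul hk), ht]
    change L.decompBracket φ p _ (k p • (t.1 p).1.2) _ _ _ _ = _
    have hd : ∀ j, mvfderiv 𝓘(ℝ, EP) (fun q => k q * g j q) p (s.1 p).1.2 =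
        k p * mvfderiv 𝓘(ℝ, EP) (g j) p (s.1 p).1.2 +
          g j p * mvfderiv 𝓘(ℝ, EP) k p (s.1 p).1.2 := by
      intro j
      have h1 := mvfderiv_mul (hk.mdifferentiable (by simp) p) ((hg.1 j).mdifferentiable (by simp) p)
      exact congrArg (fun l => l (s.1 p).1.2) h1
    have e1 : ∑ i, ∑ j, (f i p * (k p * g j p)) • L.bracket (b i) (c j) (φ p) =
        k p • ∑ i, ∑ j, (f i p * g j p) • L.bracket (b i) (c j) (φ p) := by
      simp only [Finset.smul_sum]
      exact Finset.sum_congr rfl fun i _ => Finset.sum_congr rfl fun j _ => by module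
    have e2 : ∑ j, (k p * mvfderiv 𝓘(ℝ, EP) (g j) p (s.1 p).1.2 +
          g j p * mvfderiv 𝓘(ℝ, EP) k p (s.1 p).1.2) • c j (φ p) =
        k p • ∑ j, mvfderiv 𝓘(ℝ, EP) (g j) p (s.1 p).1.2 • c j (φ p) +
          mvfderiv 𝓘(ℝ, EP) k p (s.1 p).1.2 • ∑ j, g j p • c j (φ p) := by
      simp only [Finset.smul_sum, ← Finset.sum_add_distrib]
      exact Finset.sum_congr rfl fun j _ => by module
    have e3 : ∑ i, mvfderiv 𝓘(ℝ, EP) (f i) p (k p • (t.1 p).1.2) • b i (φ p) =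
        k p • ∑ i, mvfderiv 𝓘(ℝ, EP) (f i) p (t.1 p).1.2 • b i (φ p) := by
      simp only [Finset.smul_sum, map_smul, smul_eq_mul]
      exact Finset.sum_congr rfl fun j _ => by module
    simp only [decompBracket, hd]
    rw [e1, e2, e3]
    module
  · exact (mlieBracket_smul_right (hk.mdifferentiable (by simp) p)
      (t.2.2.mdifferentiable (by simp) p)).trans (add_comm _ _)

theorem pullbackBracketFun_const_smul (r : ℝ) (s t : L.pullbackSections hφ) :
    pullbackBracketFun s (r • t) = r • pullbackBracketFun s t := by
  refine Subtype.ext (funext fun p => ?_)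
  have h := pullbackBracketFun_smul (fun _ => r) contMDiff_const s t p
  rw [mvfderiv_const] at h
  refine Eq.trans h ?_
  simp

theorem eq_zero_of_eq_neg {V : Type*} [AddCommGroup V] [Module ℝ V] {x : V} (hx : x = -x) :
    x = 0 := by
  have h2 : (2 : ℝ) • x = 0 :=
    (two_smul ℝ x).trans ((congrArg (fun y => x + y) hx).trans (add_neg_cancel x))
  exact (smul_eq_zero.1 h2).resolve_left two_ne_zero

theorem pullbackBracketFun_self (s : L.pullbackSections hφ) : pullbackBracketFun s s = 0 := by
  have h := pullbackBracketFun_swap s s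
  apply pullbackSections_ext
  · intro p
    have h1 : ((pullbackBracketFun s s).1 p).1.1 = -((pullbackBracketFun s s).1 p).1.1 :=
      congrArg (fun a : L.pullbackSections hφ => (a.1 p).1.1) h
    exact eq_zero_of_eq_neg h1
  · intro p
    have h1 : ((pullbackBracketFun s s).1 p).1.2 = -((pullbackBracketFun s s).1 p).1.2 :=
      congrArg (fun a : L.pullbackSections hφ => (a.1 p).1.2) h
    exact eq_zero_of_eq_neg h1

/-- A decomposition of the `A`-component of a bracket. -/
theorem isDecomp_bracket (s t : L.pullbackSections hφ) {p : P}
    {ι κ : Type} [Fintype ι] [Fintype κ]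
    {f : ι → P → ℝ} {b : ι → Cₛ^∞⟮𝓘(ℝ, EM); F, A⟯}
    (hf : IsDecomp EM EP F φ (fun q => (s.1 q).1.1) p f b)
    {g : κ → P → ℝ} {c : κ → Cₛ^∞⟮𝓘(ℝ, EM); F, A⟯}
    (hg : IsDecomp EM EP F φ (fun q => (t.1 q).1.1) p g c) :
    IsDecomp EM EP F φ (fun q => ((pullbackBracketFun s t).1 q).1.1) p
      (Sum.elim (fun (ij : ι × κ) q => f ij.1 q * g ij.2 q)
        (Sum.elim (fun j q => mvfderiv 𝓘(ℝ, EP) (g j) q (s.1 q).1.2)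
          (fun i q => - mvfderiv 𝓘(ℝ, EP) (f i) q (t.1 q).1.2)))
      (Sum.elim (fun ij : ι × κ => L.bracket (b ij.1) (c ij.2)) (Sum.elim c b)) := by
  refine ⟨?_, ?_⟩
  · rintro (⟨i, j⟩ | j | i)
    · exact (hf.1 i).mul (hg.1 j)
    · exact contMDiff_mvfderiv_apply (hg.1 j) s.2.2
    · exact (contMDiff_mvfderiv_apply (hf.1 i) t.2.2).neg
  · filter_upwards [hf.eventually, hg.eventually] with q h1 h2
    rw [pullbackBracketFun_fst s t h1 h2]
    simp only [decompBracket, Fintype.sum_sum_type, Sum.elim_inl, Sum.elim_inr, neg_smul,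
      Fintype.sum_prod_type, Finset.sum_neg_distrib]
    module

theorem double_bracket (r s t : L.pullbackSections hφ) {p : P}
    {ι κ τ : Type} [Fintype ι] [Fintype κ] [Fintype τ]
    {k : τ → P → ℝ} {a : τ → Cₛ^∞⟮𝓘(ℝ, EM); F, A⟯}
    (hk : IsDecomp EM EP F φ (fun q => (r.1 q).1.1) p k a)
    {f : ι → P → ℝ} {b : ι → Cₛ^∞⟮𝓘(ℝ, EM); F, A⟯}
    (hf : IsDecomp EM EP F φ (fun q => (s.1 q).1.1) p f b)
    {g : κ → P → ℝ} {c : κ → Cₛ^∞⟮𝓘(ℝ, EM); F, A⟯}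
    (hg : IsDecomp EM EP F φ (fun q => (t.1 q).1.1) p g c) :
    ((pullbackBracketFun r (pullbackBracketFun s t)).1 p).1.1 =
      ∑ l, ∑ i, ∑ j, (k l p * f i p * g j p) • L.bracket (a l) (L.bracket (b i) (c j)) (φ p)
      + ∑ l, ∑ j, (k l p * mvfderiv 𝓘(ℝ, EP) (g j) p (s.1 p).1.2) • L.bracket (a l) (c j) (φ p)
      - ∑ l, ∑ i, (k l p * mvfderiv 𝓘(ℝ, EP) (f i) p (t.1 p).1.2) • L.bracket (a l) (b i) (φ p)
      + ∑ i, ∑ j, (g j p * mvfderiv 𝓘(ℝ, EP) (f i) p (r.1 p).1.2) • L.bracket (b i) (c j) (φ p)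
      + ∑ i, ∑ j, (f i p * mvfderiv 𝓘(ℝ, EP) (g j) p (r.1 p).1.2) • L.bracket (b i) (c j) (φ p)
      + ∑ j, mvfderiv 𝓘(ℝ, EP) (fun q => mvfderiv 𝓘(ℝ, EP) (g j) q (s.1 q).1.2) p (r.1 p).1.2 •
          c j (φ p)
      - ∑ i, mvfderiv 𝓘(ℝ, EP) (fun q => mvfderiv 𝓘(ℝ, EP) (f i) q (t.1 q).1.2) p (r.1 p).1.2 •
          b i (φ p)
      - ∑ l, mvfderiv 𝓘(ℝ, EP) (fun q => mvfderiv 𝓘(ℝ, EP) (k l) q (t.1 q).1.2) p (s.1 p).1.2 •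
          a l (φ p)
      + ∑ l, mvfderiv 𝓘(ℝ, EP) (fun q => mvfderiv 𝓘(ℝ, EP) (k l) q (s.1 q).1.2) p (t.1 p).1.2 •
          a l (φ p) := by
  rw [pullbackBracketFun_fst r _ hk (isDecomp_bracket s t hf hg)]
  change L.decompBracket φ p (r.1 p).1.2
    (mlieBracket 𝓘(ℝ, EP) (fun q => (s.1 q).1.2) (fun q => (t.1 q).1.2) p) _ _ _ _ = _
  have h1 : ∀ i j, mvfderiv 𝓘(ℝ, EP) (fun q => f i q * g j q) p (r.1 p).1.2 =
      f i p * mvfderiv 𝓘(ℝ, EP) (g j) p (r.1 p).1.2 +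
        g j p * mvfderiv 𝓘(ℝ, EP) (f i) p (r.1 p).1.2 := by
    intro i j
    have h1 := mvfderiv_mul ((hf.1 i).mdifferentiable (by simp) p)
      ((hg.1 j).mdifferentiable (by simp) p)
    exact congrArg (fun l => l (r.1 p).1.2) h1
  have h2 : ∀ i, mvfderiv 𝓘(ℝ, EP) (fun q => - mvfderiv 𝓘(ℝ, EP) (f i) q (t.1 q).1.2) p
      (r.1 p).1.2 = - mvfderiv 𝓘(ℝ, EP) (fun q => mvfderiv 𝓘(ℝ, EP) (f i) q (t.1 q).1.2) p
      (r.1 p).1.2 := by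
    intro i
    have h1 := mvfderiv_neg (I := 𝓘(ℝ, EP)) (x := p)
      (g := fun q => mvfderiv 𝓘(ℝ, EP) (f i) q (t.1 q).1.2)
    exact congrArg (fun l => l (r.1 p).1.2) h1
  simp only [decompBracket, Fintype.sum_sum_type, Sum.elim_inl, Sum.elim_inr, h1, h2,
    Fintype.sum_prod_type, mvfderiv_mlieBracket (hk.1 _) s.2.2 t.2.2, add_smul, sub_smul, neg_smul,
    Finset.sum_add_distrib, Finset.sum_sub_distrib, Finset.sum_neg_distrib, mul_neg, mul_assoc]
  module

theorem pullback_jacobi (r s t : L.pullbackSections hφ) :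
    pullbackBracketFun r (pullbackBracketFun s t) =
      pullbackBracketFun (pullbackBracketFun r s) t +
        pullbackBracketFun s (pullbackBracketFun r t) := by
  rw [pullbackBracketFun_swap (pullbackBracketFun r s) t]
  apply pullbackSections_ext
  · intro p
    obtain ⟨m, k, a, hk⟩ := exists_isDecomp' r p
    obtain ⟨n, f, b, hf⟩ := exists_isDecomp' s p
    obtain ⟨m', g, c, hg⟩ := exists_isDecomp' t p
    change _ = - ((pullbackBracketFun t (pullbackBracketFun r s)).1 p).1.1 +
      ((pullbackBracketFun s (pullbackBracketFun r t)).1 p).1.1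
    rw [double_bracket r s t hk hf hg, double_bracket t r s hg hk hf, double_bracket s r t hf hk hg]
    have J : ∑ l, ∑ i, ∑ j, (k l p * f i p * g j p) •
          L.bracket (a l) (L.bracket (b i) (c j)) (φ p) =
        - ∑ j, ∑ l, ∑ i, (g j p * k l p * f i p) •
          L.bracket (c j) (L.bracket (a l) (b i)) (φ p) +
        ∑ i, ∑ l, ∑ j, (f i p * k l p * g j p) •
          L.bracket (b i) (L.bracket (a l) (c j)) (φ p) := by
      have c1 : ∀ X : Fin m' → Fin m → Fin n → A (φ p),
          ∑ j, ∑ l, ∑ i, X j l i = ∑ l, ∑ i, ∑ j, X j l i := by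
        intro X
        rw [Finset.sum_comm]
        exact Finset.sum_congr rfl fun l _ => Finset.sum_comm
      have c2 : ∀ X : Fin n → Fin m → Fin m' → A (φ p),
          ∑ i, ∑ l, ∑ j, X i l j = ∑ l, ∑ i, ∑ j, X i l j := fun X => Finset.sum_comm
      rw [c1, c2]
      simp only [← Finset.sum_neg_distrib, ← Finset.sum_add_distrib]
      refine Finset.sum_congr rfl fun l _ => Finset.sum_congr rfl fun i _ =>
        Finset.sum_congr rfl fun j _ => ?_
      rw [L.jacobi (a l) (b i) (c j), L.bracket_swap (c j)]
      simp only [ContMDiffSection.coe_add, ContMDiffSection.coe_neg, Pi.add_apply, Pi.neg_apply]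
      module
    have sw : ∀ {n m : ℕ} (X : Fin n → Fin m → ℝ) (y : Fin n → Cₛ^∞⟮𝓘(ℝ, EM); F, A⟯)
        (z : Fin m → Cₛ^∞⟮𝓘(ℝ, EM); F, A⟯),
        ∑ i, ∑ j, X i j • L.bracket (y i) (z j) (φ p) =
          - ∑ j, ∑ i, X i j • L.bracket (z j) (y i) (φ p) := by
      intro n m X y z
      rw [Finset.sum_comm, ← Finset.sum_neg_distrib]
      refine Finset.sum_congr rfl fun j _ => ?_
      rw [← Finset.sum_neg_distrib]
      refine Finset.sum_congr rfl fun i _ => ?_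
      rw [L.bracket_swap (y i) (z j)]
      simp
    rw [J, sw _ c a, sw _ c b, sw _ b a]
    module
  · intro p
    have : IsManifold 𝓘(ℝ, EP) (minSmoothness ℝ 3) P :=
      .of_le (n := ∞) (by simp; exact WithTop.coe_le_coe.2 le_top)
    have sm : ∀ s : L.pullbackSections hφ, ContMDiffAt 𝓘(ℝ, EP) 𝓘(ℝ, EP).tangent
        (minSmoothness ℝ 2)
        (fun q => (⟨q, (s.1 q).1.2⟩ : TangentBundle 𝓘(ℝ, EP) P)) p := fun s =>
      (s.2.2 p).of_le (by simp; exact WithTop.coe_le_coe.2 le_top)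
    have e := leibniz_identity_mlieBracket_apply (sm r) (sm s) (sm t)
    have e' := mlieBracket_swap_apply (I := 𝓘(ℝ, EP)) (x := p)
      (V := mlieBracket 𝓘(ℝ, EP) (fun q => (r.1 q).1.2) (fun q => (s.1 q).1.2))
      (W := fun q => (t.1 q).1.2)
    rw [e'] at e
    exact e

end Pullback

end LieAlgebroid

section Cohomology

/-- A Lie algebroid over the manifold `X` (modelled on `E`), given by its fibres `B x`, by the
space of its smooth sections among all sections, by its anchor and by the Lie bracket of smooth
sections. This is the form in which the Lie algebroid cohomology is computed; it is used for Lie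
algebroids on smooth vector bundles (`LieAlgebroid.toSections`) and for pull-back Lie algebroids
(`LieAlgebroid.pullback`), whose fibres are subspaces of `A (φ p) × T_p P`. -/
structure SectionAlgebroid (E : Type*) {X : Type*} [NormedAddCommGroup E] [NormedSpace ℝ E]
    [TopologicalSpace X] [ChartedSpace E X] [IsManifold 𝓘(ℝ, E) ∞ X]
    (B : X → Type*) [∀ x, AddCommGroup (B x)] [∀ x, Module ℝ (B x)] where
  /-- The smooth sections. -/
  sections : Submodule ℝ (∀ x, B x)
  smul_mem : ∀ f : X → ℝ, ContMDiff 𝓘(ℝ, E) 𝓘(ℝ, ℝ) ∞ f →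
    ∀ s ∈ sections, (fun x => f x • s x) ∈ sections
  /-- The anchor. -/
  anchor : ∀ x, B x →ₗ[ℝ] TangentSpace 𝓘(ℝ, E) x
  contMDiff_anchor : ∀ s ∈ sections, ContMDiff 𝓘(ℝ, E) 𝓘(ℝ, E).tangent ∞
    (fun x => (⟨x, anchor x (s x)⟩ : TangentBundle 𝓘(ℝ, E) X))
  /-- The Lie bracket of smooth sections. -/
  bracket : sections →ₗ[ℝ] sections →ₗ[ℝ] sections
  bracket_self : ∀ s, bracket s s = 0
  jacobi : ∀ r s t, bracket r (bracket s t) = bracket (bracket r s) t + bracket s (bracket r t)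
  leibniz : ∀ (s t : sections) (f : X → ℝ) (hf : ContMDiff 𝓘(ℝ, E) 𝓘(ℝ, ℝ) ∞ f) (x : X),
    (bracket s ⟨fun y => f y • t.1 y, smul_mem f hf t.1 t.2⟩).1 x =
      f x • (bracket s t).1 x + mvfderiv 𝓘(ℝ, E) f x (anchor x (s.1 x)) • t.1 x
  anchor_bracket : ∀ (s t : sections) (x : X), anchor x ((bracket s t).1 x) =
    mlieBracket 𝓘(ℝ, E) (fun y => anchor y (s.1 y)) (fun y => anchor y (t.1 y)) x

namespace SectionAlgebroid

variable {E X : Type*} [NormedAddCommGroup E] [NormedSpace ℝ E] [FiniteDimensional ℝ E]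
  [TopologicalSpace X] [ChartedSpace E X] [IsManifold 𝓘(ℝ, E) ∞ X]
  {B : X → Type*} [∀ x, AddCommGroup (B x)] [∀ x, Module ℝ (B x)] (S : SectionAlgebroid E B)

/-- The 1-cochains `Ω¹(B) = Γ(B*)`: families of linear forms on the fibres that take smooth
sections to smooth functions. -/
def cochains : Submodule ℝ (∀ x, B x →ₗ[ℝ] ℝ) where
  carrier := {α | ∀ s ∈ S.sections, ContMDiff 𝓘(ℝ, E) 𝓘(ℝ, ℝ) ∞ (fun x => α x (s x))}
  add_mem' := fun ha hb s hs => (ha s hs).add (hb s hs)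
  zero_mem' := fun _ _ => contMDiff_const
  smul_mem' := fun _ _ ha s hs => contMDiff_const.mul (ha s hs)

/-- The space `Ω¹(B)` of 1-cochains. -/
def Cochain : Type _ := S.cochains

instance : AddCommGroup S.Cochain := inferInstanceAs (AddCommGroup S.cochains)

instance : Module ℝ S.Cochain := inferInstanceAs (Module ℝ S.cochains)

theorem mvfderiv_const_mul {f : X → ℝ} {x : X} (hf : MDifferentiableAt 𝓘(ℝ, E) 𝓘(ℝ, ℝ) f x)
    (r : ℝ) (v : TangentSpace 𝓘(ℝ, E) x) :
    mvfderiv 𝓘(ℝ, E) (fun y => r * f y) x v = r * mvfderiv 𝓘(ℝ, E) f x v := by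
  have h := mvfderiv_mul (I := 𝓘(ℝ, E)) (mdifferentiableAt_const (c := r)) hf
  rw [mvfderiv_const] at h
  rw [smul_zero, add_zero] at h
  exact congrArg (fun l => l v) h

theorem mdifferentiableAt_cochain (α : S.Cochain) (s : S.sections) (x : X) :
    MDifferentiableAt 𝓘(ℝ, E) 𝓘(ℝ, ℝ) (fun y => α.1 y (s.1 y)) x :=
  (α.2 s.1 s.2).mdifferentiable (by simp) x

/-- The differential `C^∞(X) → Ω¹(B)`, `(d f)(s) = ρ(s) f`. -/
def d0 : C^∞⟮𝓘(ℝ, E), X; ℝ⟯ →ₗ[ℝ] S.Cochain where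
  toFun f := ⟨fun x => (mvfderiv 𝓘(ℝ, E) f x).toLinearMap.comp (S.anchor x),
    fun s hs => contMDiff_mvfderiv_apply f.contMDiff (S.contMDiff_anchor s hs)⟩
  map_add' f g := by
    refine Subtype.ext (funext fun x => LinearMap.ext fun v => ?_)
    have h := mvfderiv_add (f.contMDiff.mdifferentiable (by simp) x)
      (g.contMDiff.mdifferentiable (by simp) x)
    exact congrArg (fun l => l (S.anchor x v)) h
  map_smul' r f := Subtype.ext <| funext fun x => LinearMap.ext fun v =>
    mvfderiv_const_mul (f.contMDiff.mdifferentiable (by simp) x) r (S.anchor x v)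

/-- The differential on 1-cochains,
`(d α)(s, t) = ρ(s) (α(t)) - ρ(t) (α(s)) - α([s, t])`. -/
def d1 : S.Cochain →ₗ[ℝ] (S.sections → S.sections → X → ℝ) where
  toFun α s t x :=
    mvfderiv 𝓘(ℝ, E) (fun y => α.1 y (t.1 y)) x (S.anchor x (s.1 x))
      - mvfderiv 𝓘(ℝ, E) (fun y => α.1 y (s.1 y)) x (S.anchor x (t.1 x))
      - α.1 x ((S.bracket s t).1 x)
  map_add' α β := by
    ext s t x
    have h : ∀ s t : S.sections, mvfderiv 𝓘(ℝ, E) (fun y => (α + β).1 y (t.1 y)) x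
        (S.anchor x (s.1 x)) = mvfderiv 𝓘(ℝ, E) (fun y => α.1 y (t.1 y)) x (S.anchor x (s.1 x)) +
        mvfderiv 𝓘(ℝ, E) (fun y => β.1 y (t.1 y)) x (S.anchor x (s.1 x)) := fun s t =>
      congrArg (fun l => l (S.anchor x (s.1 x)))
        (mvfderiv_add (S.mdifferentiableAt_cochain α t x) (S.mdifferentiableAt_cochain β t x))
    have h' : ∀ v, (α + β).1 x v = α.1 x v + β.1 x v := fun _ => rfl
    rw [h s t, h t s, h']
    simp only [Pi.add_apply]
    ring
  map_smul' r α := by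
    ext s t x
    have h : ∀ s t : S.sections, mvfderiv 𝓘(ℝ, E) (fun y => (r • α).1 y (t.1 y)) x
        (S.anchor x (s.1 x)) =
        r * mvfderiv 𝓘(ℝ, E) (fun y => α.1 y (t.1 y)) x (S.anchor x (s.1 x)) := fun s t =>
      mvfderiv_const_mul (S.mdifferentiableAt_cochain α t x) r _
    have h' : ∀ v, (r • α).1 x v = r * α.1 x v := fun _ => rfl
    rw [h s t, h t s, h']
    simp only [Pi.smul_apply, smul_eq_mul, RingHom.id_apply]
    ring

theorem d1_d0 [T2Space X] (f : C^∞⟮𝓘(ℝ, E), X; ℝ⟯) : S.d1 (S.d0 f) = 0 := by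
  ext s t x
  change mvfderiv 𝓘(ℝ, E) (fun y => mvfderiv 𝓘(ℝ, E) f y (S.anchor y (t.1 y))) x _ -
    mvfderiv 𝓘(ℝ, E) (fun y => mvfderiv 𝓘(ℝ, E) f y (S.anchor y (s.1 y))) x _ -
    mvfderiv 𝓘(ℝ, E) f x (S.anchor x ((S.bracket s t).1 x)) = 0
  rw [S.anchor_bracket, mvfderiv_mlieBracket f.contMDiff (S.contMDiff_anchor s.1 s.2)
    (S.contMDiff_anchor t.1 t.2)]
  exact sub_self _

/-- The closed 1-cochains. -/
def cocycles : Submodule ℝ S.Cochain := LinearMap.ker S.d1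

/-- The exact 1-cochains. -/
def coboundaries : Submodule ℝ S.Cochain := LinearMap.range S.d0

theorem coboundaries_le_cocycles [T2Space X] : S.coboundaries ≤ S.cocycles := by
  rintro _ ⟨f, rfl⟩
  exact S.d1_d0 f

/-- The first Lie algebroid cohomology `H¹(B)`: closed modulo exact 1-cochains. -/
abbrev H1 : Type _ := S.cocycles ⧸ S.coboundaries.submoduleOf S.cocycles

end SectionAlgebroid

end Cohomology

namespace LieAlgebroid

section PullbackCohomology

variable {EM EP F M P : Type*}
  [NormedAddCommGroup EM] [NormedSpace ℝ EM] [FiniteDimensional ℝ EM]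
  [TopologicalSpace M] [ChartedSpace EM M] [IsManifold 𝓘(ℝ, EM) ∞ M]
  [NormedAddCommGroup EP] [NormedSpace ℝ EP] [FiniteDimensional ℝ EP]
  [TopologicalSpace P] [ChartedSpace EP P] [IsManifold 𝓘(ℝ, EP) ∞ P]
  [NormedAddCommGroup F] [NormedSpace ℝ F] [FiniteDimensional ℝ F]
  {A : M → Type*} [TopologicalSpace (TotalSpace F A)] [∀ x, AddCommGroup (A x)]
  [∀ x, Module ℝ (A x)] [∀ x, TopologicalSpace (A x)] [FiberBundle F A] [VectorBundle ℝ F A]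
  [ContMDiffVectorBundle ∞ F A 𝓘(ℝ, EM)]
  (L : LieAlgebroid EM F A) {φ : P → M}

variable (EM F A) in
/-- The smooth sections of the vector bundle `A`, as a space of sections. -/
def smoothSections : Submodule ℝ (∀ x, A x) where
  carrier := {s | ContMDiff 𝓘(ℝ, EM) (𝓘(ℝ, EM).prod 𝓘(ℝ, F)) ∞
    (fun x => TotalSpace.mk' F x (s x))}
  add_mem' := fun hs ht => hs.add_section ht
  zero_mem' := contMDiff_zeroSection ℝ A
  smul_mem' := fun _ _ hs => hs.const_smul_section

/-- A smooth section, as an element of the bundled type of smooth sections. -/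
def toSection (s : smoothSections EM F A) : Cₛ^∞⟮𝓘(ℝ, EM); F, A⟯ := ⟨s.1, s.2⟩

/-- The bracket on the space of smooth sections. -/
def sectionsBracket :
    smoothSections EM F A →ₗ[ℝ] smoothSections EM F A →ₗ[ℝ] smoothSections EM F A :=
  LinearMap.mk₂ ℝ
    (fun s t => ⟨fun x => L.bracket (toSection s) (toSection t) x,
      (L.bracket (toSection s) (toSection t)).contMDiff⟩)
    (fun s s' t => Subtype.ext <| funext fun x => by
      change L.bracket (toSection s + toSection s') (toSection t) x = _
      rw [map_add]; rfl)
    (fun r s t => Subtype.ext <| funext fun x => by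
      change L.bracket (r • toSection s) (toSection t) x = _
      rw [map_smul]; rfl)
    (fun s t t' => Subtype.ext <| funext fun x => by
      change L.bracket (toSection s) (toSection t + toSection t') x = _
      rw [map_add]; rfl)
    (fun r s t => Subtype.ext <| funext fun x => by
      change L.bracket (toSection s) (r • toSection t) x = _
      rw [map_smul]; rfl)

/-- A Lie algebroid on a smooth vector bundle `A`, given by the smooth sections of `A`. -/
def toSections : SectionAlgebroid EM A where
  sections := smoothSections EM F A
  smul_mem := fun _ hf _ hs => hf.smul_section hs
  anchor := L.anchor
  contMDiff_anchor := fun s hs => L.contMDiff_anchor_section ⟨s, hs⟩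
  bracket := L.sectionsBracket
  bracket_self := fun s => Subtype.ext <| funext fun x =>
    congrArg (fun a : Cₛ^∞⟮𝓘(ℝ, EM); F, A⟯ => a x) (L.bracket_self (toSection s))
  jacobi := fun r s t => Subtype.ext <| funext fun x =>
    congrArg (fun a : Cₛ^∞⟮𝓘(ℝ, EM); F, A⟯ => a x)
      (L.jacobi (toSection r) (toSection s) (toSection t))
  leibniz := fun s t f hf x =>
    L.leibniz (toSection s) (toSection t) (fsmul f hf (toSection t)) f hf (fun _ => rfl) x
  anchor_bracket := fun s t x => L.anchor_bracket (toSection s) (toSection t) x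

variable [T2Space M] [T2Space P]

/-- The pull-back Lie algebroid `φ^! A` over `P`, for a smooth map `φ : P → M` (the fibres
`A ×_{TM} TP` have constant rank if `φ` is a submersion). Its anchor is the projection to `TP`. -/
def pullback (hφ : ContMDiff 𝓘(ℝ, EP) 𝓘(ℝ, EM) ∞ φ) :
    SectionAlgebroid EP (fun p => L.PullbackFiber EP φ p) where
  sections := L.pullbackSections hφ
  smul_mem := fun f hf s hs => (L.pullbackSMul hφ f hf ⟨s, hs⟩).2
  anchor := fun p => (LinearMap.snd ℝ (A (φ p)) (TangentSpace 𝓘(ℝ, EP) p)).comp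
    (L.PullbackFiber EP φ p).subtype
  contMDiff_anchor := fun _ hs => hs.2
  bracket := LinearMap.mk₂ ℝ (fun s t => pullbackBracketFun s t)
    (fun s s' t => by
      rw [pullbackBracketFun_swap, pullbackBracketFun_add, pullbackBracketFun_swap s t,
        pullbackBracketFun_swap s' t]
      exact neg_add (pullbackBracketFun t s) (pullbackBracketFun t s'))
    (fun r s t => by
      rw [pullbackBracketFun_swap, pullbackBracketFun_swap s t]
      exact (congrArg Neg.neg (pullbackBracketFun_const_smul r t s)).trans (smul_neg r (pullbackBracketFun t s)).symm)
    (fun s t t' => pullbackBracketFun_add s t t')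
    (fun r s t => pullbackBracketFun_const_smul r s t)
  bracket_self := fun s => pullbackBracketFun_self s
  jacobi := fun r s t => pullback_jacobi r s t
  leibniz := fun s t f hf x => pullbackBracketFun_smul f hf s t x
  anchor_bracket := fun _ _ _ => rfl

variable {L} {hφ : ContMDiff 𝓘(ℝ, EP) 𝓘(ℝ, EM) ∞ φ}

theorem eventually_cochain_eq (α : L.toSections.Cochain) (s : L.pullbackSections hφ) {p : P}
    {ι : Type} [Fintype ι] {f : ι → P → ℝ} {b : ι → Cₛ^∞⟮𝓘(ℝ, EM); F, A⟯}
    (hf : IsDecomp EM EP F φ (fun q => (s.1 q).1.1) p f b) :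
    ∀ᶠ q in 𝓝 p, α.1 (φ q) (s.1 q).1.1 = ∑ i, f i q * (fun x => α.1 x (b i x)) (φ q) := by
  filter_upwards [hf.2] with q hq
  rw [hq]
  simp

variable (L hφ) in
/-- Pull-back of 1-cochains along the canonical morphism `φ^! A → A`, `(a, u) ↦ a`. -/
def pullbackCochain : L.toSections.Cochain →ₗ[ℝ] (L.pullback hφ).Cochain where
  toFun α := ⟨fun p => ((α.1 (φ p)).comp
      (LinearMap.fst ℝ (A (φ p)) (TangentSpace 𝓘(ℝ, EP) p))).comp
      (L.PullbackFiber EP φ p).subtype, fun s hs p => by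
    obtain ⟨n, f, b, hf⟩ := exists_isDecomp' (L := L) (hφ := hφ) ⟨s, hs⟩ p
    have h : ContMDiff 𝓘(ℝ, EP) 𝓘(ℝ, ℝ) ∞
        (fun q => ∑ i, f i q * (fun x => α.1 x (b i x)) (φ q)) := by
      apply contMDiff_finsetSum
      intro i _
      exact (hf.1 i).mul ((α.2 (b i) (b i).contMDiff).comp hφ)
    exact (h p).congr_of_eventuallyEq (eventually_cochain_eq α (⟨s, hs⟩ : L.pullbackSections hφ) hf)⟩
  map_add' _ _ := rfl
  map_smul' _ _ := rfl

theorem pullbackCochain_apply (α : L.toSections.Cochain) (p : P) (a : L.PullbackFiber EP φ p) :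
    (L.pullbackCochain hφ α).1 p a = α.1 (φ p) a.1.1 := rfl

theorem pullbackCochain_d0 (f : C^∞⟮𝓘(ℝ, EM), M; ℝ⟯) :
    L.pullbackCochain hφ (L.toSections.d0 f) = (L.pullback hφ).d0 (f.comp ⟨φ, hφ⟩) := by
  refine Subtype.ext (funext fun p => LinearMap.ext fun a => ?_)
  change mvfderiv 𝓘(ℝ, EM) f (φ p) (L.anchor (φ p) a.1.1) = mvfderiv 𝓘(ℝ, EP) (f ∘ φ) p a.1.2
  rw [mvfderiv_comp_apply (I := 𝓘(ℝ, EM)) (I' := 𝓘(ℝ, EP)) p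
    (f.contMDiff.mdifferentiable (by simp) _) (hφ.mdifferentiable (by simp) p)]
  exact congrArg _ a.2

theorem pullbackCochain_mem_cocycles (α : L.toSections.Cochain) (hα : α ∈ L.toSections.cocycles) :
    L.pullbackCochain hφ α ∈ (L.pullback hφ).cocycles := by
  have hα' : ∀ (b c : Cₛ^∞⟮𝓘(ℝ, EM); F, A⟯) (x : M), α.1 x (L.bracket b c x) =
      mvfderiv 𝓘(ℝ, EM) (fun y => α.1 y (c y)) x (L.anchor x (b x)) -
        mvfderiv 𝓘(ℝ, EM) (fun y => α.1 y (b y)) x (L.anchor x (c x)) := by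
    intro b c x
    have h := congrFun (congrFun (congrFun (LinearMap.mem_ker.1 hα) ⟨b, b.contMDiff⟩)
      ⟨c, c.contMDiff⟩) x
    exact (sub_eq_zero.1 h).symm
  refine LinearMap.mem_ker.2 (funext fun s => funext fun t => funext fun p => ?_)
  obtain ⟨n, f, b, hf⟩ := exists_isDecomp' s p
  obtain ⟨m, g, c, hg⟩ := exists_isDecomp' t p
  change mvfderiv 𝓘(ℝ, EP) (fun q => α.1 (φ q) (t.1 q).1.1) p (s.1 p).1.2 -
    mvfderiv 𝓘(ℝ, EP) (fun q => α.1 (φ q) (s.1 q).1.1) p (t.1 p).1.2 -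
    α.1 (φ p) ((pullbackBracketFun s t).1 p).1.1 = 0
  have hs : ∀ b : Cₛ^∞⟮𝓘(ℝ, EM); F, A⟯, ContMDiff 𝓘(ℝ, EM) 𝓘(ℝ, ℝ) ∞ (fun x => α.1 x (b x)) :=
    fun b => α.2 b b.contMDiff
  rw [pullbackBracketFun_fst s t hf hg,
    mvfderiv_sum_mul_comp hφ hg.1 (fun i => hs (c i)) (eventually_cochain_eq α t hg),
    mvfderiv_sum_mul_comp hφ hf.1 (fun i => hs (b i)) (eventually_cochain_eq α s hf),
    decomp_anchor (isPullbackSection s) hf, decomp_anchor (isPullbackSection t) hg]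
  simp only [decompBracket, map_add, map_sub, map_sum, map_smul, hα', smul_eq_mul,
    Finset.sum_add_distrib, Finset.mul_sum, mul_sub, Finset.sum_sub_distrib]
  have e1 : ∀ X : Fin n → Fin m → ℝ,
      ∑ j, ∑ i, g j p * (f i p * X i j) = ∑ i, ∑ j, f i p * g j p * X i j := by
    intro X
    rw [Finset.sum_comm]
    exact Finset.sum_congr rfl fun i _ => Finset.sum_congr rfl fun j _ => by ring
  have e2 : ∀ X : Fin n → Fin m → ℝ,
      ∑ i, ∑ j, f i p * (g j p * X i j) = ∑ i, ∑ j, f i p * g j p * X i j := by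
    intro X
    exact Finset.sum_congr rfl fun i _ => Finset.sum_congr rfl fun j _ => by ring
  rw [e1, e2]
  simp only [mul_comm (mvfderiv 𝓘(ℝ, EP) _ _ _)]
  ring

variable (L hφ) in
/-- Pull-back of closed 1-cochains along the canonical morphism `φ^! A → A`. -/
def pullbackCocycles : L.toSections.cocycles →ₗ[ℝ] (L.pullback hφ).cocycles :=
  (L.pullbackCochain hφ).restrict fun α hα => pullbackCochain_mem_cocycles α hα

variable (L hφ) in
/-- The linear map `H¹(A) → H¹(φ^! A)` induced by the canonical morphism `φ^! A → A`. -/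
def pullbackH1 : L.toSections.H1 →ₗ[ℝ] (L.pullback hφ).H1 :=
  Submodule.mapQ _ _ (L.pullbackCocycles hφ) (by
    rintro ⟨α, hα⟩ ⟨f, rfl : L.toSections.d0 f = α⟩
    exact ⟨f.comp ⟨φ, hφ⟩, (pullbackCochain_d0 f).symm⟩)

end PullbackCohomology

end LieAlgebroid

end

/-!
The difference between `H¹(A)` and `H¹(φ^! A)` lies along the fibres of `φ`: the kernel of the
morphism `φ^! A → A` consists of the elements `(0, v)` with `v` tangent to a fibre. The local tool
is a fibred chart (`FibredChart`), in which `φ` is the projection of a product of balls.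

Injectivity: if the pull-back of `α` is `d f`, then evaluation on the elements `(0, v)` shows that
`f` has no derivative along the fibres. As these are connected, `f` is constant on them and descends
to a smooth function `g` on `M` (`eq_on_fibres_of_vertical_mvfderiv_eq_zero`,
`exists_contMDiff_comp_eq`), and `α = d g` because `Tφ` is surjective.

Surjectivity: a cocycle `β` restricts to a family of closed 1-forms on the fibres
(`LieAlgebroid.exists_isClosedAlongFibres`). In fibred charts the Poincaré lemma with parameters
(`exists_fibrewise_primitive`) gives primitives. On one fibre they are glued to a primitive by
lifting the identity of the fibre to the covering space of germs of primitives, which is possible as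
the fibre is simply connected (`exists_glue_of_simplyConnected`). The primitives of the various
fibres form a function `F` on `P`, which need not be smooth across the fibres; but subtracting from
`F` its values along local sections of `φ` makes it smooth, and these corrections are averaged with
a partition of unity on `M` (`exists_contMDiff_sub_comp`). The resulting smooth `f`
(`IsClosedAlongFibres.exists_primitive`) is such that `β - d f` vanishes on the elements `(0, v)`,
hence depends only on the `A`-component. Its closedness, applied to a vertical section and a lift
of a section of `A`, says that it is constant along the fibres, and it descends to a cocycle of `A`
(`LieAlgebroid.exists_pullbackCochain_eq`).
-/

noncomputable section

open Set Filter Topology VectorField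

set_option linter.unusedSectionVars false

/-! ### The Poincaré lemma with parameters -/

section ParametricIntegral

variable {H : Type*} [NormedAddCommGroup H] [NormedSpace ℝ H] [FiniteDimensional ℝ H]

/-- Differentiation under the integral sign, for a smooth integrand defined near `s × [0, 1]`. -/
theorem hasFDerivAt_intervalIntegral_of_contDiffOn {U : Set (H × ℝ)} (hU : IsOpen U) {s : Set H}
    (hs : IsOpen s) (hsU : s ×ˢ Icc (0 : ℝ) 1 ⊆ U) {f : H × ℝ → ℝ} (hf : ContDiffOn ℝ ∞ f U)
    {w : H} (hw : w ∈ s) :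
    HasFDerivAt (fun x => ∫ t in (0 : ℝ)..1, f (x, t))
      (∫ t in (0 : ℝ)..1, (fderiv ℝ f (w, t)).comp (ContinuousLinearMap.inl ℝ H ℝ)) w := by
  have hf' : ContinuousOn (fun q => (fderiv ℝ f q).comp (ContinuousLinearMap.inl ℝ H ℝ)) U :=
    (hf.continuousOn_fderiv_of_isOpen hU (by simp)).clm_comp continuousOn_const
  obtain ⟨ε, hε, hball⟩ := Metric.nhds_basis_closedBall.mem_iff.1 (hs.mem_nhds hw)
  have hK : IsCompact (Metric.closedBall w ε ×ˢ Icc (0 : ℝ) 1) :=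
    (isCompact_closedBall w ε).prod isCompact_Icc
  have hKU : Metric.closedBall w ε ×ˢ Icc (0 : ℝ) 1 ⊆ U :=
    (prod_mono hball subset_rfl).trans hsU
  obtain ⟨C, hC⟩ := hK.exists_bound_of_continuousOn (hf'.mono hKU)
  have hsub : ∀ x ∈ s, MapsTo (fun t : ℝ => (x, t)) (Icc 0 1) U := fun x hx t ht => hsU ⟨hx, ht⟩
  have hcont : ∀ x ∈ s, ContinuousOn (fun t => f (x, t)) (Icc 0 1) := fun x hx =>
    hf.continuousOn.comp (by fun_prop) (hsub x hx)
  have hI : uIoc (0 : ℝ) 1 ⊆ Icc 0 1 := by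
    rw [uIoc_of_le zero_le_one]; exact Ioc_subset_Icc_self
  have hu : uIcc (0 : ℝ) 1 = Icc 0 1 := uIcc_of_le zero_le_one
  refine intervalIntegral.hasFDerivAt_integral_of_dominated_of_fderiv_le (𝕜 := ℝ)
    (F := fun x t => f (x, t))
    (F' := fun x t => (fderiv ℝ f (x, t)).comp (ContinuousLinearMap.inl ℝ H ℝ))
    (bound := fun _ => C) (Metric.closedBall_mem_nhds w hε) ?_ ?_ ?_ ?_ ?_ ?_
  · filter_upwards [hs.mem_nhds hw] with x hx
    exact ((hcont x hx).mono hI).aestronglyMeasurable measurableSet_uIoc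
  · exact ContinuousOn.intervalIntegrable (by rw [hu]; exact hcont w hw)
  · exact (((hf'.comp (by fun_prop) (hsub w hw)).mono hI)).aestronglyMeasurable measurableSet_uIoc
  · exact .of_forall fun t ht x hx => hC (x, t) ⟨hx, hI ht⟩
  · exact intervalIntegrable_const
  · refine .of_forall fun t ht x hx => ?_
    have h1 : HasFDerivAt f (fderiv ℝ f (x, t)) (x, t) :=
      ((hf.contDiffAt (hU.mem_nhds (hKU ⟨hx, hI ht⟩))).differentiableAt (by simp)).hasFDerivAt
    exact h1.comp x (hasFDerivAt_prodMk_left x t)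

/-- An integral over `[0, 1]` of a smooth function depends smoothly on the parameters. -/
theorem contDiffOn_intervalIntegral {U : Set (H × ℝ)} (hU : IsOpen U) {s : Set H}
    (hs : IsOpen s) (hsU : s ×ˢ Icc (0 : ℝ) 1 ⊆ U) {f : H × ℝ → ℝ} (hf : ContDiffOn ℝ ∞ f U) :
    ContDiffOn ℝ ∞ (fun x => ∫ t in (0 : ℝ)..1, f (x, t)) s := by
  refine contDiffOn_infty.2 fun n => ?_
  induction n generalizing f with
  | zero =>
    exact contDiffOn_zero.2 fun w hw =>
      (hasFDerivAt_intervalIntegral_of_contDiffOn hU hs hsU hf hw).continuousAt.continuousWithinAt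
  | succ n ih =>
    have hd := fun w hw => hasFDerivAt_intervalIntegral_of_contDiffOn hU hs hsU hf (w := w) hw
    push_cast
    refine contDiffOn_succ_of_fderiv_apply
      (fun w hw => (hd w hw).differentiableAt.differentiableWithinAt) (by simp) fun y => ?_
    have hg : ContDiffOn ℝ ∞ (fun q => fderiv ℝ f q (y, 0)) U :=
      (hf.fderiv_of_isOpen hU (by simp)).clm_apply contDiffOn_const
    refine (ih hg).congr fun w hw => ?_
    rw [fderivWithin_of_isOpen hs hw, (hd w hw).fderiv,
      ContinuousLinearMap.intervalIntegral_apply]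
    · simp
    · have : ContinuousOn (fun t : ℝ => (fderiv ℝ f (w, t)).comp (ContinuousLinearMap.inl ℝ H ℝ))
          (Icc 0 1) :=
        ((hf.continuousOn_fderiv_of_isOpen hU (by simp)).comp (by fun_prop)
          fun t ht => hsU ⟨hw, ht⟩).clm_comp continuousOn_const
      exact ContinuousOn.intervalIntegrable (by rwa [uIcc_of_le zero_le_one])

end ParametricIntegral

section FibrewisePoincare

variable {E G : Type*} [NormedAddCommGroup E] [NormedSpace ℝ E] [FiniteDimensional ℝ E]
  [NormedAddCommGroup G] [NormedSpace ℝ G] [FiniteDimensional ℝ G]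

/-- The Poincaré lemma with parameters: a smooth family of closed 1-forms on balls of `G`,
parametrised by a ball of `E`, has a smooth family of primitives. -/
theorem exists_fibrewise_primitive {c : E × G} {r : ℝ} {η : E × G → G →L[ℝ] ℝ}
    (hη : ContDiffOn ℝ ∞ η (Metric.ball c r))
    (hclosed : ∀ w ∈ Metric.ball c r, ∀ y y' : G,
      fderiv ℝ η w (0, y) y' = fderiv ℝ η w (0, y') y) :
    ∃ g : E × G → ℝ, ContDiffOn ℝ ∞ g (Metric.ball c r) ∧
      ∀ w ∈ Metric.ball c r, ∀ y : G, fderiv ℝ g w (0, y) = η w y := by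
  set B := Metric.ball c r with hB
  have hBp : B = Metric.ball c.1 r ×ˢ Metric.ball c.2 r := (ball_prod_same c.1 c.2 r).symm
  have hBo : IsOpen B := Metric.isOpen_ball
  let γ : (E × G) × ℝ → E × G := fun q => (q.1.1, c.2 + q.2 • (q.1.2 - c.2))
  have hγ : ContDiff ℝ ∞ γ := by fun_prop
  let f : (E × G) × ℝ → ℝ := fun q => η (γ q) (q.1.2 - c.2)
  have hf : ContDiffOn ℝ ∞ f (γ ⁻¹' B) :=
    (hη.comp hγ.contDiffOn fun q hq => hq).clm_apply (by fun_prop)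
  have hsub : B ×ˢ Icc (0 : ℝ) 1 ⊆ γ ⁻¹' B := by
    rintro ⟨⟨x, z⟩, t⟩ ⟨hw, ht⟩
    rw [hBp] at hw
    have hr : 0 < r := Metric.pos_of_mem_ball hw.2
    rw [mem_preimage, hBp]
    exact ⟨hw.1, (convex_ball c.2 r).add_smul_sub_mem (Metric.mem_ball_self hr) hw.2 ht⟩
  have hg := contDiffOn_intervalIntegral (hBo.preimage hγ.continuous) hBo hsub hf
  refine ⟨_, hg, ?_⟩
  rintro ⟨x, z⟩ hw y
  have hw' := hw
  rw [hBp] at hw'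
  have hr : 0 < r := Metric.pos_of_mem_ball hw'.2
  -- On each slice `{x} × ball` the function is the integral of a closed form along segments.
  have hmem : ∀ z' ∈ Metric.ball c.2 r, (x, z') ∈ B := fun z' hz' => by
    rw [hBp]; exact ⟨hw'.1, hz'⟩
  have hd : ∀ z' ∈ Metric.ball c.2 r, HasFDerivWithinAt (fun z => η (x, z))
      ((fun z => (fderiv ℝ η (x, z)).comp (ContinuousLinearMap.inr ℝ E G)) z')
      (Metric.ball c.2 r) z' := fun z' hz' =>
    (((hη.contDiffAt (hBo.mem_nhds (hmem z' hz'))).differentiableAt (by simp)).hasFDerivAt.comp z'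
      (hasFDerivAt_prodMk_right x z')).hasFDerivWithinAt
  have key :=
    (convex_ball c.2 r).hasFDerivWithinAt_curveIntegral_segment_of_hasFDerivWithinAt_symmetric hd
      (fun z' hz' u _ v _ => hclosed _ (hmem z' hz') u v) (Metric.mem_ball_self hr) hw'.2
  have key' := key.hasFDerivAt (Metric.isOpen_ball.mem_nhds hw'.2)
  have h1 := (((hg.contDiffAt (hBo.mem_nhds hw)).differentiableAt (by simp)).hasFDerivAt.comp z
        (hasFDerivAt_prodMk_right x z))
  have heq : (fun z => ∫ t in (0 : ℝ)..1, f ((x, z), t)) =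
      fun z => curveIntegral (fun z => η (x, z)) (.segment c.2 z) := by
    funext z
    rw [curveIntegral_segment]
    refine intervalIntegral.integral_congr fun t _ => ?_
    simp [f, γ, AffineMap.lineMap_apply, add_comm]
  have h2 := h1.unique (f := fun z => ∫ t in (0 : ℝ)..1, f ((x, z), t)) (heq ▸ key')
  exact congrArg (fun l => l y) h2

end FibrewisePoincare

/-! ### Gluing local functions over a simply connected space -/

section Gluing

variable {Y : Type*} [TopologicalSpace Y]

/-- The covering space of germs of local primitives: the local functions `g i`, which differ by
locally constant functions on overlaps, are sections of a bundle with discrete fibre `D`. -/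
def primitiveBundleCore {D : Type*} [TopologicalSpace D] [DiscreteTopology D] [AddCommGroup D]
    (U : Y → Set Y) (hU : ∀ i, IsOpen (U i)) (hmem : ∀ i, i ∈ U i) (g : Y → Y → D)
    (hg : ∀ i j, ∀ y ∈ U i ∩ U j, ∀ᶠ z in 𝓝 y, g i z - g j z = g i y - g j y) :
    FiberBundleCore Y Y D where
  baseSet := U
  isOpen_baseSet := hU
  indexAt := id
  mem_baseSet_at := hmem
  coordChange i j y v := v + (g i y - g j y)
  coordChange_self i y _ v := by simp
  continuousOn_coordChange i j := by
    rintro ⟨y, v⟩ ⟨hy, -⟩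
    refine ContinuousAt.continuousWithinAt ?_
    have h : (fun p : Y × D => p.2 + (g i p.1 - g j p.1)) =ᶠ[𝓝 (y, v)]
        fun p => p.2 + (g i y - g j y) := by
      filter_upwards [continuous_fst.continuousAt.eventually (hg i j y hy)] with p hp
      rw [hp]
    refine ContinuousAt.congr ?_ h.symm
    exact (continuous_of_discreteTopology (f := fun a : D => a + (g i y - g j y))).continuousAt.comp
      continuous_snd.continuousAt
  coordChange_comp i j k y _ v := by abel

/-- Local functions on a simply connected space which differ by locally constant functions can be
made equal by subtracting locally constant functions. -/
theorem exists_glue_of_simplyConnected [SimplyConnectedSpace Y] [LocallyPathConnectedSpace Y]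
    {D : Type*} [AddCommGroup D] (U : Y → Set Y) (hU : ∀ i, IsOpen (U i)) (hmem : ∀ i, i ∈ U i)
    (g : Y → Y → D) (hg : ∀ i j, ∀ y ∈ U i ∩ U j, ∀ᶠ z in 𝓝 y, g i z - g j z = g i y - g j y) :
    ∃ f : Y → D, ∀ i, ∀ y ∈ U i, ∀ᶠ z in 𝓝 y, f z - g i z = f y - g i y := by
  let τ : TopologicalSpace D := ⊥
  have : DiscreteTopology D := ⟨rfl⟩
  let Z := primitiveBundleCore U hU hmem g hg
  have cov : IsCoveringMap (π D Z.Fiber) := FiberBundle.isCoveringMap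
  obtain ⟨y₀⟩ : Nonempty Y := inferInstance
  obtain ⟨s, ⟨-, hs⟩, -⟩ := cov.existsUnique_continuousMap_lifts (ContinuousMap.id Y) y₀
    (⟨y₀, (0 : D)⟩ : TotalSpace D Z.Fiber) rfl
  have hs' : ∀ y, (s y).1 = y := fun y => congrFun hs y
  let v : Y → D := fun y => (s y).2
  -- In the trivialisation over `U i`, the section `s` reads `f - g i`, so this is locally constant.
  refine ⟨fun y => v y + g y y, fun i y hy => ?_⟩
  have hval : ∀ z, v z + g z z - g i z = ((Z.localTriv i) (s z)).2 := by
    intro z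
    have h1 : ((Z.localTriv i) (s z)).2 = v z + (g (s z).1 (s z).1 - g i (s z).1) := rfl
    rw [h1, hs', add_sub_assoc]
  have hcont : ContinuousAt (fun z => ((Z.localTriv i) (s z)).2) y := by
    have hsrc : s y ∈ (Z.localTriv i).source := by
      rw [Z.mem_localTriv_source]; rw [hs']; exact hy
    exact continuous_snd.continuousAt.comp
      (((Z.localTriv i).continuousAt hsrc).comp s.continuous.continuousAt)
  have hev := hcont.eventually (IsOpen.mem_nhds (isOpen_discrete {((Z.localTriv i) (s y)).2}) rfl)
  filter_upwards [hev] with z hz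
  rw [hval z, hval y]
  exact hz

end Gluing

/-! ### Fibred charts of a submersion -/

/-- A fibred chart of the map `φ : P → M`: charts of `P` and of `M` in which `φ` is the first
projection `EM × G → EM`, where the image of the chart of `P` is a ball of `EM × G`, that is (for
the sup norm) a product of balls. The slices of the chart along the fibres of `φ` are thus balls
of `G`. -/
structure FibredChart (EM EP G : Type*) {M P : Type*}
    [NormedAddCommGroup EM] [NormedSpace ℝ EM] [TopologicalSpace M] [ChartedSpace EM M]
    [NormedAddCommGroup EP] [NormedSpace ℝ EP] [TopologicalSpace P] [ChartedSpace EP P]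
    [NormedAddCommGroup G] [NormedSpace ℝ G] (φ : P → M) where
  /-- The chart of the total space. -/
  chart : OpenPartialHomeomorph P (EM × G)
  /-- The chart of the base. -/
  base : OpenPartialHomeomorph M EM
  center : EM × G
  radius : ℝ
  target_eq : chart.target = Metric.ball center radius
  contMDiffOn_chart : ContMDiffOn 𝓘(ℝ, EP) 𝓘(ℝ, EM × G) ∞ chart chart.source
  contMDiffOn_symm : ContMDiffOn 𝓘(ℝ, EM × G) 𝓘(ℝ, EP) ∞ chart.symm chart.target
  contMDiffOn_base : ContMDiffOn 𝓘(ℝ, EM) 𝓘(ℝ, EM) ∞ base base.source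
  contMDiffOn_base_symm : ContMDiffOn 𝓘(ℝ, EM) 𝓘(ℝ, EM) ∞ base.symm base.target
  mapsTo : MapsTo φ chart.source base.source
  base_apply : ∀ q ∈ chart.source, base (φ q) = (chart q).1

section Submersion

universe u

variable {EM G M P : Type*} {EP : Type u}
  [NormedAddCommGroup EM] [NormedSpace ℝ EM] [FiniteDimensional ℝ EM]
  [TopologicalSpace M] [ChartedSpace EM M] [IsManifold 𝓘(ℝ, EM) ∞ M]
  [NormedAddCommGroup EP] [NormedSpace ℝ EP] [FiniteDimensional ℝ EP]
  [TopologicalSpace P] [ChartedSpace EP P] [IsManifold 𝓘(ℝ, EP) ∞ P]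
  [NormedAddCommGroup G] [NormedSpace ℝ G] [FiniteDimensional ℝ G]
  {φ : P → M}

/-- The normal form of a submersion at `p`, shrunk to the preimage of a small ball. -/
theorem exists_fibredChart_of_complement
    {p : P} (h : Manifold.IsSubmersionAtOfComplement G 𝓘(ℝ, EP) 𝓘(ℝ, EM) ∞ φ p)
    {N : Set P} (hN : N ∈ 𝓝 p) :
    ∃ c : FibredChart EM EP G φ, p ∈ c.chart.source ∧ c.chart.source ⊆ N := by
  let e₀ : OpenPartialHomeomorph P (EM × G) :=
    h.domChart.trans h.equiv.toHomeomorph.toOpenPartialHomeomorph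
  have hs₀ : e₀.source = h.domChart.source := by simp [e₀]
  have hp₀ : p ∈ e₀.source := by rw [hs₀]; exact h.mem_domChart_source
  have ht₀ : e₀.symm ⁻¹' interior N ∩ e₀.target ∈ 𝓝 (e₀ p) := by
    refine inter_mem ?_ (e₀.open_target.mem_nhds (e₀.map_source hp₀))
    refine (e₀.continuousAt_symm (e₀.map_source hp₀)).preimage_mem_nhds ?_
    rw [e₀.left_inv hp₀]
    exact interior_mem_nhds.2 hN
  obtain ⟨r, hr, hball⟩ := Metric.mem_nhds_iff.1 ht₀
  let e : OpenPartialHomeomorph P (EM × G) :=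
    (e₀.symm.restrOpen (Metric.ball (e₀ p) r) Metric.isOpen_ball).symm
  have het : e.target = Metric.ball (e₀ p) r := by
    change e₀.target ∩ Metric.ball (e₀ p) r = _
    exact inter_eq_right.2 fun x hx => (hball hx).2
  have hes : e.source ⊆ e₀.source ∩ N := by
    intro q hq
    have h1 : e₀.symm (e q) = q := e.left_inv hq
    have h2 : e q ∈ Metric.ball (e₀ p) r := het ▸ e.map_source hq
    have h3 := hball h2
    rw [← h1]
    exact ⟨e₀.map_target h3.2, interior_subset h3.1⟩
  have hpe : p ∈ e.source := by
    have h1 : e.symm (e₀ p) = p := e₀.left_inv hp₀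
    have h2 : e₀ p ∈ e.target := by rw [het]; exact Metric.mem_ball_self hr
    exact h1 ▸ e.map_target h2
  refine ⟨⟨e, h.codChart, e₀ p, r, het, ?_, ?_,
    contMDiffOn_of_mem_maximalAtlas h.codChart_mem_maximalAtlas,
    contMDiffOn_symm_of_mem_maximalAtlas h.codChart_mem_maximalAtlas, ?_, ?_⟩, ?_, ?_⟩
  · refine h.equiv.contDiff.contMDiff.comp_contMDiffOn
      ((contMDiffOn_of_mem_maximalAtlas h.domChart_mem_maximalAtlas).mono ?_)
    exact fun q hq => hs₀ ▸ (hes hq).1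
  · refine (contMDiffOn_symm_of_mem_maximalAtlas h.domChart_mem_maximalAtlas).comp
      h.equiv.symm.contDiff.contMDiff.contMDiffOn ?_
    intro w hw
    have h3 := (hball (het ▸ hw)).2
    simpa [e₀] using h3
  · exact fun q hq => h.mapsto_domChart_source_codChart_source (hs₀ ▸ (hes hq).1)
  · intro q hq
    have hq' : q ∈ h.domChart.source := hs₀ ▸ (hes hq).1
    have ht : h.domChart q ∈ (h.domChart.extend 𝓘(ℝ, EP)).target := by
      simpa using h.domChart.map_source hq'
    have h1 := h.writtenInCharts ht
    simp only [OpenPartialHomeomorph.extend_coe, OpenPartialHomeomorph.extend_coe_symm,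
      modelWithCornersSelf_coe, modelWithCornersSelf_coe_symm, Function.comp_apply, id_eq,
      h.domChart.left_inv hq'] at h1
    exact h1
  · exact hpe
  · exact fun q hq => (hes hq).2

/-- The slices of all fibred charts of a submersion can be taken in the same vector space. -/
theorem exists_fibredChart (hφ : Manifold.IsSubmersion 𝓘(ℝ, EP) 𝓘(ℝ, EM) ∞ φ) :
    ∃ (G : Type u) (_ : NormedAddCommGroup G) (_ : NormedSpace ℝ G) (_ : FiniteDimensional ℝ G),
      ∀ (p : P), ∀ N ∈ 𝓝 p,
        ∃ c : FibredChart EM EP G φ, p ∈ c.chart.source ∧ c.chart.source ⊆ N := by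
  obtain ⟨G, i1, i2, hG⟩ := hφ
  rcases isEmpty_or_nonempty P with hP | ⟨⟨p₀⟩⟩
  -- Over an empty `P` every `G` will do; the one provided by `hφ` may have infinite dimension.
  · exact ⟨EP, inferInstance, inferInstance, inferInstance, fun p => (hP.false p).elim⟩
  · have : FiniteDimensional ℝ (EM × G) := (hG p₀).equiv.toLinearEquiv.finiteDimensional
    have : FiniteDimensional ℝ G :=
      Module.Finite.of_surjective (LinearMap.snd ℝ EM G) LinearMap.snd_surjective
    exact ⟨G, i1, i2, this, fun p N hN => exists_fibredChart_of_complement (hG p) hN⟩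

namespace FibredChart

variable (c : FibredChart EM EP G φ) {p q : P}

theorem contMDiffAt_chart (hq : q ∈ c.chart.source) :
    ContMDiffAt 𝓘(ℝ, EP) 𝓘(ℝ, EM × G) ∞ c.chart q :=
  c.contMDiffOn_chart.contMDiffAt (c.chart.open_source.mem_nhds hq)

theorem mdifferentiable : c.chart.MDifferentiable 𝓘(ℝ, EP) 𝓘(ℝ, EM × G) :=
  ⟨c.contMDiffOn_chart.mdifferentiableOn (by simp), c.contMDiffOn_symm.mdifferentiableOn (by simp)⟩

theorem base_mdifferentiable : c.base.MDifferentiable 𝓘(ℝ, EM) 𝓘(ℝ, EM) :=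
  ⟨c.contMDiffOn_base.mdifferentiableOn (by simp),
    c.contMDiffOn_base_symm.mdifferentiableOn (by simp)⟩

theorem source_mem_nhds (hq : q ∈ c.chart.source) : c.chart.source ∈ 𝓝 q :=
  c.chart.open_source.mem_nhds hq

theorem target_eq_prod :
    c.chart.target = Metric.ball c.center.1 c.radius ×ˢ Metric.ball c.center.2 c.radius := by
  rw [c.target_eq]; exact (ball_prod_same _ _ _).symm

theorem eq_base_symm (hq : q ∈ c.chart.source) : φ q = c.base.symm (c.chart q).1 := by
  rw [← c.base_apply q hq, c.base.left_inv (c.mapsTo hq)]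

theorem fst_mem_target (hq : q ∈ c.chart.source) : (c.chart q).1 ∈ c.base.target := by
  rw [← c.base_apply q hq]
  exact c.base.map_source (c.mapsTo hq)

theorem apply_eq_iff (hp : p ∈ c.chart.source) (hq : q ∈ c.chart.source) :
    φ p = φ q ↔ (c.chart p).1 = (c.chart q).1 := by
  rw [← c.base_apply p hp, ← c.base_apply q hq, c.base.injOn.eq_iff (c.mapsTo hp) (c.mapsTo hq)]

theorem symm_apply {x : EM} {z : G} (h : (x, z) ∈ c.chart.target) :
    φ (c.chart.symm (x, z)) = c.base.symm x := by
  rw [c.eq_base_symm (c.chart.map_target h), c.chart.right_inv h]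

/-- The slice of a fibred chart along a fibre which it meets is the image of a ball. -/
theorem source_inter_fibre_eq (hq : q ∈ c.chart.source) :
    c.chart.source ∩ φ ⁻¹' {φ q} =
      (fun z => c.chart.symm ((c.chart q).1, z)) '' Metric.ball c.center.2 c.radius := by
  have ht := c.target_eq_prod
  have hqt : c.chart q ∈ Metric.ball c.center.1 c.radius ×ˢ Metric.ball c.center.2 c.radius :=
    ht ▸ c.chart.map_source hq
  ext q'
  constructor
  · rintro ⟨h1, h2⟩
    have h3 := (c.apply_eq_iff h1 hq).1 h2
    refine ⟨(c.chart q').2, (ht ▸ c.chart.map_source h1).2, ?_⟩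
    simp only [← h3]
    exact c.chart.left_inv h1
  · rintro ⟨z, hz, rfl⟩
    have h1 : ((c.chart q).1, z) ∈ c.chart.target := by rw [ht]; exact ⟨hqt.1, hz⟩
    exact ⟨c.chart.map_target h1, by
      rw [mem_preimage, mem_singleton_iff, c.symm_apply h1, ← c.eq_base_symm hq]⟩

theorem isPathConnected_source_inter_fibre (hq : q ∈ c.chart.source) :
    IsPathConnected (c.chart.source ∩ φ ⁻¹' {φ q}) := by
  have hqt : c.chart q ∈ Metric.ball c.center.1 c.radius ×ˢ Metric.ball c.center.2 c.radius :=
    c.target_eq_prod ▸ c.chart.map_source hq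
  rw [c.source_inter_fibre_eq hq]
  refine IsPathConnected.image' ((convex_ball _ _).isPathConnected ⟨_, hqt.2⟩) ?_
  refine c.chart.continuousOn_symm.comp (by fun_prop) fun z hz => ?_
  rw [c.target_eq_prod]
  exact ⟨hqt.1, hz⟩

/-- A submersion has smooth local sections through every point, with values in a given fibred
chart. -/
theorem exists_localSection (hp : p ∈ c.chart.source) :
    ∃ (σ : M → P) (U : Set M), IsOpen U ∧ φ p ∈ U ∧ ContMDiffOn 𝓘(ℝ, EM) 𝓘(ℝ, EP) ∞ σ U ∧
      σ (φ p) = p ∧ MapsTo σ U c.chart.source ∧ ∀ m ∈ U, φ (σ m) = m := by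
  have hb : c.base (φ p) = (c.chart p).1 := c.base_apply p hp
  let i : M → EM × G := fun m => (c.base m, (c.chart p).2)
  have hi : ContMDiffOn 𝓘(ℝ, EM) 𝓘(ℝ, EM × G) ∞ i c.base.source :=
    (contDiff_prodMk_left (c.chart p).2).contMDiff.comp_contMDiffOn c.contMDiffOn_base
  have hval : i (φ p) = c.chart p := by simp only [i]; rw [hb]
  refine ⟨fun m => c.chart.symm (i m), c.base.source ∩ i ⁻¹' c.chart.target,
    hi.continuousOn.isOpen_inter_preimage c.base.open_source c.chart.open_target,
    ⟨c.mapsTo hp, ?_⟩, ?_, ?_, ?_, ?_⟩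
  · rw [mem_preimage, hval]
    exact c.chart.map_source hp
  · exact c.contMDiffOn_symm.comp (hi.mono inter_subset_left) inter_subset_right
  · simp only [hval]
    exact c.chart.left_inv hp
  · exact fun m hm => c.chart.map_target hm.2
  · rintro m ⟨h1, h2⟩
    rw [c.symm_apply h2, c.base.left_inv h1]

end FibredChart

end Submersion

/-! ### Vector fields in fibred charts -/

theorem mlieBracket_eq_zero_of_const {E : Type*} [NormedAddCommGroup E] [NormedSpace ℝ E]
    {V W : ∀ x : E, TangentSpace 𝓘(ℝ, E) x} {v w : E} (hV : ∀ x, V x = v) (hW : ∀ x, W x = w) :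
    mlieBracket 𝓘(ℝ, E) V W = 0 := by
  rw [← mlieBracketWithin_univ, mlieBracketWithin_eq_lieBracketWithin]
  obtain rfl : V = fun _ => v := funext hV
  obtain rfl : W = fun _ => w := funext hW
  funext x
  have : lieBracketWithin ℝ (fun _ : E => v) (fun _ => w) univ x = 0 := by
    simp [lieBracketWithin]
  exact this

section Submersion

universe u

variable {EM G M P : Type*} {EP : Type u}
  [NormedAddCommGroup EM] [NormedSpace ℝ EM] [FiniteDimensional ℝ EM]
  [TopologicalSpace M] [ChartedSpace EM M] [IsManifold 𝓘(ℝ, EM) ∞ M]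
  [NormedAddCommGroup EP] [NormedSpace ℝ EP] [FiniteDimensional ℝ EP]
  [TopologicalSpace P] [ChartedSpace EP P] [IsManifold 𝓘(ℝ, EP) ∞ P]
  [NormedAddCommGroup G] [NormedSpace ℝ G] [FiniteDimensional ℝ G]
  {φ : P → M}

namespace FibredChart

variable (c : FibredChart EM EP G φ) {p q : P}

/-- The vector field on the domain of a fibred chart with the given coordinate expression. -/
def field (W : EM × G → EM × G) (q : P) : TangentSpace 𝓘(ℝ, EP) q :=
  mpullback 𝓘(ℝ, EP) 𝓘(ℝ, EM × G) c.chart (fun w => (W w : TangentSpace 𝓘(ℝ, EM × G) w)) q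

theorem isInvertible_mfderiv (hq : q ∈ c.chart.source) :
    (mfderiv 𝓘(ℝ, EP) 𝓘(ℝ, EM × G) c.chart q).IsInvertible :=
  ⟨c.mdifferentiable.mfderiv hq, rfl⟩

/-- The derivative of the chart, with values in the model space. -/
def dchart (q : P) : TangentSpace 𝓘(ℝ, EP) q →L[ℝ] EM × G := mvfderiv 𝓘(ℝ, EP) c.chart q

theorem dchart_injective (hq : q ∈ c.chart.source) : Function.Injective (c.dchart q) :=
  c.mdifferentiable.mfderiv_injective hq

theorem dchart_field (W : EM × G → EM × G) (hq : q ∈ c.chart.source) :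
    c.dchart q (c.field W q) = W (c.chart q) :=
  (c.isInvertible_mfderiv hq).self_apply_inverse _

theorem contMDiffAt_field {W : EM × G → EM × G} (hq : q ∈ c.chart.source)
    (hW : ContDiffAt ℝ ∞ W (c.chart q)) :
    ContMDiffAt 𝓘(ℝ, EP) 𝓘(ℝ, EP).tangent ∞
      (fun q => (⟨q, c.field W q⟩ : TangentBundle 𝓘(ℝ, EP) P)) q := by
  have : IsManifold 𝓘(ℝ, EP) (∞ + 1) P := by simpa using ‹IsManifold 𝓘(ℝ, EP) ∞ P›
  exact ContMDiffAt.mpullback_vectorField_preimage (n := ∞)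
    (contMDiffAt_vectorSpace_iff_contDiffAt.2 hW) (c.contMDiffAt_chart hq)
    (c.isInvertible_mfderiv hq) (by simp)

theorem mvfderiv_eq {h : P → ℝ} (hq : q ∈ c.chart.source)
    (hh : MDifferentiableAt 𝓘(ℝ, EP) 𝓘(ℝ, ℝ) h q) (v : TangentSpace 𝓘(ℝ, EP) q) :
    mvfderiv 𝓘(ℝ, EP) h q v = fderiv ℝ (h ∘ c.chart.symm) (c.chart q) (c.dchart q v) := by
  have h1 : h =ᶠ[𝓝 q] (h ∘ c.chart.symm) ∘ c.chart := by
    filter_upwards [c.source_mem_nhds hq] with q' hq'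
    simp [c.chart.left_inv hq']
  have h2 : MDifferentiableAt 𝓘(ℝ, EM × G) 𝓘(ℝ, ℝ) (h ∘ c.chart.symm) (c.chart q) := by
    refine MDifferentiableAt.comp (I' := 𝓘(ℝ, EP)) _ ?_
      (c.mdifferentiable.mdifferentiableAt_symm (c.chart.map_source hq))
    rwa [c.chart.left_inv hq]
  rw [LieAlgebroid.mvfderiv_congr h1, mvfderiv_comp_apply (I := 𝓘(ℝ, EM × G)) q h2
    (c.mdifferentiable.mdifferentiableAt hq)]
  unfold mvfderiv
  rw [mfderiv_eq_fderiv]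
  rfl

theorem dbase_mfderiv (hφ : ContMDiff 𝓘(ℝ, EP) 𝓘(ℝ, EM) ∞ φ) (hq : q ∈ c.chart.source)
    (v : TangentSpace 𝓘(ℝ, EP) q) :
    mvfderiv 𝓘(ℝ, EM) c.base (φ q) (mfderiv 𝓘(ℝ, EP) 𝓘(ℝ, EM) φ q v) = (c.dchart q v).1 := by
  have h1 : c.base ∘ φ =ᶠ[𝓝 q] (ContinuousLinearMap.fst ℝ EM G) ∘ c.chart := by
    filter_upwards [c.source_mem_nhds hq] with q' hq'
    exact c.base_apply q' hq'
  have h2 := mfderiv_comp_apply (I' := 𝓘(ℝ, EM)) (I'' := 𝓘(ℝ, EM)) q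
    (c.base_mdifferentiable.mdifferentiableAt (c.mapsTo hq)) (hφ.mdifferentiable (by simp) q) v
  have h3 := mfderiv_comp_apply (I' := 𝓘(ℝ, EM × G)) q
    ((ContinuousLinearMap.fst ℝ EM G).mdifferentiableAt)
    (c.mdifferentiable.mdifferentiableAt hq) v
  have h4 : mfderiv 𝓘(ℝ, EP) 𝓘(ℝ, EM) (c.base ∘ φ) q v =
      mfderiv 𝓘(ℝ, EP) 𝓘(ℝ, EM) ((ContinuousLinearMap.fst ℝ EM G) ∘ c.chart) q v :=
    congrArg (fun l : EP →L[ℝ] EM => l v) h1.mfderiv_eq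
  refine (h2.symm.trans (h4.trans h3)).trans ?_
  rw [ContinuousLinearMap.mfderiv_eq]
  rfl

theorem dbase_injective {m : M} (hm : m ∈ c.base.source) :
    Function.Injective (mvfderiv 𝓘(ℝ, EM) c.base m) :=
  c.base_mdifferentiable.mfderiv_injective hm

/-- In a fibred chart, the vectors tangent to the fibres are those with vanishing first
component. -/
theorem mfderiv_eq_zero_iff (hφ : ContMDiff 𝓘(ℝ, EP) 𝓘(ℝ, EM) ∞ φ) (hq : q ∈ c.chart.source)
    (v : TangentSpace 𝓘(ℝ, EP) q) :
    mfderiv 𝓘(ℝ, EP) 𝓘(ℝ, EM) φ q v = 0 ↔ (c.dchart q v).1 = 0 := by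
  rw [← c.dbase_mfderiv hφ hq, ← map_eq_zero_iff _ (c.dbase_injective (c.mapsTo hq))]

theorem mfderiv_field_vertical (hφ : ContMDiff 𝓘(ℝ, EP) 𝓘(ℝ, EM) ∞ φ) (hq : q ∈ c.chart.source)
    (y : G) : mfderiv 𝓘(ℝ, EP) 𝓘(ℝ, EM) φ q (c.field (fun _ => (0, y)) q) = 0 := by
  rw [c.mfderiv_eq_zero_iff hφ hq, c.dchart_field _ hq]

theorem eq_field_of_vertical (hφ : ContMDiff 𝓘(ℝ, EP) 𝓘(ℝ, EM) ∞ φ) (hq : q ∈ c.chart.source)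
    {v : TangentSpace 𝓘(ℝ, EP) q} (hv : mfderiv 𝓘(ℝ, EP) 𝓘(ℝ, EM) φ q v = 0) :
    v = c.field (fun _ => (0, (c.dchart q v).2)) q := by
  apply c.dchart_injective hq
  rw [c.dchart_field _ hq]
  exact Prod.ext ((c.mfderiv_eq_zero_iff hφ hq v).1 hv) rfl

theorem mlieBracket_field_const (hq : q ∈ c.chart.source) (w w' : EM × G) :
    mlieBracket 𝓘(ℝ, EP) (c.field fun _ => w) (c.field fun _ => w') q = 0 := by
  have : IsManifold 𝓘(ℝ, EP) (minSmoothness ℝ 3) P :=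
    .of_le (n := ∞) (by simp; exact WithTop.coe_le_coe.2 le_top)
  have : IsManifold 𝓘(ℝ, EM × G) (minSmoothness ℝ 3) (EM × G) :=
    .of_le (n := ∞) (by simp; exact WithTop.coe_le_coe.2 le_top)
  have hc : ∀ w : EM × G, MDifferentiableAt 𝓘(ℝ, EM × G) 𝓘(ℝ, EM × G).tangent
      (fun x => (⟨x, w⟩ : TangentBundle 𝓘(ℝ, EM × G) (EM × G))) (c.chart q) := fun w =>
    (contMDiffAt_vectorSpace_iff_contDiffAt (n := 1).2 contDiffAt_const).mdifferentiableAt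
      (by simp)
  have h := mpullback_mlieBracket (hc w) (hc w') (c.contMDiffAt_chart hq) (x₀ := q)
    (by simp; exact WithTop.coe_le_coe.2 le_top)
  refine h.symm.trans ?_
  have h0 := mlieBracket_eq_zero_of_const (E := EM × G) (V := fun _ => w) (W := fun _ => w')
    (fun _ => rfl) (fun _ => rfl)
  rw [h0, mpullback_zero, Pi.zero_apply]

/-- Coordinate expression of a horizontal lift of a vector field `X` on the base. -/
def liftCoord (X : ∀ m : M, TangentSpace 𝓘(ℝ, EM) m) (w : EM × G) : EM × G :=
  (mpullback 𝓘(ℝ, EM) 𝓘(ℝ, EM) c.base.symm X w.1, 0)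

theorem dbase_eq_mpullback (X : ∀ m : M, TangentSpace 𝓘(ℝ, EM) m) {x : EM}
    (hx : x ∈ c.base.target) :
    mvfderiv 𝓘(ℝ, EM) c.base (c.base.symm x) (X (c.base.symm x)) =
      mpullback 𝓘(ℝ, EM) 𝓘(ℝ, EM) c.base.symm X x := by
  have hi : (mfderiv 𝓘(ℝ, EM) 𝓘(ℝ, EM) c.base.symm x).IsInvertible :=
    ⟨c.base_mdifferentiable.symm.mfderiv hx, rfl⟩
  have h1 := hi.self_apply_inverse (X (c.base.symm x))
  have h2 := c.base_mdifferentiable.comp_symm_deriv hx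
  have h3 := congrArg (fun l => l (mpullback 𝓘(ℝ, EM) 𝓘(ℝ, EM) c.base.symm X x)) h2
  refine Eq.trans ?_ h3
  exact congrArg (mfderiv 𝓘(ℝ, EM) 𝓘(ℝ, EM) c.base (c.base.symm x)) h1.symm

theorem mfderiv_field_lift (hφ : ContMDiff 𝓘(ℝ, EP) 𝓘(ℝ, EM) ∞ φ)
    (X : ∀ m : M, TangentSpace 𝓘(ℝ, EM) m) (hq : q ∈ c.chart.source) :
    mfderiv 𝓘(ℝ, EP) 𝓘(ℝ, EM) φ q (c.field (c.liftCoord X) q) = X (φ q) := by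
  apply c.dbase_injective (c.mapsTo hq)
  rw [c.dbase_mfderiv hφ hq, c.dchart_field _ hq]
  refine (c.dbase_eq_mpullback X (c.fst_mem_target hq)).symm.trans ?_
  exact congrArg (fun m => mvfderiv 𝓘(ℝ, EM) c.base m (X m)) (c.eq_base_symm hq).symm

theorem contDiffAt_liftCoord {X : ∀ m : M, TangentSpace 𝓘(ℝ, EM) m}
    (hX : ContMDiff 𝓘(ℝ, EM) 𝓘(ℝ, EM).tangent ∞
      (fun m => (⟨m, X m⟩ : TangentBundle 𝓘(ℝ, EM) M)))
    (hq : q ∈ c.chart.source) : ContDiffAt ℝ ∞ (c.liftCoord X) (c.chart q) := by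
  have : IsManifold 𝓘(ℝ, EM) (∞ + 1) M := by simpa using ‹IsManifold 𝓘(ℝ, EM) ∞ M›
  have hx := c.fst_mem_target hq
  have hi : (mfderiv 𝓘(ℝ, EM) 𝓘(ℝ, EM) c.base.symm (c.chart q).1).IsInvertible :=
    ⟨c.base_mdifferentiable.symm.mfderiv hx, rfl⟩
  have h1 := ContMDiffAt.mpullback_vectorField_preimage (n := ∞) (m := ∞) (hX _)
    (c.contMDiffOn_base_symm.contMDiffAt (c.base.open_target.mem_nhds hx)) hi (by simp)
  have h2 := contMDiffAt_vectorSpace_iff_contDiffAt.1 h1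
  exact ContDiffAt.prodMk (ContDiffAt.comp (c.chart q) h2 contDiffAt_fst) contDiffAt_const

/-- Every smooth vector field on a fibred chart agrees near a given point with a smooth vector
field on the whole manifold, of the form `χ • V`. -/
theorem exists_bump_field [T2Space P] (hp : p ∈ c.chart.source) {W : EM × G → EM × G}
    (hW : ∀ q ∈ c.chart.source, ContDiffAt ℝ ∞ W (c.chart q)) :
    ∃ χ : P → ℝ, ContMDiff 𝓘(ℝ, EP) 𝓘(ℝ, ℝ) ∞ χ ∧ χ =ᶠ[𝓝 p] 1 ∧ tsupport χ ⊆ c.chart.source ∧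
      ContMDiff 𝓘(ℝ, EP) 𝓘(ℝ, EP).tangent ∞
        (fun q => (⟨q, χ q • c.field W q⟩ : TangentBundle 𝓘(ℝ, EP) P)) := by
  obtain ⟨χ, h1, h2, h3⟩ := exists_bump (E := EP) p _ (c.source_mem_nhds hp)
  exact ⟨χ, h1, h2, h3, ContMDiffOn.smul_section_of_tsupport h1.contMDiffOn c.chart.open_source h3
    fun q hq => (c.contMDiffAt_field hq (hW q hq)).contMDiffWithinAt⟩

/-- A function with vanishing derivatives along the fibres is constant on the slices of a fibred
chart. -/
theorem eq_of_vertical_mvfderiv_eq_zero (hφ : ContMDiff 𝓘(ℝ, EP) 𝓘(ℝ, EM) ∞ φ) {h : P → ℝ}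
    (hh : ∀ q ∈ c.chart.source, MDifferentiableAt 𝓘(ℝ, EP) 𝓘(ℝ, ℝ) h q)
    (h0 : ∀ q ∈ c.chart.source, ∀ v : TangentSpace 𝓘(ℝ, EP) q,
      mfderiv 𝓘(ℝ, EP) 𝓘(ℝ, EM) φ q v = 0 → mvfderiv 𝓘(ℝ, EP) h q v = 0)
    (hp : p ∈ c.chart.source) (hq : q ∈ c.chart.source) (hpq : φ p = φ q) : h p = h q := by
  set x := (c.chart p).1 with hx
  have ht := c.target_eq_prod
  have hpt : c.chart p ∈ Metric.ball c.center.1 c.radius ×ˢ Metric.ball c.center.2 c.radius :=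
    ht ▸ c.chart.map_source hp
  have hqt : c.chart q ∈ Metric.ball c.center.1 c.radius ×ˢ Metric.ball c.center.2 c.radius :=
    ht ▸ c.chart.map_source hq
  have hd : ∀ z ∈ Metric.ball c.center.2 c.radius,
      HasFDerivAt (fun z => (h ∘ c.chart.symm) (x, z)) (0 : G →L[ℝ] ℝ) z := by
    intro z hz
    have hzt : (x, z) ∈ c.chart.target := by rw [ht]; exact ⟨hpt.1, hz⟩
    have hs := c.chart.map_target hzt
    have h1 : MDifferentiableAt 𝓘(ℝ, EM × G) 𝓘(ℝ, ℝ) (h ∘ c.chart.symm) (x, z) :=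
      MDifferentiableAt.comp (I' := 𝓘(ℝ, EP)) _ (hh _ hs)
        (c.mdifferentiable.mdifferentiableAt_symm hzt)
    have h2 := h1.differentiableAt.hasFDerivAt.comp z (hasFDerivAt_prodMk_right x z)
    convert! h2 using 1
    ext y
    have h3 := h0 _ hs _ (c.mfderiv_field_vertical hφ hs y)
    rw [c.mvfderiv_eq hs (hh _ hs), c.dchart_field _ hs, c.chart.right_inv hzt] at h3
    exact h3.symm
  have key := Metric.isOpen_ball.is_const_of_fderiv_eq_zero (𝕜 := ℝ)
    (convex_ball c.center.2 c.radius).isPreconnected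
    (fun z hz => (hd z hz).differentiableAt.differentiableWithinAt)
    (fun z hz => (hd z hz).fderiv) hpt.2 hqt.2
  have hxq : (x, (c.chart q).2) = c.chart q :=
    Prod.ext ((c.apply_eq_iff hp hq).1 hpq) rfl
  have hxp : (x, (c.chart p).2) = c.chart p := rfl
  simp only [Function.comp_apply] at key
  rw [hxq, hxp, c.chart.left_inv hp, c.chart.left_inv hq] at key
  exact key

end FibredChart

end Submersion

section Submersion

universe u

variable {EM G M P : Type*} {EP : Type u}
  [NormedAddCommGroup EM] [NormedSpace ℝ EM] [FiniteDimensional ℝ EM]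
  [TopologicalSpace M] [ChartedSpace EM M] [IsManifold 𝓘(ℝ, EM) ∞ M]
  [NormedAddCommGroup EP] [NormedSpace ℝ EP] [FiniteDimensional ℝ EP]
  [TopologicalSpace P] [ChartedSpace EP P] [IsManifold 𝓘(ℝ, EP) ∞ P]
  [NormedAddCommGroup G] [NormedSpace ℝ G] [FiniteDimensional ℝ G]
  {φ : P → M}

/-! ### Functions on the total space of a submersion -/

variable (EM EP G φ) in
/-- The map `φ` has arbitrarily small fibred charts, with slices in `G`, around every point. -/
def HasFibredCharts : Prop :=
  ∀ (p : P), ∀ N ∈ 𝓝 p, ∃ c : FibredChart EM EP G φ, p ∈ c.chart.source ∧ c.chart.source ⊆ N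

theorem HasFibredCharts.exists_chart (hc : HasFibredCharts EM G EP φ) (p : P) :
    ∃ c : FibredChart EM EP G φ, p ∈ c.chart.source :=
  (hc p univ univ_mem).imp fun _ h => h.1

theorem mfderiv_surjective_of_hasFibredCharts (hc : HasFibredCharts EM G EP φ)
    (hφ : ContMDiff 𝓘(ℝ, EP) 𝓘(ℝ, EM) ∞ φ) (p : P) :
    Function.Surjective (mfderiv 𝓘(ℝ, EP) 𝓘(ℝ, EM) φ p) := by
  obtain ⟨c, hp⟩ := hc.exists_chart p
  intro w
  refine ⟨c.field (fun _ => (mvfderiv 𝓘(ℝ, EM) c.base (φ p) w, 0)) p, ?_⟩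
  apply c.dbase_injective (c.mapsTo hp)
  rw [c.dbase_mfderiv hφ hp, c.dchart_field _ hp]

/-- An equivalence relation which holds locally along the fibres holds on connected fibres. -/
theorem eq_on_fibres_of_local {R : P → P → Prop} (hR : Equivalence R)
    (hconn : ∀ m, IsPreconnected (φ ⁻¹' {m}))
    (hloc : ∀ p, ∀ᶠ q in 𝓝 p, φ p = φ q → R p q) {p q : P} (hpq : φ p = φ q) : R p q := by
  refine (hconn (φ q)).induction₂ R (fun x hx => ?_) (fun x y z _ _ _ => hR.trans)
    (fun x y _ _ => hR.symm) hpq rfl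
  filter_upwards [nhdsWithin_le_nhds (hloc x), self_mem_nhdsWithin] with y hy hy'
  exact hy (Eq.trans hx (Eq.symm hy'))

/-- A smooth function whose derivatives along the fibres vanish is constant on connected fibres. -/
theorem eq_on_fibres_of_vertical_mvfderiv_eq_zero (hc : HasFibredCharts EM G EP φ)
    (hφ : ContMDiff 𝓘(ℝ, EP) 𝓘(ℝ, EM) ∞ φ) (hconn : ∀ m, IsPreconnected (φ ⁻¹' {m})) {h : P → ℝ}
    (hh : ContMDiff 𝓘(ℝ, EP) 𝓘(ℝ, ℝ) ∞ h)
    (h0 : ∀ (q : P) (v : TangentSpace 𝓘(ℝ, EP) q),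
      mfderiv 𝓘(ℝ, EP) 𝓘(ℝ, EM) φ q v = 0 → mvfderiv 𝓘(ℝ, EP) h q v = 0)
    {p q : P} (hpq : φ p = φ q) : h p = h q := by
  refine eq_on_fibres_of_local (R := fun p q => h p = h q)
    ⟨fun _ => rfl, Eq.symm, Eq.trans⟩ hconn (fun p => ?_) hpq
  obtain ⟨c, hp⟩ := hc.exists_chart p
  filter_upwards [c.source_mem_nhds hp] with q hq hpq
  exact c.eq_of_vertical_mvfderiv_eq_zero hφ (fun q _ => hh.mdifferentiable (by simp) q)
    (fun q _ => h0 q) hp hq hpq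

/-- A smooth function which is constant on the fibres of a surjective submersion descends to a
smooth function on the base. -/
theorem exists_contMDiff_comp_eq (hc : HasFibredCharts EM G EP φ) (hsurj : Function.Surjective φ)
    {h : P → ℝ} (hh : ContMDiff 𝓘(ℝ, EP) 𝓘(ℝ, ℝ) ∞ h) (hconst : ∀ p q, φ p = φ q → h p = h q) :
    ∃ g : M → ℝ, ContMDiff 𝓘(ℝ, EM) 𝓘(ℝ, ℝ) ∞ g ∧ ∀ p, g (φ p) = h p := by
  refine ⟨fun m => h (Function.surjInv hsurj m), fun m => ?_, fun p =>
    hconst _ _ (Function.surjInv_eq hsurj _)⟩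
  obtain ⟨p, rfl⟩ := hsurj m
  obtain ⟨c, hp⟩ := hc.exists_chart p
  obtain ⟨σ, U, hU, hpU, hσ, -, -, hσφ⟩ := c.exists_localSection hp
  have h1 : ContMDiffAt 𝓘(ℝ, EM) 𝓘(ℝ, ℝ) ∞ (h ∘ σ) (φ p) :=
    hh.contMDiffAt.comp _ (hσ.contMDiffAt (hU.mem_nhds hpU))
  refine h1.congr_of_eventuallyEq ?_
  filter_upwards [hU.mem_nhds hpU] with m hm
  exact hconst _ _ ((Function.surjInv_eq hsurj _).trans (hσφ m hm).symm)

/-- Near a point `q` of a fibred chart, a function which is constant on its slices factors through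
any local section through another point `p` of the slice of `q`. -/
theorem FibredChart.eventually_eq_comp_section (c : FibredChart EM EP G φ)
    (hφ : ContMDiff 𝓘(ℝ, EP) 𝓘(ℝ, EM) ∞ φ) {k : P → ℝ}
    (hk : ∀ q ∈ c.chart.source, ∀ q' ∈ c.chart.source, φ q = φ q' → k q = k q') {p q : P}
    (hp : p ∈ c.chart.source) (hq : q ∈ c.chart.source) (hpq : φ p = φ q) :
    ∃ σ : M → P, ContMDiffAt 𝓘(ℝ, EM) 𝓘(ℝ, EP) ∞ σ (φ q) ∧ σ (φ q) = p ∧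
      k =ᶠ[𝓝 q] (k ∘ σ) ∘ φ := by
  obtain ⟨σ, U, hU, hpU, hσ, hσp, hσm, hσφ⟩ := c.exists_localSection hp
  rw [hpq] at hpU hσp
  refine ⟨σ, hσ.contMDiffAt (hU.mem_nhds hpU), hσp, ?_⟩
  filter_upwards [c.source_mem_nhds hq,
    hφ.continuous.continuousAt.preimage_mem_nhds (hU.mem_nhds hpU)] with q' h1 h2
  exact hk q' h1 _ (hσm h2) (hσφ _ h2).symm

/-- A function which is constant on the slices of a fibred chart is smooth at every point of a slice
if it is at one of them. -/
theorem FibredChart.contMDiffAt_of_slice (c : FibredChart EM EP G φ)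
    (hφ : ContMDiff 𝓘(ℝ, EP) 𝓘(ℝ, EM) ∞ φ) {k : P → ℝ}
    (hk : ∀ q ∈ c.chart.source, ∀ q' ∈ c.chart.source, φ q = φ q' → k q = k q') {p q : P}
    (hp : p ∈ c.chart.source) (hq : q ∈ c.chart.source) (hpq : φ p = φ q)
    (h : ContMDiffAt 𝓘(ℝ, EP) 𝓘(ℝ, ℝ) ∞ k p) : ContMDiffAt 𝓘(ℝ, EP) 𝓘(ℝ, ℝ) ∞ k q := by
  obtain ⟨σ, hσ, rfl, hkσ⟩ := c.eventually_eq_comp_section hφ hk hp hq hpq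
  exact ((h.comp (φ q) hσ).comp q hφ.contMDiffAt).congr_of_eventuallyEq hkσ

theorem FibredChart.mvfderiv_eq_zero_of_slice (c : FibredChart EM EP G φ)
    (hφ : ContMDiff 𝓘(ℝ, EP) 𝓘(ℝ, EM) ∞ φ) {k : P → ℝ}
    (hk : ∀ q ∈ c.chart.source, ∀ q' ∈ c.chart.source, φ q = φ q' → k q = k q') {q : P}
    (hq : q ∈ c.chart.source) (h : MDifferentiableAt 𝓘(ℝ, EP) 𝓘(ℝ, ℝ) k q)
    {v : TangentSpace 𝓘(ℝ, EP) q} (hv : mfderiv 𝓘(ℝ, EP) 𝓘(ℝ, EM) φ q v = 0) :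
    mvfderiv 𝓘(ℝ, EP) k q v = 0 := by
  obtain ⟨σ, hσ, hσq, hkσ⟩ := c.eventually_eq_comp_section hφ hk hq hq rfl
  have h1 : MDifferentiableAt 𝓘(ℝ, EM) 𝓘(ℝ, ℝ) (k ∘ σ) (φ q) :=
    MDifferentiableAt.comp (I' := 𝓘(ℝ, EP)) (φ q) (hσq.symm ▸ h)
      (hσ.mdifferentiableAt (by simp))
  rw [LieAlgebroid.mvfderiv_congr hkσ, mvfderiv_comp_apply (I := 𝓘(ℝ, EM)) q h1
    (hφ.mdifferentiable (by simp) q), hv, map_zero]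

/-! ### Closed forms along the fibres -/

/-- The forms `θ`, restricted to the tangent spaces of the fibres of `φ`, form a smooth family of
closed 1-forms on the fibres. (The values of `θ` on other tangent vectors are irrelevant.) -/
structure IsClosedAlongFibres (φ : P → M) (θ : ∀ p : P, TangentSpace 𝓘(ℝ, EP) p →ₗ[ℝ] ℝ) :
    Prop where
  smooth : ∀ V : ∀ p : P, TangentSpace 𝓘(ℝ, EP) p,
    ContMDiff 𝓘(ℝ, EP) 𝓘(ℝ, EP).tangent ∞ (fun p => (⟨p, V p⟩ : TangentBundle 𝓘(ℝ, EP) P)) →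
    (∀ p, mfderiv 𝓘(ℝ, EP) 𝓘(ℝ, EM) φ p (V p) = 0) →
    ContMDiff 𝓘(ℝ, EP) 𝓘(ℝ, ℝ) ∞ (fun p => θ p (V p))
  closed : ∀ V V' : ∀ p : P, TangentSpace 𝓘(ℝ, EP) p,
    ContMDiff 𝓘(ℝ, EP) 𝓘(ℝ, EP).tangent ∞ (fun p => (⟨p, V p⟩ : TangentBundle 𝓘(ℝ, EP) P)) →
    (∀ p, mfderiv 𝓘(ℝ, EP) 𝓘(ℝ, EM) φ p (V p) = 0) →
    ContMDiff 𝓘(ℝ, EP) 𝓘(ℝ, EP).tangent ∞ (fun p => (⟨p, V' p⟩ : TangentBundle 𝓘(ℝ, EP) P)) →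
    (∀ p, mfderiv 𝓘(ℝ, EP) 𝓘(ℝ, EM) φ p (V' p) = 0) → ∀ p,
    mvfderiv 𝓘(ℝ, EP) (fun q => θ q (V' q)) p (V p) -
      mvfderiv 𝓘(ℝ, EP) (fun q => θ q (V q)) p (V' p) = θ p (mlieBracket 𝓘(ℝ, EP) V V' p)

/-- The vector field `∂/∂y` in a fibred chart extends to a vertical vector field. -/
theorem FibredChart.exists_vertical_field [T2Space P] (c : FibredChart EM EP G φ)
    (hφ : ContMDiff 𝓘(ℝ, EP) 𝓘(ℝ, EM) ∞ φ) {p : P} (hp : p ∈ c.chart.source) (y : G) :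
    ∃ V : ∀ p : P, TangentSpace 𝓘(ℝ, EP) p,
      ContMDiff 𝓘(ℝ, EP) 𝓘(ℝ, EP).tangent ∞ (fun p => (⟨p, V p⟩ : TangentBundle 𝓘(ℝ, EP) P)) ∧
      (∀ p, mfderiv 𝓘(ℝ, EP) 𝓘(ℝ, EM) φ p (V p) = 0) ∧
      ∀ᶠ q in 𝓝 p, V q = c.field (fun _ => (0, y)) q := by
  obtain ⟨χ, -, h2, h3, h4⟩ := c.exists_bump_field hp (W := fun _ => (0, y))
    fun _ _ => contDiffAt_const
  refine ⟨_, h4, fun q => ?_, ?_⟩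
  · by_cases hq : q ∈ c.chart.source
    · rw [map_smul, c.mfderiv_field_vertical hφ hq, smul_zero]
    · rw [image_eq_zero_of_notMem_tsupport fun h => hq (h3 h), zero_smul, map_zero]
  · filter_upwards [h2] with q hq
    rw [hq, Pi.one_apply, one_smul]

/-- A family of closed forms along the fibres has smooth primitives in fibred charts. -/
theorem FibredChart.exists_primitive [T2Space P] (c : FibredChart EM EP G φ)
    (hφ : ContMDiff 𝓘(ℝ, EP) 𝓘(ℝ, EM) ∞ φ) {θ : ∀ p : P, TangentSpace 𝓘(ℝ, EP) p →ₗ[ℝ] ℝ}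
    (hθ : IsClosedAlongFibres (EM := EM) φ θ) :
    ∃ g : P → ℝ, ContMDiffOn 𝓘(ℝ, EP) 𝓘(ℝ, ℝ) ∞ g c.chart.source ∧
      ∀ q ∈ c.chart.source, ∀ v : TangentSpace 𝓘(ℝ, EP) q,
        mfderiv 𝓘(ℝ, EP) 𝓘(ℝ, EM) φ q v = 0 → mvfderiv 𝓘(ℝ, EP) g q v = θ q v := by
  -- `θc y` is the component of `θ` in the direction `y` of the fibre.
  let θc : G → P → ℝ := fun y q => θ q (c.field (fun _ => (0, y)) q)
  have hθc : ∀ y, ∀ p ∈ c.chart.source, ContMDiffAt 𝓘(ℝ, EP) 𝓘(ℝ, ℝ) ∞ (θc y) p := by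
    intro y p hp
    obtain ⟨V, hV, hV0, hVe⟩ := c.exists_vertical_field hφ hp y
    refine (hθ.smooth V hV hV0 p).congr_of_eventuallyEq ?_
    filter_upwards [hVe] with q hq
    simp only [θc, hq]
  have hcl : ∀ y y', ∀ p ∈ c.chart.source,
      mvfderiv 𝓘(ℝ, EP) (θc y') p (c.field (fun _ => (0, y)) p) =
        mvfderiv 𝓘(ℝ, EP) (θc y) p (c.field (fun _ => (0, y')) p) := by
    intro y y' p hp
    obtain ⟨V, hV, hV0, hVe⟩ := c.exists_vertical_field hφ hp y
    obtain ⟨V', hV', hV0', hVe'⟩ := c.exists_vertical_field hφ hp y'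
    have h1 := hθ.closed V V' hV hV0 hV' hV0' p
    have e : (fun q => θ q (V q)) =ᶠ[𝓝 p] θc y := by
      filter_upwards [hVe] with q hq
      simp only [θc, hq]
    have e' : (fun q => θ q (V' q)) =ᶠ[𝓝 p] θc y' := by
      filter_upwards [hVe'] with q hq
      simp only [θc, hq]
    rw [Filter.EventuallyEq.mlieBracket_vectorField_eq hVe hVe', c.mlieBracket_field_const hp,
      map_zero, sub_eq_zero, LieAlgebroid.mvfderiv_congr e, LieAlgebroid.mvfderiv_congr e',
      hVe.self_of_nhds, hVe'.self_of_nhds] at h1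
    exact h1
  have hadd : ∀ q ∈ c.chart.source, ∀ y y', θc (y + y') q = θc y q + θc y' q := by
    intro q hq y y'
    simp only [θc]
    rw [← map_add]
    congr 1
    apply c.dchart_injective hq
    rw [map_add, c.dchart_field _ hq, c.dchart_field _ hq, c.dchart_field _ hq]
    simp
  have hsmul : ∀ q ∈ c.chart.source, ∀ (r : ℝ) y, θc (r • y) q = r * θc y q := by
    intro q hq r y
    simp only [θc]
    rw [← smul_eq_mul, ← map_smul]
    congr 1
    apply c.dchart_injective hq
    rw [map_smul, c.dchart_field _ hq, c.dchart_field _ hq]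
    simp
  classical
  let η : EM × G → G →L[ℝ] ℝ := fun w => if hw : w ∈ c.chart.target then
    LinearMap.toContinuousLinearMap
      { toFun := fun y => θc y (c.chart.symm w)
        map_add' := hadd _ (c.chart.map_target hw)
        map_smul' := hsmul _ (c.chart.map_target hw) } else 0
  have hη : ∀ w ∈ c.chart.target, ∀ y, η w y = (θc y ∘ c.chart.symm) w := by
    intro w hw y
    simp only [η, dif_pos hw]
    rfl
  have hηs : ContDiffOn ℝ ∞ η (Metric.ball c.center c.radius) := by
    rw [← c.target_eq]
    refine contDiffOn_clm_apply.2 fun y => ContDiffOn.congr ?_ fun w hw => hη w hw y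
    exact contMDiffOn_iff_contDiffOn.1 fun w hw =>
      ((hθc y _ (c.chart.map_target hw)).comp w
        (c.contMDiffOn_symm.contMDiffAt (c.chart.open_target.mem_nhds hw))).contMDiffWithinAt
  have hηd : ∀ w ∈ c.chart.target, ∀ y y', fderiv ℝ η w (0, y) y' =
      mvfderiv 𝓘(ℝ, EP) (θc y') (c.chart.symm w) (c.field (fun _ => (0, y)) (c.chart.symm w)) := by
    intro w hw y y'
    have hs := c.chart.map_target hw
    rw [c.mvfderiv_eq hs ((hθc y' _ hs).mdifferentiableAt (by simp)), c.dchart_field _ hs,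
      c.chart.right_inv hw]
    have h1 : (fun w => η w y') =ᶠ[𝓝 w] θc y' ∘ c.chart.symm := by
      filter_upwards [c.chart.open_target.mem_nhds hw] with w' hw'
      exact hη w' hw' y'
    have h2 : DifferentiableAt ℝ η w :=
      (hηs.contDiffAt (c.target_eq ▸ c.chart.open_target.mem_nhds hw)).differentiableAt (by simp)
    rw [← h1.fderiv_eq, fderiv_clm_apply h2 (differentiableAt_const y')]
    simp
  obtain ⟨g, hg, hgd⟩ := exists_fibrewise_primitive hηs (by
    rw [← c.target_eq]
    intro w hw y y'
    rw [hηd w hw, hηd w hw, hcl y y' _ (c.chart.map_target hw)])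
  rw [← c.target_eq] at hg hgd
  have hgs : ContMDiffOn 𝓘(ℝ, EP) 𝓘(ℝ, ℝ) ∞ (g ∘ c.chart) c.chart.source :=
    hg.contMDiffOn.comp c.contMDiffOn_chart c.chart.mapsTo
  refine ⟨g ∘ c.chart, hgs, fun q hq v hv => ?_⟩
  have hqt := c.chart.map_source hq
  have h1 : (g ∘ c.chart) ∘ c.chart.symm =ᶠ[𝓝 (c.chart q)] g := by
    filter_upwards [c.chart.open_target.mem_nhds hqt] with w hw
    simp [c.chart.right_inv hw]
  rw [c.eq_field_of_vertical hφ hq hv, c.mvfderiv_eq hq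
    ((hgs.contMDiffAt (c.source_mem_nhds hq)).mdifferentiableAt (by simp)),
    h1.fderiv_eq, c.dchart_field _ hq, hgd _ hqt, hη _ hqt, Function.comp_apply,
    c.chart.left_inv hq]

end Submersion

section Submersion

universe u

variable {EM G M P : Type*} {EP : Type u}
  [NormedAddCommGroup EM] [NormedSpace ℝ EM] [FiniteDimensional ℝ EM]
  [TopologicalSpace M] [ChartedSpace EM M] [IsManifold 𝓘(ℝ, EM) ∞ M]
  [NormedAddCommGroup EP] [NormedSpace ℝ EP] [FiniteDimensional ℝ EP]
  [TopologicalSpace P] [ChartedSpace EP P] [IsManifold 𝓘(ℝ, EP) ∞ P]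
  [NormedAddCommGroup G] [NormedSpace ℝ G] [FiniteDimensional ℝ G]
  {φ : P → M}

/-! ### Global primitives along simply connected fibres -/

theorem locallyPathConnectedSpace_fibre (hc : HasFibredCharts EM G EP φ) (m : M) :
    LocallyPathConnectedSpace (φ ⁻¹' {m}) := by
  refine ⟨fun x => ⟨fun N => ⟨fun hN => ?_, fun ⟨t, ht, htN⟩ => mem_of_superset ht.1 htN⟩⟩⟩
  obtain ⟨p, rfl⟩ := x
  obtain ⟨N', hN', hNN'⟩ := mem_nhds_subtype _ _ _ |>.1 hN
  obtain ⟨c, hp, hcN⟩ := hc p N' hN'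
  refine ⟨Subtype.val ⁻¹' c.chart.source, ⟨?_, ?_⟩, (preimage_mono hcN).trans hNN'⟩
  · exact continuous_subtype_val.continuousAt.preimage_mem_nhds (c.source_mem_nhds hp)
  · rw [Topology.IsInducing.subtypeVal.isPathConnected_iff, Subtype.image_preimage_coe, inter_comm]
    exact c.isPathConnected_source_inter_fibre hp

/-- Let the fibres of `φ` be connected, and let the function `F` on the total space differ from a
smooth function, in a fibred chart around each point, by a function which is constant on the slices.
Then `F` becomes smooth on subtraction of a suitable function of the base. -/
theorem exists_contMDiff_sub_comp [T2Space M] [SigmaCompactSpace M]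
    (hφ : ContMDiff 𝓘(ℝ, EP) 𝓘(ℝ, EM) ∞ φ)
    (hsurj : Function.Surjective φ) (hconn : ∀ m, IsPreconnected (φ ⁻¹' {m})) {F : P → ℝ}
    {c : P → FibredChart EM EP G φ} (hmem : ∀ p, p ∈ (c p).chart.source) {g : P → P → ℝ}
    (hg : ∀ p, ContMDiffOn 𝓘(ℝ, EP) 𝓘(ℝ, ℝ) ∞ (g p) (c p).chart.source)
    (hF : ∀ p, ∀ q ∈ (c p).chart.source, ∀ q' ∈ (c p).chart.source, φ q = φ q' →
      F q - g p q = F q' - g p q') :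
    ∃ a : M → ℝ, ContMDiff 𝓘(ℝ, EP) 𝓘(ℝ, ℝ) ∞ (fun q => F q - a (φ q)) := by
  have hgA : ∀ p, ∀ q ∈ (c p).chart.source, ContMDiffAt 𝓘(ℝ, EP) 𝓘(ℝ, ℝ) ∞ (g p) q :=
    fun p q hq => (hg p).contMDiffAt ((c p).source_mem_nhds hq)
  -- Smoothness of `F - a ∘ φ` spreads along the fibres. It is used as a relation between points,
  -- since `ContMDiffAt` of order `∞` at one point says nothing about smoothness near that point.
  have hspread : ∀ (a : M → ℝ) {p q : P}, φ p = φ q →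
      ContMDiffAt 𝓘(ℝ, EP) 𝓘(ℝ, ℝ) ∞ (fun q => F q - a (φ q)) p →
      ContMDiffAt 𝓘(ℝ, EP) 𝓘(ℝ, ℝ) ∞ (fun q => F q - a (φ q)) q := by
    intro a p q hpq
    refine (eq_on_fibres_of_local (R := fun p q =>
      ContMDiffAt 𝓘(ℝ, EP) 𝓘(ℝ, ℝ) ∞ (fun q => F q - a (φ q)) p ↔
      ContMDiffAt 𝓘(ℝ, EP) 𝓘(ℝ, ℝ) ∞ (fun q => F q - a (φ q)) q)
      ⟨fun _ => Iff.rfl, Iff.symm, Iff.trans⟩ hconn (fun p => ?_) hpq).1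
    filter_upwards [(c p).source_mem_nhds (hmem p)] with q hq hpq
    have key : ∀ q₁ ∈ (c p).chart.source, ∀ q₂ ∈ (c p).chart.source, φ q₁ = φ q₂ →
        ContMDiffAt 𝓘(ℝ, EP) 𝓘(ℝ, ℝ) ∞ (fun q => F q - a (φ q)) q₁ →
        ContMDiffAt 𝓘(ℝ, EP) 𝓘(ℝ, ℝ) ∞ (fun q => F q - a (φ q)) q₂ := by
      intro q₁ h1 q₂ h2 h12 h
      have h3 := (c p).contMDiffAt_of_slice hφ (k := fun q => F q - a (φ q) - g p q)
        (fun q hq q' hq' hqq' => by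
          have := hF p q hq q' hq' hqq'
          simp only [hqq']
          linarith) h1 h2 h12 (h.sub (hgA p q₁ h1))
      refine (h3.add (hgA p q₂ h2)).congr_of_eventuallyEq (Eventually.of_forall fun q => ?_)
      simp
    exact ⟨key p (hmem p) q hq hpq, key q hq p (hmem p) hpq.symm⟩
  -- Over a small open set, `b` can be taken to be `F ∘ σ` for a local section `σ`: then `F - b ∘ φ` is
  -- smooth near the image of `σ`, where it is `g p - g p ∘ σ ∘ φ`.
  have hloc : ∀ m : M, ∃ (b : M → ℝ) (U : Set M), IsOpen U ∧ m ∈ U ∧ ∀ q, φ q ∈ U →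
      ContMDiffAt 𝓘(ℝ, EP) 𝓘(ℝ, ℝ) ∞ (fun q => F q - b (φ q)) q := by
    intro m
    obtain ⟨p, rfl⟩ := hsurj m
    obtain ⟨σ, U, hU, hpU, hσ, hσp, hσm, hσφ⟩ := (c p).exists_localSection (hmem p)
    refine ⟨F ∘ σ, U, hU, hpU, fun q hq => hspread (F ∘ σ) (hσφ _ hq) ?_⟩
    have hs := hσm hq
    have h1 : ContMDiffAt 𝓘(ℝ, EP) 𝓘(ℝ, ℝ) ∞ (fun q => g p q - g p (σ (φ q))) (σ (φ q)) := by
      have e : φ (σ (φ q)) = φ q := hσφ _ hq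
      have h2 : ContMDiffAt 𝓘(ℝ, EP) 𝓘(ℝ, EP) ∞ (σ ∘ φ) (σ (φ q)) :=
        ContMDiffAt.comp (I' := 𝓘(ℝ, EM)) _ (by rw [e]; exact hσ.contMDiffAt (hU.mem_nhds hq))
          hφ.contMDiffAt
      refine (hgA p _ hs).sub (ContMDiffAt.comp (I' := 𝓘(ℝ, EP)) (f := σ ∘ φ) (g := g p) _ ?_ h2)
      simp only [Function.comp_apply, e]
      exact hgA p _ hs
    refine h1.congr_of_eventuallyEq ?_
    have hU' : φ ⁻¹' U ∈ 𝓝 (σ (φ q)) :=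
      (hU.preimage hφ.continuous).mem_nhds (by rw [mem_preimage, hσφ _ hq]; exact hq)
    filter_upwards [(c p).source_mem_nhds hs, hU'] with q' h1 h2
    have := hF p q' h1 _ (hσm h2) (hσφ _ h2).symm
    simp only [Function.comp_apply]
    linarith
  choose b U hU hmU hb using hloc
  obtain ⟨ρ, hρ⟩ := SmoothPartitionOfUnity.exists_isSubordinate 𝓘(ℝ, EM) isClosed_univ U hU
    fun m _ => mem_iUnion.2 ⟨m, hmU m⟩
  have hsum : ∀ m, ∀ r : ℝ, ∑ᶠ i, ρ i m • (r - b i m) = r - ∑ᶠ i, ρ i m • b i m := by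
    intro m r
    have h1 := ρ.sum_finsupport_smul_eq_finsum (x₀ := m) (fun i x => r - b i x)
    have h2 := ρ.sum_finsupport_smul_eq_finsum (x₀ := m) (fun i x => b i x)
    have h3 := ρ.sum_finsupport (x₀ := m) (mem_univ m)
    rw [← h1, ← h2]
    simp only [smul_sub, Finset.sum_sub_distrib, ← Finset.sum_smul, h3, one_smul]
  refine ⟨fun m => ∑ᶠ i, ρ i m • b i m, ?_⟩
  have h : ContMDiff 𝓘(ℝ, EP) 𝓘(ℝ, ℝ) ∞ (fun q => ∑ᶠ i, ρ i (φ q) • (F q - b i (φ q))) := by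
    refine contMDiff_finsum (fun i q => ?_) ?_
    · by_cases hq : φ q ∈ tsupport (ρ i)
      · exact ((ρ i).contMDiff.comp hφ).contMDiffAt.smul (hb i q (hρ i hq))
      · have h0 : ∀ᶠ q' in 𝓝 q, φ q' ∉ tsupport (ρ i) :=
          hφ.continuous.continuousAt.eventually_mem ((isClosed_tsupport _).isOpen_compl.mem_nhds hq)
        refine (contMDiffAt_const (c := (0 : ℝ))).congr_of_eventuallyEq ?_
        filter_upwards [h0] with q' hq'
        rw [image_eq_zero_of_notMem_tsupport hq', zero_smul]
    · refine (ρ.locallyFinite.preimage_continuous hφ.continuous).subset fun i q hq => ?_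
      exact fun h0 => hq (by simp only [show ρ i (φ q) = 0 from h0, zero_smul])
  simpa only [hsum] using h

/-- A smooth family of closed 1-forms on simply connected fibres has a smooth primitive. -/
theorem IsClosedAlongFibres.exists_primitive [T2Space M] [SigmaCompactSpace M] [T2Space P]
    (hc : HasFibredCharts EM G EP φ) (hφ : ContMDiff 𝓘(ℝ, EP) 𝓘(ℝ, EM) ∞ φ)
    (hsurj : Function.Surjective φ) (hsc : ∀ m, SimplyConnectedSpace (φ ⁻¹' {m}))
    {θ : ∀ p : P, TangentSpace 𝓘(ℝ, EP) p →ₗ[ℝ] ℝ}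
    (hθ : IsClosedAlongFibres (EM := EM) φ θ) :
    ∃ f : P → ℝ, ContMDiff 𝓘(ℝ, EP) 𝓘(ℝ, ℝ) ∞ f ∧
      ∀ (q : P) (v : TangentSpace 𝓘(ℝ, EP) q),
        mfderiv 𝓘(ℝ, EP) 𝓘(ℝ, EM) φ q v = 0 → mvfderiv 𝓘(ℝ, EP) f q v = θ q v := by
  have hconn : ∀ m, IsPreconnected (φ ⁻¹' {m}) := fun m =>
    isPreconnected_iff_preconnectedSpace.2 inferInstance
  choose c hmem using hc.exists_chart
  choose g hg hgd using fun p => (c p).exists_primitive hφ hθ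
  have hgA : ∀ p, ∀ q ∈ (c p).chart.source, ContMDiffAt 𝓘(ℝ, EP) 𝓘(ℝ, ℝ) ∞ (g p) q :=
    fun p q hq => (hg p).contMDiffAt ((c p).source_mem_nhds hq)
  have hgg : ∀ p p', ∀ q ∈ (c p).chart.source ∩ (c p').chart.source, ∀ᶠ z in 𝓝 q, φ z = φ q →
      g p z - g p' z = g p q - g p' q := by
    intro p p' q hq
    obtain ⟨d, hqd, hd⟩ := hc q _
      (inter_mem ((c p).source_mem_nhds hq.1) ((c p').source_mem_nhds hq.2))
    filter_upwards [d.source_mem_nhds hqd] with z hz hzq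
    have hm : ∀ p, ∀ q ∈ (c p).chart.source, MDifferentiableAt 𝓘(ℝ, EP) 𝓘(ℝ, ℝ) (g p) q :=
      fun p q hq => (hgA p q hq).mdifferentiableAt (by simp)
    refine d.eq_of_vertical_mvfderiv_eq_zero hφ (h := fun z => g p z - g p' z)
      (fun y hy => (hm p y (hd hy).1).sub (hm p' y (hd hy).2)) (fun y hy v hv => ?_) hz hqd hzq
    have h1 := mvfderiv_sub (hm p y (hd hy).1) (hm p' y (hd hy).2)
    have h2 := congrArg (fun l => l v) h1
    refine h2.trans ?_
    simp only [sub_apply]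
    rw [hgd p y (hd hy).1 v hv, hgd p' y (hd hy).2 v hv, sub_self]
  have hglue : ∀ m, ∃ f : φ ⁻¹' {m} → ℝ, ∀ i : φ ⁻¹' {m}, ∀ y : φ ⁻¹' {m},
      y.1 ∈ (c i.1).chart.source → ∀ᶠ z in 𝓝 y, f z - g i.1 z.1 = f y - g i.1 y.1 := by
    intro m
    have := locallyPathConnectedSpace_fibre hc m
    refine exists_glue_of_simplyConnected (Y := φ ⁻¹' {m})
      (fun i => Subtype.val ⁻¹' (c i.1).chart.source)
      (fun i => (c i.1).chart.open_source.preimage continuous_subtype_val) (fun i => hmem i.1)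
      (fun i z => g i.1 z.1) fun i j y hy => ?_
    filter_upwards [continuous_subtype_val.continuousAt.eventually (hgg i.1 j.1 y.1 hy)] with z hz
    exact hz (z.2.trans y.2.symm)
  choose f₀ hf₀ using hglue
  -- The primitives on the single fibres, put together without regard to smoothness.
  let F : P → ℝ := fun p => f₀ (φ p) ⟨p, rfl⟩
  have hFeq : ∀ {m} (y : φ ⁻¹' {m}), F y.1 = f₀ m y := by
    rintro m ⟨y, rfl⟩
    rfl
  have hF₀ : ∀ p, ∀ q ∈ (c p).chart.source, ∀ᶠ z in 𝓝 q, φ z = φ q →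
      F z - g p z = F q - g p q := by
    intro p q hq
    have h1 := hf₀ (φ q) ⟨q, rfl⟩ ⟨q, rfl⟩ (hmem q)
    simp only [← hFeq] at h1
    rw [show 𝓝 (⟨q, rfl⟩ : φ ⁻¹' {φ q}) = comap Subtype.val (𝓝 q) from nhds_induced _ _,
      eventually_comap] at h1
    filter_upwards [h1, hgg p q q ⟨hq, hmem q⟩] with z hz hz' hzq
    have e1 := hz ⟨z, hzq⟩ rfl
    have e2 := hz' hzq
    simp only at e1
    linarith
  have hF : ∀ p, ∀ q ∈ (c p).chart.source, ∀ q' ∈ (c p).chart.source, φ q = φ q' →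
      F q - g p q = F q' - g p q' := by
    intro p q hq q' hq' hqq'
    refine ((c p).isPathConnected_source_inter_fibre hq).isConnected.isPreconnected.induction₂
      (fun q q' => F q - g p q = F q' - g p q') (fun x hx => ?_)
      (fun x y z _ _ _ => Eq.trans) (fun x y _ _ => Eq.symm) ⟨hq, rfl⟩ ⟨hq', hqq'.symm⟩
    filter_upwards [nhdsWithin_le_nhds (hF₀ p x hx.1), self_mem_nhdsWithin] with z hz hz'
    exact (hz (hz'.2.trans hx.2.symm)).symm
  obtain ⟨a, ha⟩ := exists_contMDiff_sub_comp hφ hsurj hconn hmem hg hF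
  refine ⟨_, ha, fun q v hv => ?_⟩
  have hfq := ha.mdifferentiable (by simp) q
  have hgq := (hgA q q (hmem q)).mdifferentiableAt (by simp)
  have h1 := (c q).mvfderiv_eq_zero_of_slice hφ (k := fun z => F z - a (φ z) - g q z)
    (fun y hy y' hy' hyy' => by
      have := hF q y hy y' hy' hyy'
      simp only [hyy']
      linarith) (hmem q) (hfq.sub hgq) hv
  have h2 := congrArg (fun l => l v) (mvfderiv_sub hfq hgq)
  rw [← hgd q q (hmem q) v hv, ← sub_eq_zero]
  exact h2.symm.trans h1

end Submersion

namespace LieAlgebroid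

variable {EM EP F G M P : Type*}
  [NormedAddCommGroup EM] [NormedSpace ℝ EM] [FiniteDimensional ℝ EM]
  [TopologicalSpace M] [ChartedSpace EM M] [IsManifold 𝓘(ℝ, EM) ∞ M]
  [NormedAddCommGroup EP] [NormedSpace ℝ EP] [FiniteDimensional ℝ EP]
  [TopologicalSpace P] [ChartedSpace EP P] [IsManifold 𝓘(ℝ, EP) ∞ P]
  [NormedAddCommGroup F] [NormedSpace ℝ F] [FiniteDimensional ℝ F]
  [NormedAddCommGroup G] [NormedSpace ℝ G] [FiniteDimensional ℝ G]
  {A : M → Type*} [TopologicalSpace (TotalSpace F A)] [∀ x, AddCommGroup (A x)]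
  [∀ x, Module ℝ (A x)] [∀ x, TopologicalSpace (A x)] [FiberBundle F A] [VectorBundle ℝ F A]
  [ContMDiffVectorBundle ∞ F A 𝓘(ℝ, EM)]
  {L : LieAlgebroid EM F A} {φ : P → M} [T2Space M] [T2Space P]
  {hφ : ContMDiff 𝓘(ℝ, EP) 𝓘(ℝ, EM) ∞ φ}

/-! ### Vertical sections and lifts in the pull-back Lie algebroid -/

theorem anchor_fst_eq {p : P} (x : L.PullbackFiber EP φ p) :
    L.anchor (φ p) x.1.1 = mfderiv 𝓘(ℝ, EP) 𝓘(ℝ, EM) φ p x.1.2 := x.2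

variable (L) in
/-- The element `(0, v)` of the pull-back Lie algebroid, for a vector `v` tangent to the fibre. -/
def verticalVector {p : P} (v : TangentSpace 𝓘(ℝ, EP) p)
    (hv : mfderiv 𝓘(ℝ, EP) 𝓘(ℝ, EM) φ p v = 0) : L.PullbackFiber EP φ p :=
  ⟨(0, v), (map_zero (L.anchor (φ p))).trans hv.symm⟩

variable (L hφ) in
/-- The section `(0, V)` of the pull-back Lie algebroid, for a vertical vector field `V`. -/
def verticalSection (V : ∀ p : P, TangentSpace 𝓘(ℝ, EP) p)
    (hV : ContMDiff 𝓘(ℝ, EP) 𝓘(ℝ, EP).tangent ∞ (fun p => (⟨p, V p⟩ : TangentBundle 𝓘(ℝ, EP) P)))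
    (hV0 : ∀ p, mfderiv 𝓘(ℝ, EP) 𝓘(ℝ, EM) φ p (V p) = 0) : L.pullbackSections hφ :=
  ⟨fun p => L.verticalVector (V p) (hV0 p), .zero hφ, hV⟩

theorem isDecomp_zero (p : P) :
    IsDecomp EM EP F φ (fun p => (0 : A (φ p))) p (fun i : Empty => i.elim) (fun i => i.elim) :=
  ⟨fun i => i.elim, Eventually.of_forall fun _ => by simp⟩

theorem isDecomp_smul {χ : P → ℝ} (hχ : ContMDiff 𝓘(ℝ, EP) 𝓘(ℝ, ℝ) ∞ χ)
    (b : Cₛ^∞⟮𝓘(ℝ, EM); F, A⟯) {s : ∀ p, A (φ p)} (hs : ∀ q, s q = χ q • b (φ q)) (p : P) :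
    IsDecomp EM EP F φ s p (fun _ : Unit => χ) (fun _ => b) :=
  ⟨fun _ => hχ, Eventually.of_forall fun q => by simp [hs]⟩

/-- A section `b` of `A` lifts, near every point, to a section of the pull-back Lie algebroid: its
product with a bump function `χ` lifts globally. -/
theorem exists_lift (hc : HasFibredCharts EM G EP φ) (b : Cₛ^∞⟮𝓘(ℝ, EM); F, A⟯) (p : P) :
    ∃ (χ : P → ℝ) (s : L.pullbackSections hφ), ContMDiff 𝓘(ℝ, EP) 𝓘(ℝ, ℝ) ∞ χ ∧ χ =ᶠ[𝓝 p] 1 ∧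
      ∀ q, (s.1 q).1.1 = χ q • b (φ q) := by
  obtain ⟨c, hp⟩ := hc.exists_chart p
  obtain ⟨χ, h1, h2, h3, h4⟩ := c.exists_bump_field hp
    fun q hq => c.contDiffAt_liftCoord (L.contMDiff_anchor_section b) hq
  refine ⟨χ, ⟨fun q => ⟨(χ q • b (φ q), _), ?_⟩, (IsSmoothAlong.comp hφ b).smul hφ h1, h4⟩,
    h1, h2, fun q => rfl⟩
  change L.anchor (φ q) (χ q • b (φ q)) =
    mfderiv 𝓘(ℝ, EP) 𝓘(ℝ, EM) φ q (χ q • c.field (c.liftCoord fun m => L.anchor m (b m)) q)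
  by_cases hq : q ∈ c.chart.source
  · rw [map_smul, map_smul, c.mfderiv_field_lift hφ _ hq]
  · rw [image_eq_zero_of_notMem_tsupport fun h => hq (h3 h), zero_smul, zero_smul, map_zero,
      map_zero]

theorem mvfderiv_eq_zero_of_eventuallyEq_one {χ : P → ℝ} {p : P} (h : χ =ᶠ[𝓝 p] 1) :
    mvfderiv 𝓘(ℝ, EP) χ p = 0 :=
  (mvfderiv_congr (h.trans (Eventually.of_forall fun _ => rfl) : χ =ᶠ[𝓝 p] fun _ => (1 : ℝ))).trans
    (mvfderiv_const 1)

/-! ### Closed cochains of the pull-back Lie algebroid -/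

theorem cocycle_bracket {β : (L.pullback hφ).Cochain} (hβ : β ∈ (L.pullback hφ).cocycles)
    (s t : L.pullbackSections hφ) (p : P) :
    mvfderiv 𝓘(ℝ, EP) (fun q => β.1 q (t.1 q)) p (s.1 p).1.2 -
      mvfderiv 𝓘(ℝ, EP) (fun q => β.1 q (s.1 q)) p (t.1 p).1.2 =
      β.1 p ((pullbackBracketFun s t).1 p) :=
  sub_eq_zero.1 (congrFun (congrFun (congrFun (LinearMap.mem_ker.1 hβ) s) t) p)

/-- The restriction of a closed cochain of the pull-back Lie algebroid to vertical vectors is a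
family of closed forms along the fibres. -/
theorem exists_isClosedAlongFibres {β : (L.pullback hφ).Cochain}
    (hβ : β ∈ (L.pullback hφ).cocycles) :
    ∃ θ : ∀ p : P, TangentSpace 𝓘(ℝ, EP) p →ₗ[ℝ] ℝ, IsClosedAlongFibres (EM := EM) φ θ ∧
      ∀ (p : P) (v : TangentSpace 𝓘(ℝ, EP) p) (hv : mfderiv 𝓘(ℝ, EP) 𝓘(ℝ, EM) φ p v = 0),
        θ p v = β.1 p (L.verticalVector v hv) := by
  have hext : ∀ p : P, ∃ l : TangentSpace 𝓘(ℝ, EP) p →ₗ[ℝ] ℝ,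
      ∀ (v : TangentSpace 𝓘(ℝ, EP) p) (hv : mfderiv 𝓘(ℝ, EP) 𝓘(ℝ, EM) φ p v = 0),
        l v = β.1 p (L.verticalVector v hv) := by
    intro p
    let K := LinearMap.ker (mfderiv 𝓘(ℝ, EP) 𝓘(ℝ, EM) φ p).toLinearMap
    let ι : K →ₗ[ℝ] L.PullbackFiber EP φ p :=
      { toFun := fun v => L.verticalVector v.1 v.2
        map_add' := fun v w => Subtype.ext (Prod.ext (add_zero _).symm rfl)
        map_smul' := fun r v => Subtype.ext (Prod.ext (smul_zero _).symm rfl) }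
    obtain ⟨l, hl⟩ := LinearMap.exists_extend ((β.1 p).comp ι)
    exact ⟨l, fun v hv => LinearMap.congr_fun hl ⟨v, hv⟩⟩
  choose θ hθ using hext
  refine ⟨θ, ⟨fun V hV hV0 => ?_, fun V V' hV hV0 hV' hV0' p => ?_⟩, hθ⟩
  · have h := β.2 (L.verticalSection hφ V hV hV0).1 (L.verticalSection hφ V hV hV0).2
    exact h.congr fun p => hθ p _ (hV0 p)
  · let s := L.verticalSection hφ V hV hV0
    let t := L.verticalSection hφ V' hV' hV0'
    have h := cocycle_bracket hβ s t p
    have h1 : ((pullbackBracketFun s t).1 p).1.1 = 0 := by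
      rw [pullbackBracketFun_fst s t (isDecomp_zero p) (isDecomp_zero p)]
      simp [decompBracket]
    have h2 : mfderiv 𝓘(ℝ, EP) 𝓘(ℝ, EM) φ p (mlieBracket 𝓘(ℝ, EP) V V' p) = 0 := by
      refine (anchor_fst_eq ((pullbackBracketFun s t).1 p)).symm.trans ?_
      rw [h1, map_zero]
    have h3 : (pullbackBracketFun s t).1 p = L.verticalVector _ h2 :=
      Subtype.ext (Prod.ext h1 rfl)
    rw [hθ p _ h2, ← h3, ← h]
    simp only [hθ _ _ (hV0 _), hθ _ _ (hV0' _)]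
    rfl

/-- A cochain of the pull-back Lie algebroid which vanishes on vertical vectors depends only on
the `A`-component. -/
theorem exists_eq_fst (hsub : ∀ p, Function.Surjective (mfderiv 𝓘(ℝ, EP) 𝓘(ℝ, EM) φ p))
    {β : (L.pullback hφ).Cochain}
    (h0 : ∀ (p : P) (v : TangentSpace 𝓘(ℝ, EP) p) (hv : mfderiv 𝓘(ℝ, EP) 𝓘(ℝ, EM) φ p v = 0),
      β.1 p (L.verticalVector v hv) = 0) :
    ∃ κ : ∀ p, A (φ p) →ₗ[ℝ] ℝ, ∀ (p : P) (x : L.PullbackFiber EP φ p),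
      β.1 p x = κ p x.1.1 := by
  suffices h : ∀ p, ∃ k : A (φ p) →ₗ[ℝ] ℝ, ∀ x : L.PullbackFiber EP φ p, β.1 p x = k x.1.1 from
    ⟨fun p => (h p).choose, fun p => (h p).choose_spec⟩
  intro p
  let pr : L.PullbackFiber EP φ p →ₗ[ℝ] A (φ p) :=
    (LinearMap.fst ℝ (A (φ p)) (TangentSpace 𝓘(ℝ, EP) p)).comp (L.PullbackFiber EP φ p).subtype
  have hpr : Function.Surjective pr := fun a => by
    obtain ⟨u, hu⟩ := hsub p (L.anchor (φ p) a)
    exact ⟨⟨(a, u), hu.symm⟩, rfl⟩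
  obtain ⟨r, hr⟩ := LinearMap.exists_rightInverse_of_surjective pr (LinearMap.range_eq_top.2 hpr)
  refine ⟨(β.1 p).comp r, fun x => ?_⟩
  have h1 : (x - r (pr x)).1.1 = 0 := by
    change pr (x - r (pr x)) = 0
    rw [map_sub, sub_eq_zero]
    exact (LinearMap.congr_fun hr (pr x)).symm
  have h2 : mfderiv 𝓘(ℝ, EP) 𝓘(ℝ, EM) φ p (x - r (pr x)).1.2 = 0 := by
    rw [← anchor_fst_eq, h1, map_zero]
  have h3 : x - r (pr x) = L.verticalVector _ h2 := Subtype.ext (Prod.ext h1 rfl)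
  have h4 := h0 p _ h2
  rw [← h3, map_sub, sub_eq_zero] at h4
  exact h4

theorem exists_section_apply_eq {m : M} (a : A m) : ∃ b : Cₛ^∞⟮𝓘(ℝ, EM); F, A⟯, b m = a := by
  obtain ⟨U, hU, hE⟩ := FiberBundle.exists_contMDiffOn_extend (k := ∞) 𝓘(ℝ, EM) F (V := A) a
  obtain ⟨b, hb⟩ := exists_global_section (E := EM) (F := F) hU hE
  exact ⟨b, by rw [hb.self_of_nhds, FiberBundle.extend_apply_self]⟩

section Descent

variable {β : (L.pullback hφ).Cochain} {κ : ∀ p, A (φ p) →ₗ[ℝ] ℝ}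

theorem eventually_eq_of_lift (hκ : ∀ (p : P) (x : L.PullbackFiber EP φ p), β.1 p x = κ p x.1.1)
    {b : Cₛ^∞⟮𝓘(ℝ, EM); F, A⟯} {χ : P → ℝ} {s : L.pullbackSections hφ} {p : P}
    (hχ : χ =ᶠ[𝓝 p] 1) (hs : ∀ q, (s.1 q).1.1 = χ q • b (φ q)) :
    (fun q => β.1 q (s.1 q)) =ᶠ[𝓝 p] fun q => κ q (b (φ q)) := by
  filter_upwards [hχ] with q hq
  rw [hκ, hs, hq, Pi.one_apply, one_smul]

theorem contMDiff_apply_section (hc : HasFibredCharts EM G EP φ)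
    (hκ : ∀ (p : P) (x : L.PullbackFiber EP φ p), β.1 p x = κ p x.1.1)
    (b : Cₛ^∞⟮𝓘(ℝ, EM); F, A⟯) :
    ContMDiff 𝓘(ℝ, EP) 𝓘(ℝ, ℝ) ∞ (fun q => κ q (b (φ q))) := by
  intro p
  obtain ⟨χ, s, -, hχ, hs⟩ := exists_lift (L := L) (hφ := hφ) hc b p
  exact (β.2 s.1 s.2 p).congr_of_eventuallyEq (eventually_eq_of_lift hκ hχ hs).symm

/-- Closedness of `β`, applied to a vertical section and to the lift of a section of `A`: a cocycle
which depends only on the `A`-component is constant along the fibres. -/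
theorem vertical_mvfderiv_apply_section (hc : HasFibredCharts EM G EP φ)
    (hβ : β ∈ (L.pullback hφ).cocycles)
    (hκ : ∀ (p : P) (x : L.PullbackFiber EP φ p), β.1 p x = κ p x.1.1)
    (b : Cₛ^∞⟮𝓘(ℝ, EM); F, A⟯) (p : P) (v : TangentSpace 𝓘(ℝ, EP) p)
    (hv : mfderiv 𝓘(ℝ, EP) 𝓘(ℝ, EM) φ p v = 0) :
    mvfderiv 𝓘(ℝ, EP) (fun q => κ q (b (φ q))) p v = 0 := by
  obtain ⟨c, hp⟩ := hc.exists_chart p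
  obtain ⟨V, hV, hV0, hVe⟩ := c.exists_vertical_field hφ hp (c.dchart p v).2
  have hVp : V p = v := by rw [hVe.self_of_nhds, ← c.eq_field_of_vertical hφ hp hv]
  obtain ⟨χ, s, hχs, hχ, hs⟩ := exists_lift (L := L) (hφ := hφ) hc b p
  let t := L.verticalSection hφ V hV hV0
  have h := cocycle_bracket hβ t s p
  have ht : (fun q => β.1 q (t.1 q)) = fun _ => (0 : ℝ) := funext fun q =>
    (hκ q _).trans (map_zero (κ q))
  have h1 : ((pullbackBracketFun t s).1 p).1.1 = 0 := by
    rw [pullbackBracketFun_fst t s (isDecomp_zero p) (isDecomp_smul hχs b hs p)]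
    simp [decompBracket, mvfderiv_eq_zero_of_eventuallyEq_one hχ]
  rw [ht, mvfderiv_const, hκ, h1, map_zero, mvfderiv_congr (eventually_eq_of_lift hκ hχ hs)] at h
  rw [← hVp]
  exact (sub_zero _).symm.trans h

/-- If the fibres are connected, a cocycle which depends only on the `A`-component is the pull-back
of a cocycle of `A`. -/
theorem exists_pullbackCochain_eq (hc : HasFibredCharts EM G EP φ)
    (hsurj : Function.Surjective φ) (hconn : ∀ m, IsPreconnected (φ ⁻¹' {m}))
    (hβ : β ∈ (L.pullback hφ).cocycles)
    (hκ : ∀ (p : P) (x : L.PullbackFiber EP φ p), β.1 p x = κ p x.1.1) :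
    ∃ α ∈ L.toSections.cocycles, L.pullbackCochain hφ α = β := by
  have hsm := contMDiff_apply_section hc hκ
  have hconst : ∀ (b : Cₛ^∞⟮𝓘(ℝ, EM); F, A⟯) (p q : P), φ p = φ q →
      κ p (b (φ p)) = κ q (b (φ q)) := fun b p q =>
    eq_on_fibres_of_vertical_mvfderiv_eq_zero hc hφ hconn (hsm b)
      (vertical_mvfderiv_apply_section hc hβ hκ b)
  -- The value at `m` is taken on sections of `A`, as `A (φ p)` and `A m` are different types.
  have hα : ∀ m, ∃ l : A m →ₗ[ℝ] ℝ, ∀ p, φ p = m → ∀ b : Cₛ^∞⟮𝓘(ℝ, EM); F, A⟯,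
      κ p (b (φ p)) = l (b m) := by
    intro m
    obtain ⟨p₀, rfl⟩ := hsurj m
    exact ⟨κ p₀, fun p hp b => hconst b p p₀ hp⟩
  choose l hl using hα
  have hlκ : ∀ p, κ p = l (φ p) := by
    intro p
    ext a
    obtain ⟨b, rfl⟩ := exists_section_apply_eq (EM := EM) (F := F) a
    exact hl _ p rfl b
  have hls : ∀ b : Cₛ^∞⟮𝓘(ℝ, EM); F, A⟯,
      ContMDiff 𝓘(ℝ, EM) 𝓘(ℝ, ℝ) ∞ (fun m => l m (b m)) := by
    intro b
    obtain ⟨g, hg, hgb⟩ := exists_contMDiff_comp_eq hc hsurj (hsm b) (hconst b)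
    convert hg using 1
    funext m
    obtain ⟨p, rfl⟩ := hsurj m
    rw [hgb, hlκ]
  let α : L.toSections.Cochain := ⟨l, fun s hs => hls ⟨s, hs⟩⟩
  refine ⟨α, LinearMap.mem_ker.2 (funext fun s => funext fun t => funext fun m => ?_), ?_⟩
  · obtain ⟨p, rfl⟩ := hsurj m
    let a := toSection s
    let b := toSection t
    obtain ⟨χ, s', hχs, hχ, hs'⟩ := exists_lift (L := L) (hφ := hφ) hc a p
    obtain ⟨ψ, t', hψs, hψ, ht'⟩ := exists_lift (L := L) (hφ := hφ) hc b p
    have h := cocycle_bracket hβ s' t' p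
    have hχp : χ p = 1 := hχ.self_of_nhds
    have hψp : ψ p = 1 := hψ.self_of_nhds
    -- The lifts are related to the sections of `A` near `p`, and so is their bracket.
    have h1 : ((pullbackBracketFun s' t').1 p).1.1 = L.bracket a b (φ p) := by
      rw [pullbackBracketFun_fst s' t' (isDecomp_smul hχs a hs' p) (isDecomp_smul hψs b ht' p)]
      simp [decompBracket, mvfderiv_eq_zero_of_eventuallyEq_one hχ,
        mvfderiv_eq_zero_of_eventuallyEq_one hψ, hχp, hψp]
    have hd : ∀ (e : Cₛ^∞⟮𝓘(ℝ, EM); F, A⟯) (v : TangentSpace 𝓘(ℝ, EP) p),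
        mvfderiv 𝓘(ℝ, EP) (fun q => κ q (e (φ q))) p v =
          mvfderiv 𝓘(ℝ, EM) (fun m => l m (e m)) (φ p) (mfderiv 𝓘(ℝ, EP) 𝓘(ℝ, EM) φ p v) := by
      intro e v
      simp only [hlκ]
      exact mvfderiv_comp_apply (I := 𝓘(ℝ, EM)) (I' := 𝓘(ℝ, EP)) p
        ((hls e).mdifferentiable (by simp) _) (hφ.mdifferentiable (by simp) p) v
    have e1 : mfderiv 𝓘(ℝ, EP) 𝓘(ℝ, EM) φ p (s'.1 p).1.2 = L.anchor (φ p) (a (φ p)) := by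
      rw [← anchor_fst_eq, hs', hχp, one_smul]
    have e2 : mfderiv 𝓘(ℝ, EP) 𝓘(ℝ, EM) φ p (t'.1 p).1.2 = L.anchor (φ p) (b (φ p)) := by
      rw [← anchor_fst_eq, ht', hψp, one_smul]
    rw [mvfderiv_congr (eventually_eq_of_lift hκ hχ hs'),
      mvfderiv_congr (eventually_eq_of_lift hκ hψ ht'), hd, hd, e1, e2, hκ, h1, hlκ] at h
    exact sub_eq_zero.2 h
  · refine Subtype.ext (funext fun p => LinearMap.ext fun x => ?_)
    rw [pullbackCochain_apply, hκ, hlκ]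

end Descent

/-! ### The map in cohomology -/

/-- If the fibres are connected, a cochain of `A` whose pull-back is exact is exact. -/
theorem exists_d0_eq_of_pullback (hc : HasFibredCharts EM G EP φ)
    (hsurj : Function.Surjective φ) (hconn : ∀ m, IsPreconnected (φ ⁻¹' {m}))
    {α : L.toSections.Cochain} {f : C^∞⟮𝓘(ℝ, EP), P; ℝ⟯}
    (hf : (L.pullback hφ).d0 f = L.pullbackCochain hφ α) :
    ∃ g : C^∞⟮𝓘(ℝ, EM), M; ℝ⟯, L.toSections.d0 g = α := by
  have hfx : ∀ (p : P) (x : L.PullbackFiber EP φ p),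
      mvfderiv 𝓘(ℝ, EP) f p x.1.2 = α.1 (φ p) x.1.1 := fun p x =>
    congrArg (fun γ : (L.pullback hφ).Cochain => γ.1 p x) hf
  have hconst : ∀ p q, φ p = φ q → f p = f q := fun p q =>
    eq_on_fibres_of_vertical_mvfderiv_eq_zero hc hφ hconn f.contMDiff fun q v hv =>
      (hfx q (L.verticalVector v hv)).trans (map_zero _)
  obtain ⟨g, hg, hgf⟩ := exists_contMDiff_comp_eq hc hsurj f.contMDiff hconst
  refine ⟨⟨g, hg⟩, Subtype.ext (funext fun m => LinearMap.ext fun a => ?_)⟩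
  obtain ⟨p, rfl⟩ := hsurj m
  obtain ⟨u, hu⟩ := mfderiv_surjective_of_hasFibredCharts hc hφ p (L.anchor (φ p) a)
  refine Eq.trans ?_ (hfx p ⟨(a, u), hu.symm⟩)
  change mvfderiv 𝓘(ℝ, EM) g (φ p) (L.anchor (φ p) a) = mvfderiv 𝓘(ℝ, EP) f p u
  rw [← hu, ← mvfderiv_comp_apply (I := 𝓘(ℝ, EM)) (I' := 𝓘(ℝ, EP)) p
    (hg.mdifferentiable (by simp) _) (hφ.mdifferentiable (by simp) p)]
  exact congrArg (fun h => mvfderiv 𝓘(ℝ, EP) h p u) (funext hgf)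

theorem injective_pullbackH1 (hc : HasFibredCharts EM G EP φ)
    (hsurj : Function.Surjective φ) (hconn : ∀ m, IsPreconnected (φ ⁻¹' {m})) :
    Function.Injective (L.pullbackH1 hφ) := by
  rw [injective_iff_map_eq_zero]
  intro x hx
  obtain ⟨α, rfl⟩ := Submodule.Quotient.mk_surjective _ x
  obtain ⟨f, hf⟩ := (Submodule.Quotient.mk_eq_zero _).1
    (hx : Submodule.Quotient.mk (L.pullbackCocycles hφ α) = 0)
  exact (Submodule.Quotient.mk_eq_zero _).2 (exists_d0_eq_of_pullback hc hsurj hconn hf)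

theorem surjective_pullbackH1 [SigmaCompactSpace M] (hc : HasFibredCharts EM G EP φ)
    (hsurj : Function.Surjective φ) (hsc : ∀ m, SimplyConnectedSpace (φ ⁻¹' {m})) :
    Function.Surjective (L.pullbackH1 hφ) := by
  intro x
  obtain ⟨⟨β, hβ⟩, rfl⟩ := Submodule.Quotient.mk_surjective _ x
  obtain ⟨θ, hθ, hθβ⟩ := exists_isClosedAlongFibres hβ
  obtain ⟨f, hf, hfθ⟩ := hθ.exists_primitive hc hφ hsurj hsc
  let f' : C^∞⟮𝓘(ℝ, EP), P; ℝ⟯ := ⟨f, hf⟩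
  have hβ' : β - (L.pullback hφ).d0 f' ∈ (L.pullback hφ).cocycles :=
    sub_mem hβ ((L.pullback hφ).coboundaries_le_cocycles ⟨f', rfl⟩)
  obtain ⟨κ, hκ⟩ := exists_eq_fst (mfderiv_surjective_of_hasFibredCharts hc hφ)
    (β := β - (L.pullback hφ).d0 f') fun p v hv => by
      change β.1 p (L.verticalVector v hv) - mvfderiv 𝓘(ℝ, EP) f p v = 0
      rw [hfθ p v hv, hθβ p v hv, sub_self]
  obtain ⟨α, hα, hαβ⟩ := exists_pullbackCochain_eq hc hsurj
    (fun m => isPreconnected_iff_preconnectedSpace.2 inferInstance) hβ' hκ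
  refine ⟨Submodule.Quotient.mk ⟨α, hα⟩, (Submodule.Quotient.eq _).2 ⟨-f', ?_⟩⟩
  change (L.pullback hφ).d0 (-f') = L.pullbackCochain hφ α - β
  rw [hαβ, map_neg]
  abel

end LieAlgebroid

end

theorem proposition3p15
    {EM EP F : Type*}
    [NormedAddCommGroup EM] [NormedSpace ℝ EM] [FiniteDimensional ℝ EM]
    [NormedAddCommGroup EP] [NormedSpace ℝ EP] [FiniteDimensional ℝ EP]
    [NormedAddCommGroup F] [NormedSpace ℝ F] [FiniteDimensional ℝ F]
    {M : Type*} [TopologicalSpace M] [T2Space M] [SigmaCompactSpace M]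
    [ChartedSpace EM M] [IsManifold 𝓘(ℝ, EM) ∞ M]
    {P : Type*} [TopologicalSpace P] [T2Space P] [SigmaCompactSpace P]
    [ChartedSpace EP P] [IsManifold 𝓘(ℝ, EP) ∞ P]
    {A : M → Type*} [TopologicalSpace (TotalSpace F A)] [∀ x, AddCommGroup (A x)]
    [∀ x, Module ℝ (A x)] [∀ x, TopologicalSpace (A x)] [FiberBundle F A] [VectorBundle ℝ F A]
    [ContMDiffVectorBundle ∞ F A 𝓘(ℝ, EM)]
    (L : LieAlgebroid EM F A)
    (φ : P → M) (hφ : Manifold.IsSubmersion 𝓘(ℝ, EP) 𝓘(ℝ, EM) ∞ φ) (hsurj : Function.Surjective φ) :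
    ((∀ m, IsConnected (φ ⁻¹' {m})) →
      Function.Injective (L.pullbackH1 hφ.contMDiff)) ∧
    ((∀ m, SimplyConnectedSpace (φ ⁻¹' {m})) →
      Function.Bijective (L.pullbackH1 hφ.contMDiff)) := by
  obtain ⟨G, _, _, _, hc⟩ := exists_fibredChart hφ
  refine ⟨fun hconn => LieAlgebroid.injective_pullbackH1 hc hsurj fun m => (hconn m).isPreconnected,
    fun hsc => ⟨LieAlgebroid.injective_pullbackH1 hc hsurj fun m => ?_,
      LieAlgebroid.surjective_pullbackH1 hc hsurj hsc⟩⟩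
  exact isPreconnected_iff_preconnectedSpace.2 inferInstance
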